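/- Let $L f=-\nu f+Kf$ with $Kf(x,v)=\int_{\mathbb R^3}k(v,v^*)f(x,v^*)\,dv^*$, where $\nu:\mathbb R^3\to\mathbb R$ is differentiable, $k:\mathbb R^3\times\mathbb R^3\to\mathbb R$ is measurable, and $k(\cdot,v^*)$ is differentiable at every $v\ne v^*$. Suppose that for some $0<\rho<1$, $0\le\gamma\le1$ and positive constants $\nu_0,\nu_1,C_0$, for all $v\neq v^*$, \begin{gather*} \nu_0(1+|v|)^\gamma\le\nu(v)\le\nu_1(1+|v|)^\gamma,\qquad |\nabla_v\nu(v)|\le C_0(1+|v|)^{\gamma-1},\\ |k(v,v^*)|\le \frac{C_0\,E_\rho(v,v^*)}{|v-v^*|(1+|v|+|v^*|)^{1-\gamma}},\qquad |\nabla_vk(v,v^*)|\le \frac{C_0(1+|v|)\,E_\rho(v,v^*)}{|v-v^*|^2(1+|v|+|v^*|)^{1-\gamma}},\\ E_\rho(v,v^*)=\exp\Big(-\tfrac{1-\rho}{4}\Big(|v-v^*|^2+\Big(\tfrac{|v|^2-|v^*|^2}{|v-v^*|}\Big)^2\Big)\Big). \end{gather*} For a bounded convex domain $\Omega\subset\mathbb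 R^3$ with $C^2$ boundary put $\tau(x,v)=\inf\{s>0: x-sv\notin\Omega\}$ and $$S_\Omega f(x,v)=\int_0^{\tau(x,v)}e^{-\nu(v)s}f(x-sv,v)\,ds .$$ For $1\le p<\infty$ and $\alpha\ge0$ let $$\|f\|_{L^p_\alpha(\Omega\times\mathbb R^3)}^p=\int_{\Omega\times\mathbb R^3}|f|^pe^{p\alpha|v|^2}\,dx\,dv,\qquad \|f\|_{L^p_\alpha(\partial\Omega\times\mathbb R^3)}^p=\int_{\partial\Omega\times\mathbb R^3}|f|^pe^{p\alpha|v|^2}\,d\Sigma(z)\,dv,$$ $$\|f\|_{W^{1,p}_\alpha(\Omega\times\mathbb R^3)}=\|f\|_{L^p_\alpha(\Omega\times\mathbb R^3)}+\|\nabla_xf\|_{L^p_\alpha(\Omega\times\mathbb R^3)}+\|\nabla_vf\|_{L^p_\alpha(\Omega\times\mathbb R^3)},$$ where $\Sigma$ is the surface measure of $\partial\Omega$, the gradients are weak gradients, and on $\partial\Omega\times\mathbb R^3$ a Sobolev function is understood as its trace. Let $1\le p<2$ and $0\le\alpha<(1-\rho)/2$. Then there is a constant $C$, depending only on $\nu,k,\rho,\gamma,p,\alpha$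 (and not on $\Omega$ or $h$), such that for every bounded convex domain $\Omega\subset\mathbb R^3$ with $C^2$ boundary and every $h\in W^{1,p}_\alpha(\Omega\times\mathbb R^3)$, $$\|S_\Omega Kh\|_{W^{1,p}_\alpha(\Omega\times\mathbb R^3)}\le C\Big(\operatorname{diam}(\Omega)^{1/p}\|h\|_{W^{1,p}_\alpha(\Omega\times\mathbb R^3)}+\|h\|_{L^p_\alpha(\Omega\times\mathbb R^3)}+\operatorname{diam}(\Omega)^{1/p}\|h\|_{L^p_\alpha(\partial\Omega\times\mathbb R^3)}\Big).$$ -/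

import Mathlib

open MeasureTheory Set Filter Topology
open scoped ENNReal NNReal ContDiff

noncomputable section

namespace StationaryBoltzmann

/-- Euclidean three-space; it serves both as position space and as velocity space. -/
abbrev E3 : Type := EuclideanSpace ℝ (Fin 3)

/-- `E_ρ(v, v*) = exp (-(1-ρ)/4 (|v-v*|² + ((|v|²-|v*|²)/|v-v*|)²))`, only used for `v ≠ v*`. -/
def gaussFactor (ρ : ℝ) (v w : E3) : ℝ :=
  Real.exp (-((1 - ρ) / 4) * (‖v - w‖ ^ 2 + ((‖v‖ ^ 2 - ‖w‖ ^ 2) / ‖v - w‖) ^ 2))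

/-- The structural assumption on the collision frequency `ν` and on the collision kernel `k` of
the linearized collision operator `L f = - ν f + K f`. The bounds on `k` and on its gradient in
`v` are required off the diagonal, where `k` is singular. -/
structure CollisionAssumption (ρ γ : ℝ) (ν : E3 → ℝ) (k : E3 → E3 → ℝ) : Prop where
  rho_pos : 0 < ρ
  rho_lt_one : ρ < 1
  gamma_nonneg : 0 ≤ γ
  gamma_le_one : γ ≤ 1
  measurable_kernel : Measurable (Function.uncurry k)
  differentiable_nu : Differentiable ℝ ν
  differentiableAt_kernel : ∀ v w : E3, v ≠ w → DifferentiableAt ℝ (fun u => k u w) v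
  nu_bounds : ∃ ν₀ > 0, ∃ ν₁ > 0, ∀ v : E3,
    ν₀ * (1 + ‖v‖) ^ γ ≤ ν v ∧ ν v ≤ ν₁ * (1 + ‖v‖) ^ γ
  kernel_bound : ∃ C > 0, ∀ v w : E3, v ≠ w →
    |k v w| ≤ C * (1 / (‖v - w‖ * (1 + ‖v‖ + ‖w‖) ^ (1 - γ)) * gaussFactor ρ v w)
  grad_kernel_bound : ∃ C > 0, ∀ v w : E3, v ≠ w →
    ‖fderiv ℝ (fun u => k u w) v‖ ≤
      C * ((1 + ‖v‖) / (‖v - w‖ ^ 2 * (1 + ‖v‖ + ‖w‖) ^ (1 - γ)) * gaussFactor ρ v w)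
  grad_nu_bound : ∃ C > 0, ∀ v : E3, ‖fderiv ℝ ν v‖ ≤ C * (1 + ‖v‖) ^ (γ - 1)

/-- The integral operator `K f (x, v) = ∫ k(v, v*) f(x, v*) dv*`. -/
def opK (k : E3 → E3 → ℝ) (f : E3 × E3 → ℝ) : E3 × E3 → ℝ :=
  fun z => ∫ w : E3, k z.2 w * f (z.1, w)

/-- The backward exit time `τ(x, v) = inf {s > 0 | x - s v ∉ Ω}`. (For bounded `Ω` and `x ∈ Ω`
the set is empty only on the null set `v = 0`.) -/
def exitTime (Ω : Set E3) (x v : E3) : ℝ :=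
  sInf {s : ℝ | 0 < s ∧ x - s • v ∉ Ω}

/-- The transport operator `S_Ω f (x, v) = ∫_0^{τ(x,v)} e^{-ν(v) s} f(x - s v, v) ds`. -/
def opS (ν : E3 → ℝ) (Ω : Set E3) (f : E3 × E3 → ℝ) : E3 × E3 → ℝ :=
  fun z => ∫ s in (0 : ℝ)..exitTime Ω z.1 z.2,
    Real.exp (-(ν z.2 * s)) * f (z.1 - s • z.2, z.2)

/-- `∂Ω` is of class `C²`: near each boundary point, after an orthogonal change of coordinates,
`Ω` is the region above the graph of a `C²` function of two variables. -/
def HasC2Boundary (Ω : Set E3) : Prop :=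
  ∀ z ∈ frontier Ω, ∃ r > 0, ∃ e : E3 ≃ₗᵢ[ℝ] E3, ∃ ψ : EuclideanSpace ℝ (Fin 2) → ℝ,
    ContDiff ℝ 2 ψ ∧ ∀ x ∈ Metric.ball z r, x ∈ Ω ↔ ψ !₂[e x 0, e x 1] < e x 2

/-- Bounded convex domains of `ℝ³` with `C²` boundary. -/
structure IsConvexC2Domain (Ω : Set E3) : Prop where
  isOpen : IsOpen Ω
  nonempty : Ω.Nonempty
  convex : Convex ℝ Ω
  isBounded : Bornology.IsBounded Ω
  boundary : HasC2Boundary Ω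

/-- Lebesgue measure on the phase space `Ω × ℝ³`. -/
def phaseMeasure (Ω : Set E3) : Measure (E3 × E3) :=
  volume.restrict (Ω ×ˢ univ)

/-- The measure `dΣ(z) dv` on `∂Ω × ℝ³`, where `Σ` is the surface measure, that is, the
two-dimensional Hausdorff measure with the Euclidean normalization, on `∂Ω`. -/
def boundaryMeasure (Ω : Set E3) : Measure (E3 × E3) :=
  ((Measure.euclideanHausdorffMeasure 2).restrict (frontier Ω)).prod volume

/-- The weighted norm `(∫ |f(x, v)|^p e^{p α |v|²} dμ)^{1/p}`, with values in `[0, ∞]`. -/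
def weightedLpNorm {F : Type*} [NormedAddCommGroup F] (p α : ℝ) (μ : Measure (E3 × E3))
    (f : E3 × E3 → F) : ℝ≥0∞ :=
  (∫⁻ z, ‖f z‖ₑ ^ p * ENNReal.ofReal (Real.exp (p * α * ‖z.2‖ ^ 2)) ∂μ) ^ (1 / p)

/-- `Gx` and `Gv` are the weak gradients `∇ₓ f` and `∇ᵥ f` of `f` on `Ω × ℝ³`. -/
structure HasWeakGradient (Ω : Set E3) (f : E3 × E3 → ℝ) (Gx Gv : E3 × E3 → E3) : Prop where
  locallyIntegrable : LocallyIntegrableOn f (Ω ×ˢ univ)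
  locallyIntegrable_x : LocallyIntegrableOn Gx (Ω ×ˢ univ)
  locallyIntegrable_v : LocallyIntegrableOn Gv (Ω ×ˢ univ)
  deriv_x : ∀ φ : E3 × E3 → ℝ, ContDiff ℝ ∞ φ → HasCompactSupport φ →
    tsupport φ ⊆ Ω ×ˢ univ → ∀ w : E3,
      ∫ z in Ω ×ˢ univ, f z * fderiv ℝ φ z (w, 0) = -∫ z in Ω ×ˢ univ, inner ℝ (Gx z) w * φ z
  deriv_v : ∀ φ : E3 × E3 → ℝ, ContDiff ℝ ∞ φ → HasCompactSupport φ →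
    tsupport φ ⊆ Ω ×ˢ univ → ∀ w : E3,
      ∫ z in Ω ×ˢ univ, f z * fderiv ℝ φ z (0, w) = -∫ z in Ω ×ˢ univ, inner ℝ (Gv z) w * φ z

/-- The norm of `W^{1,p}_α(Ω × ℝ³)`. The weak gradients are unique up to null sets, so that the
infimum runs over a single value; it is `∞` if `f` is not weakly differentiable. -/
def sobolevNorm (p α : ℝ) (Ω : Set E3) (f : E3 × E3 → ℝ) : ℝ≥0∞ :=
  ⨅ (Gx : E3 × E3 → E3) (Gv : E3 × E3 → E3) (_ : HasWeakGradient Ω f Gx Gv),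
    weightedLpNorm p α (phaseMeasure Ω) f + weightedLpNorm p α (phaseMeasure Ω) Gx
      + weightedLpNorm p α (phaseMeasure Ω) Gv

/-- `f ∈ W^{1,p}_α(Ω × ℝ³)`. -/
def MemSobolev (p α : ℝ) (Ω : Set E3) (f : E3 × E3 → ℝ) : Prop :=
  sobolevNorm p α Ω f < ⊤

/-- `g` is the trace of `f ∈ W^{1,p}(Ω × ℝ³)` on `∂Ω × ℝ³`: some sequence of smooth compactly
supported functions on `ℝ³ × ℝ³` converges to `f` in `W^{1,p}(Ω × ℝ³)`, while its restrictions
converge to `g` in `L^p(∂Ω × ℝ³)`. -/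
def IsTrace (p : ℝ) (Ω : Set E3) (f g : E3 × E3 → ℝ) : Prop :=
  AEStronglyMeasurable g (boundaryMeasure Ω) ∧
  ∃ φ : ℕ → E3 × E3 → ℝ, (∀ n, ContDiff ℝ ∞ (φ n) ∧ HasCompactSupport (φ n)) ∧
    Tendsto (fun n => sobolevNorm p 0 Ω (f - φ n)) atTop (𝓝 0) ∧
    Tendsto (fun n => weightedLpNorm p 0 (boundaryMeasure Ω) (g - φ n)) atTop (𝓝 0)

/-- The norm `‖f‖_{L^p_α(∂Ω × ℝ³)}` of the trace of `f`. The trace of a function in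
`W^{1,p}(Ω × ℝ³)` exists and is unique up to null sets, so that the infimum runs over a single
value. -/
def traceNorm (p α : ℝ) (Ω : Set E3) (f : E3 × E3 → ℝ) : ℝ≥0∞ :=
  ⨅ (g : E3 × E3 → ℝ) (_ : IsTrace p Ω f g), weightedLpNorm p α (boundaryMeasure Ω) g

end StationaryBoltzmann

end

open StationaryBoltzmann

open MeasureTheory Set Filter Topology
open scoped ENNReal NNReal ContDiff

noncomputable section

namespace StationaryBoltzmann

section

/-! ### Singular Gaussian integrals -/

/-! By convexity a backward trajectory leaves Ω once and for all, so S_Ω K h(x,v) is the integral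
over w and s > 0 of 1_Ω(x - sv) e^{-ν(v)s} k(v,w) h(x - sv, w). Differentiate it in a phase space
direction (a,b). The derivative can fall on e^{-νs} k, on h, or on the exit time τ. It reaches h
only through the position, since the velocity argument of h is integrated out; hence ∇_v h is never
needed. The derivative of τ is n·(a - τb)/(n·v), with n the outer normal at the exit point, and it
multiplies the trace of h there.

Each of these terms is an integral operator, bounded on the weighted spaces by a Schur test. The
weight passes from v to w at the cost of part of the Gaussian decay of the kernel
(`gaussFactor_mul_exp_le`), leaving singularities |v-w|^{-1} and |v-w|^{-2} times a Gaussian,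
integrable in three dimensions. Three mechanisms give the sizes. (1) The growth 1+|v| of ∇_v k is
compensated up to a factor ν(v), and the time integral of ν e^{-νs/2} is 2 (`kernelBound_of_nu`);
this costs only the norm of h in L^p. (2) A particle of speed |v| stays in Ω for at most diam(Ω)/|v|
(`exists_kernelBound_diam`). This enters one of the two Schur integrals, whence diam(Ω)^{1/p} in
front of ∇_x h. (3) For fixed v the exit map pushes volume forward to at most a constant times
diam(Ω)|n·v|/|v| dΣ (`IsConvexC2Domain.lintegral_exitPoint_le`). Against |n·v|^{-p} from the
derivative of τ this leaves |n·v|^{1-p}/|v|, integrable in v together with |v-w|^{-1} because p < 2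
(`exists_lintegral_grazing_le`). The constants do not see the shape of Ω.

That these expressions are the weak derivatives is shown first for smooth compactly supported h:
with w frozen, the product of a test function and the transport integral is differentiable along
almost every line, and integrals of such line derivatives vanish (`testPairing_smooth`). All
pairings are continuous in h, its gradient and its trace, so the identity survives the limit along
the smooth sequence defining the trace (`testPairing_weak`). -/

lemma lintegral_coord_prod {f g h : ℝ → ℝ≥0∞} (hf : Measurable f) (hg : Measurable g)
    (hh : Measurable h) :
    ∫⁻ v : E3, f (v 0) * g (v 1) * h (v 2) = (∫⁻ t, f t) * (∫⁻ t, g t) * ∫⁻ t, h t := by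
  have e1 := (PiLp.volume_preserving_ofLp (Fin 3)).lintegral_comp
    (f := fun v : Fin 3 → ℝ => f (v 0) * g (v 1) * h (v 2)) (by fun_prop)
  have e2 := (volume_preserving_piFinSuccAbove (fun _ : Fin 3 => ℝ) 0).lintegral_comp
    (f := fun q : ℝ × (Fin 2 → ℝ) => f q.1 * (g (q.2 0) * h (q.2 1))) (by fun_prop)
  have e3 := (volume_preserving_finTwoArrow ℝ).lintegral_comp
    (f := fun q : ℝ × ℝ => g q.1 * h q.2) (by fun_prop)
  have e4 : ∫⁻ v : E3, f (v 0) * g (v 1) * h (v 2) =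
      ∫⁻ v : Fin 3 → ℝ, f (v 0) * g (v 1) * h (v 2) := e1
  have e5 : ∫⁻ v : Fin 3 → ℝ, f (v 0) * g (v 1) * h (v 2) =
      ∫⁻ q : ℝ × (Fin 2 → ℝ), f q.1 * (g (q.2 0) * h (q.2 1)) := by
    rw [← e2]
    refine lintegral_congr fun v => ?_
    simp [MeasurableEquiv.piFinSuccAbove, mul_assoc, Fin.tail]
  have e6 : ∫⁻ q : Fin 2 → ℝ, g (q 0) * h (q 1) = ∫⁻ q : ℝ × ℝ, g q.1 * h q.2 := e3
  rw [e4, e5, Measure.volume_eq_prod, lintegral_prod_mul (g := fun q : Fin 2 → ℝ => g (q 0) * h (q 1)) hf.aemeasurable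
      (by fun_prop), e6,
    Measure.volume_eq_prod, lintegral_prod_mul hg.aemeasurable hh.aemeasurable, mul_assoc]

lemma rpow_neg_anti {x y : ℝ≥0∞} (h : x ≤ y) {b : ℝ} (hb : 0 ≤ b) : y ^ (-b) ≤ x ^ (-b) := by
  rw [ENNReal.rpow_neg, ENNReal.rpow_neg]
  exact ENNReal.inv_le_inv.2 (ENNReal.rpow_le_rpow h hb)

lemma lintegral_rpow_neg_lt_top {d : ℝ} (hd1 : d < 1) :
    ∫⁻ t in Icc (-1 : ℝ) 1, ‖t‖ₑ ^ (-d) < ⊤ := by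
  have h1 : ∫⁻ t in Ioc (0 : ℝ) 1, ‖t‖ₑ ^ (-d) < ⊤ := by
    have := (intervalIntegral.intervalIntegrable_rpow' (a := 0) (b := 1) (r := -d) (by linarith))
    rw [intervalIntegrable_iff_integrableOn_Ioc_of_le zero_le_one] at this
    refine lt_of_le_of_lt (le_of_eq ?_) this.2
    refine setLIntegral_congr_fun measurableSet_Ioc fun t ht => ?_
    simp only [Real.enorm_eq_ofReal_abs, abs_of_pos ht.1, abs_of_nonneg (Real.rpow_nonneg ht.1.le _)]
    rw [ENNReal.ofReal_rpow_of_pos ht.1]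
  have h2 : ∫⁻ t in Ico (-1 : ℝ) 0, ‖t‖ₑ ^ (-d) = ∫⁻ t in Ioc (0 : ℝ) 1, ‖t‖ₑ ^ (-d) := by
    have := (Measure.measurePreserving_neg (volume : Measure ℝ)).setLIntegral_comp_preimage
      (s := Ioc (0 : ℝ) 1) (f := fun t => ‖t‖ₑ ^ (-d)) measurableSet_Ioc (by fun_prop)
    simpa using this
  have h3 : Icc (-1 : ℝ) 1 = Ico (-1) 0 ∪ ({0} ∪ Ioc 0 1) := by
    ext t; simp only [mem_Icc, mem_union, mem_Ico, mem_singleton_iff, mem_Ioc]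
    constructor
    · rintro ⟨a, b⟩
      rcases lt_trichotomy t 0 with h | h | h
      · exact .inl ⟨a, h⟩
      · exact .inr (.inl h)
      · exact .inr (.inr ⟨h, b⟩)
    · rintro (⟨a, b⟩ | rfl | ⟨a, b⟩) <;> constructor <;> linarith
  rw [h3]
  refine (lintegral_union_le _ _ _).trans_lt (ENNReal.add_lt_top.2 ⟨h2 ▸ h1, ?_⟩)
  refine (lintegral_union_le _ _ _).trans_lt (ENNReal.add_lt_top.2 ⟨by simp, h1⟩)

lemma lintegral_gauss_lt_top {δ : ℝ} (hδ : 0 < δ) :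
    ∫⁻ t : ℝ, ENNReal.ofReal (Real.exp (-δ * t ^ 2)) < ⊤ := by
  have := (integrable_exp_neg_mul_sq hδ).2
  refine lt_of_le_of_lt (le_of_eq (lintegral_congr fun t => ?_)) this
  rw [Real.enorm_eq_ofReal_abs, abs_of_pos (Real.exp_pos _)]

/-- Bounding the larger distance below by the smaller one gives |t|^{-a} |t-c|^{-b} ≤ |t|^{-(a+b)} +
|t-c|^{-(a+b)}. Each summand is at most 1 plus an integrable bump near its singularity, and
translation invariance makes the result uniform in c. -/
lemma exists_lintegral_singular_gauss_le {a b δ : ℝ} (ha : 0 ≤ a) (hb : 0 ≤ b) (hab : a + b < 1)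
    (hδ : 0 < δ) : ∃ C : ℝ≥0, ∀ c : ℝ,
      ∫⁻ t : ℝ, ‖t‖ₑ ^ (-a) * ‖t - c‖ₑ ^ (-b) * ENNReal.ofReal (Real.exp (-δ * (t - c) ^ 2))
        ≤ C := by
  set d := a + b
  set I : ℝ → ℝ≥0∞ := (Icc (-1 : ℝ) 1).indicator fun t => ‖t‖ₑ ^ (-d)
  set G : ℝ → ℝ≥0∞ := fun t => ENNReal.ofReal (Real.exp (-δ * t ^ 2))
  have hI : Measurable I := Measurable.indicator (by fun_prop) measurableSet_Icc
  have hG : Measurable G := by fun_prop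
  have hG1 : ∀ t, G t ≤ 1 := fun t => by
    simp only [G, ENNReal.ofReal_le_one, Real.exp_le_one_iff]
    nlinarith [sq_nonneg t]
  have hI1 : ∫⁻ t, I t < ⊤ := by
    rw [lintegral_indicator measurableSet_Icc]; exact lintegral_rpow_neg_lt_top hab
  have hd0 : 0 ≤ d := add_nonneg ha hb
  have hpow : ∀ t : ℝ, ‖t‖ₑ ^ (-d) ≤ 1 + I t := by
    intro t
    by_cases ht : t ∈ Icc (-1 : ℝ) 1
    · simp [I, ht]
    · refine le_add_right ?_
      rw [ENNReal.rpow_neg, ENNReal.inv_le_one]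
      rcases hd0.eq_or_lt with h0 | h0
      · simp [← h0]
      · refine ENNReal.one_le_rpow ?_ h0
        rw [Real.enorm_eq_ofReal_abs, ENNReal.one_le_ofReal]
        by_contra h
        exact ht (abs_le.1 (not_le.1 h).le)
  have hmix : ∀ t c : ℝ, ‖t‖ₑ ^ (-a) * ‖t - c‖ₑ ^ (-b) ≤ ‖t‖ₑ ^ (-d) + ‖t - c‖ₑ ^ (-d) := by
    have key : ∀ x y : ℝ≥0∞, x ≠ ⊤ → y ≠ ⊤ → x ≤ y → x ^ (-a) * y ^ (-b) ≤ x ^ (-d) := by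
      intro x y hx hy hxy
      calc x ^ (-a) * y ^ (-b) ≤ x ^ (-a) * x ^ (-b) := by
            exact mul_le_mul_right (rpow_neg_anti hxy hb) _
        _ = x ^ (-d) := by
            rw [ENNReal.rpow_neg, ENNReal.rpow_neg, ENNReal.rpow_neg, ← ENNReal.mul_inv,
              ← ENNReal.rpow_add_of_nonneg _ _ ha hb]
            · right; exact ENNReal.rpow_ne_top_of_nonneg hb hx
            · left; exact ENNReal.rpow_ne_top_of_nonneg ha hx
    intro t c
    rcases le_total ‖t‖ₑ ‖t - c‖ₑ with h | h
    · exact (key _ _ (by simp) (by simp) h).trans le_self_add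
    · refine le_trans ?_ le_add_self
      calc _ ≤ ‖t - c‖ₑ ^ (-a) * ‖t - c‖ₑ ^ (-b) := by
            exact mul_le_mul_left (rpow_neg_anti h ha) _
        _ ≤ _ := key _ _ (by simp) (by simp) le_rfl
  refine ⟨(2 * (∫⁻ t, G t) + 2 * ∫⁻ t, I t).toNNReal, fun c => ?_⟩
  rw [ENNReal.coe_toNNReal (by
    have := lintegral_gauss_lt_top hδ
    exact (ENNReal.add_lt_top.2 ⟨ENNReal.mul_lt_top (by simp) this,
      ENNReal.mul_lt_top (by simp) hI1⟩).ne)]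
  calc ∫⁻ t : ℝ, ‖t‖ₑ ^ (-a) * ‖t - c‖ₑ ^ (-b) * ENNReal.ofReal (Real.exp (-δ * (t - c) ^ 2))
      ≤ ∫⁻ t : ℝ, (2 * G (t - c) + (I t + I (t - c))) := by
        refine lintegral_mono fun t => ?_
        calc _ ≤ ((1 + I t) + (1 + I (t - c))) * G (t - c) := by
              refine mul_le_mul' ((hmix t c).trans (add_le_add (hpow t) (hpow (t - c)))) le_rfl
          _ = 2 * G (t - c) + (I t + I (t - c)) * G (t - c) := by ring
          _ ≤ _ := by
              gcongr
              exact mul_le_of_le_one_right' (hG1 _)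
    _ = _ := by
        rw [lintegral_add_left (by fun_prop), lintegral_add_left hI, lintegral_const_mul _ (by fun_prop),
          lintegral_sub_right_eq_self (fun t => G t), lintegral_sub_right_eq_self (fun t => I t), two_mul (∫⁻ t, I t)]

/-- The singular Gaussian `|u|^{-d} e^{-δ|u|²}`. -/
def singGauss (δ d : ℝ) (u : E3) : ℝ≥0∞ :=
  ‖u‖ₑ ^ (-d) * ENNReal.ofReal (Real.exp (-δ * ‖u‖ ^ 2))

lemma measurable_singGauss (δ d : ℝ) : Measurable (singGauss δ d) := by
  unfold singGauss; fun_prop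

/-- The reflection exchanging n with the third basis vector. It reduces every question about a
normal direction to a coordinate axis. -/
lemma exists_isometry_coord {n : E3} (hn : ‖n‖ = 1) :
    ∃ e : E3 ≃ₗᵢ[ℝ] E3, ∀ v, inner ℝ n v = e v 2 := by
  refine ⟨Submodule.reflection (ℝ ∙ (n - EuclideanSpace.single 2 1))ᗮ, fun v => ?_⟩
  have : (Submodule.reflection (ℝ ∙ (n - EuclideanSpace.single 2 1))ᗮ) n
      = EuclideanSpace.single 2 1 := Submodule.reflection_sub (by simp [hn])
  rw [← LinearIsometryEquiv.inner_map_map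
    (Submodule.reflection (ℝ ∙ (n - EuclideanSpace.single 2 1))ᗮ), this,
    EuclideanSpace.inner_single_left]
  simp

lemma exp_norm_sq_eq (δ : ℝ) (u : E3) :
    ENNReal.ofReal (Real.exp (-δ * ‖u‖ ^ 2)) = ENNReal.ofReal (Real.exp (-δ * u 0 ^ 2)) *
      ENNReal.ofReal (Real.exp (-δ * u 1 ^ 2)) * ENNReal.ofReal (Real.exp (-δ * u 2 ^ 2)) := by
  rw [← ENNReal.ofReal_mul (Real.exp_nonneg _), ← ENNReal.ofReal_mul (by positivity),
    ← Real.exp_add, ← Real.exp_add, EuclideanSpace.norm_sq_eq, Fin.sum_univ_three]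
  simp only [Real.norm_eq_abs, sq_abs]
  ring_nf

/-- Each coordinate is at most the norm, so a radial singularity can be shared out among the axes at
will. This turns singular integrals over space into products of one-dimensional ones. -/
lemma rpow_neg_norm_le (u : E3) {x y z : ℝ} (hx : 0 ≤ x) (hy : 0 ≤ y) (hz : 0 ≤ z) :
    ‖u‖ₑ ^ (-(x + y + z)) ≤ ‖u 0‖ₑ ^ (-x) * ‖u 1‖ₑ ^ (-y) * ‖u 2‖ₑ ^ (-z) := by
  have hc : ∀ i, ‖u i‖ₑ ≤ ‖u‖ₑ := fun i => by
    rw [enorm_le_iff_norm_le]; exact PiLp.norm_apply_le u i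
  have ht : ‖u‖ₑ ≠ ⊤ := enorm_ne_top
  have h1 : ‖u‖ₑ ^ (-(x + y + z)) = ‖u‖ₑ ^ (-x) * ‖u‖ₑ ^ (-y) * ‖u‖ₑ ^ (-z) := by
    simp only [ENNReal.rpow_neg]
    rw [ENNReal.rpow_add_of_nonneg _ _ (by positivity) hz, ENNReal.rpow_add_of_nonneg _ _ hx hy,
      ENNReal.mul_inv, ENNReal.mul_inv]
    · right; exact ENNReal.rpow_ne_top_of_nonneg hy ht
    · left; exact ENNReal.rpow_ne_top_of_nonneg hx ht
    · right; exact ENNReal.rpow_ne_top_of_nonneg hz ht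
    · left; exact ENNReal.mul_ne_top (ENNReal.rpow_ne_top_of_nonneg hx ht)
        (ENNReal.rpow_ne_top_of_nonneg hy ht)
  rw [h1]
  exact mul_le_mul' (mul_le_mul' (rpow_neg_anti (hc 0) hx) (rpow_neg_anti (hc 1) hy))
    (rpow_neg_anti (hc 2) hz)

lemma exists_lintegral_coord_singular_le {a b a' b' δ : ℝ} (ha : 0 ≤ a) (hb : 0 ≤ b)
    (hab : a + b < 1) (ha' : 0 ≤ a') (hb' : 0 ≤ b') (hab' : a' + b' < 1) (hδ : 0 < δ) :
    ∃ C : ℝ≥0, ∀ w : E3, ∫⁻ v : E3,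
      (‖v 0‖ₑ ^ (-a) * ‖v 0 - w 0‖ₑ ^ (-b) * ENNReal.ofReal (Real.exp (-δ * (v 0 - w 0) ^ 2))) *
      (‖v 1‖ₑ ^ (-a) * ‖v 1 - w 1‖ₑ ^ (-b) * ENNReal.ofReal (Real.exp (-δ * (v 1 - w 1) ^ 2))) *
      (‖v 2‖ₑ ^ (-a') * ‖v 2 - w 2‖ₑ ^ (-b') *
        ENNReal.ofReal (Real.exp (-δ * (v 2 - w 2) ^ 2))) ≤ C := by
  obtain ⟨C, hC⟩ := exists_lintegral_singular_gauss_le ha hb hab hδ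
  obtain ⟨C', hC'⟩ := exists_lintegral_singular_gauss_le ha' hb' hab' hδ
  refine ⟨C * C * C', fun w => ?_⟩
  rw [lintegral_coord_prod
    (f := fun t => ‖t‖ₑ ^ (-a) * ‖t - w 0‖ₑ ^ (-b) *
      ENNReal.ofReal (Real.exp (-δ * (t - w 0) ^ 2)))
    (g := fun t => ‖t‖ₑ ^ (-a) * ‖t - w 1‖ₑ ^ (-b) *
      ENNReal.ofReal (Real.exp (-δ * (t - w 1) ^ 2)))
    (h := fun t => ‖t‖ₑ ^ (-a') * ‖t - w 2‖ₑ ^ (-b') *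
      ENNReal.ofReal (Real.exp (-δ * (t - w 2) ^ 2)))
    (by fun_prop) (by fun_prop) (by fun_prop)]
  push_cast
  exact mul_le_mul' (mul_le_mul' (hC _) (hC _)) (hC' _)

/-- Shared evenly, the singularity costs each axis the exponent d/3 < 1. -/
lemma lintegral_singGauss_lt_top {δ d : ℝ} (hδ : 0 < δ) (hd0 : 0 ≤ d) (hd : d < 3) :
    ∫⁻ u, singGauss δ d u < ⊤ := by
  obtain ⟨C, hC⟩ := exists_lintegral_coord_singular_le (a := 0) (b := d / 3) (a' := 0)
    (b' := d / 3) le_rfl (by positivity) (by linarith) le_rfl (by positivity) (by linarith) hδ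
  refine lt_of_le_of_lt ((lintegral_mono fun u => ?_).trans (hC 0)) ENNReal.coe_lt_top
  have h1 := rpow_neg_norm_le u (x := d / 3) (y := d / 3) (z := d / 3) (by positivity)
    (by positivity) (by positivity)
  rw [show d / 3 + d / 3 + d / 3 = d by ring] at h1
  rw [singGauss, exp_norm_sq_eq]
  refine (mul_le_mul_left h1 _).trans (le_of_eq ?_)
  simp only [neg_zero, ENNReal.rpow_zero, PiLp.zero_apply, sub_zero]
  ring

/-- The integral that controls the grazing singularity `|n·v|^{1-p}` of the boundary terms. -/
lemma exists_lintegral_grazing_le {p δ : ℝ} (hp1 : 1 ≤ p) (hp2 : p < 2) (hδ : 0 < δ) :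
    ∃ C : ℝ≥0, ∀ n : E3, ‖n‖ = 1 → ∀ w : E3,
      ∫⁻ v : E3, ‖(inner ℝ n v : ℝ)‖ₑ ^ (1 - p) * ‖v‖ₑ⁻¹ * singGauss δ 1 (v - w) ≤ C := by
  -- The normal axis already carries p - 1, so it receives only the share θ of |v|^{-1} and nothing
  -- of |v-w|^{-1}: its total is p/2 < 1. Each tangential axis gets (1-θ)/2 from |v|^{-1} and 1/2
  -- from |v-w|^{-1}, in all 1 - θ/2 < 1. Positivity of θ is the condition p < 2.
  set θ := (2 - p) / 2
  have hθ0 : 0 < θ := by simp only [θ]; linarith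
  have hθ1 : θ ≤ 1 / 2 := by simp only [θ]; linarith
  obtain ⟨C, hC⟩ := exists_lintegral_coord_singular_le (a := (1 - θ) / 2) (b := 1 / 2)
    (a' := (p - 1) + θ) (b' := 0) (by linarith) (by norm_num) (by linarith) (by linarith) le_rfl
    (by simp only [θ]; linarith) hδ
  refine ⟨C, fun n hn w => ?_⟩
  obtain ⟨e, he⟩ := exists_isometry_coord hn
  refine le_trans ((lintegral_mono fun v => ?_).trans
    (e.measurePreserving.lintegral_comp (by fun_prop)).le) (hC (e w))
  have h1 := rpow_neg_norm_le (e v) (x := (1 - θ) / 2) (y := (1 - θ) / 2) (z := θ) (by linarith)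
    (by linarith) hθ0.le
  rw [show (1 - θ) / 2 + (1 - θ) / 2 + θ = 1 by ring] at h1
  have h2 := rpow_neg_norm_le (e (v - w)) (x := 1 / 2) (y := 1 / 2) (z := 0) (by norm_num)
    (by norm_num) le_rfl
  rw [show (1 / 2 : ℝ) + 1 / 2 + 0 = 1 by norm_num] at h2
  have h3 : ‖e v 2‖ₑ ^ (-((p - 1) + θ)) = ‖e v 2‖ₑ ^ (1 - p) * ‖e v 2‖ₑ ^ (-θ) := by
    rw [show 1 - p = -(p - 1) by ring]
    simp only [ENNReal.rpow_neg]
    rw [ENNReal.rpow_add_of_nonneg _ _ (by linarith) hθ0.le, ENNReal.mul_inv]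
    · right; exact ENNReal.rpow_ne_top_of_nonneg hθ0.le enorm_ne_top
    · left; exact ENNReal.rpow_ne_top_of_nonneg (by linarith) enorm_ne_top
  have hnv : ‖v‖ₑ = ‖e v‖ₑ := by rw [← ofReal_norm, ← ofReal_norm, e.norm_map]
  have hnvw : ‖v - w‖ = ‖e (v - w)‖ := by rw [e.norm_map]
  have hnvw' : ‖v - w‖ₑ = ‖e (v - w)‖ₑ := by rw [← ofReal_norm, ← ofReal_norm, e.norm_map]
  rw [he, singGauss, hnvw, exp_norm_sq_eq, hnv, hnvw', h3, ← ENNReal.rpow_neg_one]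
  refine (mul_le_mul' (mul_le_mul_right h1 _) (mul_le_mul_left h2 _)).trans (le_of_eq ?_)
  simp only [neg_zero, ENNReal.rpow_zero, map_sub, PiLp.sub_apply]
  ring

end

section

/-! ### Weighted bounds for the collision kernel -/

/-- The weight `e^{α|v|²}`. -/
def gaussWeight (α : ℝ) (v : E3) : ℝ≥0∞ := ENNReal.ofReal (Real.exp (α * ‖v‖ ^ 2))

lemma measurable_gaussWeight (α : ℝ) : Measurable (gaussWeight α) := by
  unfold gaussWeight; fun_prop

lemma gaussWeight_pos (α : ℝ) (v : E3) : gaussWeight α v ≠ 0 := by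
  simp [gaussWeight, Real.exp_pos]

lemma gaussWeight_ne_top (α : ℝ) (v : E3) : gaussWeight α v ≠ ⊤ := ENNReal.ofReal_ne_top

/-- With r = |v-w| and y = (|v|²-|w|²)/r one has α(|v|²-|w|²) = αyr ≤ (α/2)r² + (α/2)y². The y² term
is absorbed by the second part of the Gaussian because α/2 ≤ (1-ρ)/4, and the r² term leaves the
decay rate (1-ρ)/4 - α/2 > 0. -/
lemma gaussFactor_mul_exp_le {ρ α : ℝ} (hα0 : 0 ≤ α) (hα : α < (1 - ρ) / 2) {v w : E3}
    (hvw : v ≠ w) : gaussFactor ρ v w * Real.exp (α * ‖v‖ ^ 2) ≤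
      Real.exp (-((1 - ρ) / 4 - α / 2) * ‖v - w‖ ^ 2) * Real.exp (α * ‖w‖ ^ 2) := by
  have hr : 0 < ‖v - w‖ := norm_pos_iff.2 (sub_ne_zero.2 hvw)
  rw [gaussFactor, ← Real.exp_add, ← Real.exp_add, Real.exp_le_exp]
  set y := (‖v‖ ^ 2 - ‖w‖ ^ 2) / ‖v - w‖
  have hy : ‖v‖ ^ 2 - ‖w‖ ^ 2 = y * ‖v - w‖ := by simp only [y]; field_simp
  nlinarith [mul_nonneg hα0 (sq_nonneg (y - ‖v - w‖)), mul_nonneg (sub_nonneg.2 hα.le) (sq_nonneg y)]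

lemma singGauss_of_ne {δ : ℝ} (d : ℕ) {u : E3} (hu : u ≠ 0) :
    singGauss δ d u = ENNReal.ofReal ((‖u‖ ^ d)⁻¹ * Real.exp (-δ * ‖u‖ ^ 2)) := by
  have hr : 0 < ‖u‖ := norm_pos_iff.2 hu
  rw [singGauss, ENNReal.ofReal_mul (by positivity), ← ofReal_norm, ENNReal.rpow_neg,
    ENNReal.ofReal_rpow_of_pos hr, ENNReal.ofReal_inv_of_pos (by positivity), Real.rpow_natCast]

/-- The infinite value at the origin lets the kernel bounds below hold on the diagonal too, where
nothing is assumed about k. -/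
lemma singGauss_zero {δ d : ℝ} (hd : 0 < d) : singGauss δ d (0 : E3) = ⊤ := by
  simp [singGauss, ENNReal.zero_rpow_of_neg (neg_lt_zero.2 hd)]

variable {ρ γ : ℝ} {ν : E3 → ℝ} {k : E3 → E3 → ℝ}

lemma CollisionAssumption.exists_nu_lower (hL : CollisionAssumption ρ γ ν k) :
    ∃ ν₀ > 0, ∀ v, ν₀ ≤ ν v ∧ ν₀ * (1 + ‖v‖) ^ γ ≤ ν v := by
  obtain ⟨ν₀, h0, ν₁, -, h⟩ := hL.nu_bounds
  refine ⟨ν₀, h0, fun v => ⟨le_trans ?_ (h v).1, (h v).1⟩⟩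
  exact le_mul_of_one_le_right h0.le (Real.one_le_rpow (by simp) hL.gamma_nonneg)

lemma CollisionAssumption.nu_pos (hL : CollisionAssumption ρ γ ν k) (v : E3) : 0 < ν v := by
  obtain ⟨ν₀, h0, h⟩ := hL.exists_nu_lower
  exact h0.trans_le (h v).1

lemma CollisionAssumption.exists_fderiv_nu_le (hL : CollisionAssumption ρ γ ν k) :
    ∃ C > 0, ∀ v, ‖fderiv ℝ ν v‖ ≤ C := by
  obtain ⟨C, h0, h⟩ := hL.grad_nu_bound
  refine ⟨C, h0, fun v => (h v).trans (mul_le_of_le_one_right h0.le ?_)⟩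
  exact Real.rpow_le_one_of_one_le_of_nonpos (by simp) (by linarith [hL.gamma_le_one])

lemma CollisionAssumption.exists_kernel_le (hL : CollisionAssumption ρ γ ν k) {α : ℝ}
    (hα0 : 0 ≤ α) (hα : α < (1 - ρ) / 2) : ∃ C : ℝ≥0, ∀ v w,
      ‖k v w‖ₑ * gaussWeight α v ≤
        C * singGauss ((1 - ρ) / 4 - α / 2) 1 (v - w) * gaussWeight α w := by
  obtain ⟨C, hC0, hC⟩ := hL.kernel_bound
  refine ⟨C.toNNReal, fun v w => ?_⟩
  have hCe : (((C).toNNReal : ℝ≥0) : ℝ≥0∞) = ENNReal.ofReal (C) := rfl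
  rw [hCe]
  rcases eq_or_ne v w with rfl | hvw
  · rw [sub_self, singGauss_zero one_pos, ENNReal.mul_top (by simpa using hC0),
      ENNReal.top_mul (gaussWeight_pos _ _)]
    exact le_top
  have hr : 0 < ‖v - w‖ := norm_pos_iff.2 (sub_ne_zero.2 hvw)
  have hs := singGauss_of_ne (δ := (1 - ρ) / 4 - α / 2) 1 (sub_ne_zero.2 hvw)
  rw [Nat.cast_one] at hs
  rw [hs, gaussWeight, gaussWeight, Real.enorm_eq_ofReal_abs,
    ← ENNReal.ofReal_mul (abs_nonneg _), ← ENNReal.ofReal_mul hC0.le,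
    ← ENNReal.ofReal_mul (by positivity)]
  refine ENNReal.ofReal_le_ofReal ?_
  have h1 : 1 / (‖v - w‖ * (1 + ‖v‖ + ‖w‖) ^ (1 - γ)) ≤ (‖v - w‖ ^ 1)⁻¹ := by
    rw [pow_one, ← one_div]
    refine one_div_le_one_div_of_le hr (le_mul_of_one_le_right hr.le ?_)
    exact Real.one_le_rpow (by linarith [norm_nonneg v, norm_nonneg w])
      (by linarith [hL.gamma_le_one])
  have hg : 0 ≤ gaussFactor ρ v w := (Real.exp_pos _).le
  calc |k v w| * Real.exp (α * ‖v‖ ^ 2)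
      ≤ C * ((‖v - w‖ ^ 1)⁻¹ * gaussFactor ρ v w) * Real.exp (α * ‖v‖ ^ 2) := by
        gcongr
        exact (hC v w hvw).trans (by gcongr)
    _ = C * (‖v - w‖ ^ 1)⁻¹ * (gaussFactor ρ v w * Real.exp (α * ‖v‖ ^ 2)) := by ring
    _ ≤ C * (‖v - w‖ ^ 1)⁻¹ * (Real.exp (-((1 - ρ) / 4 - α / 2) * ‖v - w‖ ^ 2) *
          Real.exp (α * ‖w‖ ^ 2)) := by
        exact mul_le_mul_of_nonneg_left (gaussFactor_mul_exp_le hα0 hα hvw) (by positivity)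
    _ = _ := by ring

/-- Since (1+|v|)/(1+|v|+|w|)^{1-γ} ≤ (1+|v|)^γ ≤ ν(v)/ν₀, the growth of the gradient is no worse
than that of the collision frequency. The factor ν(v) is kept, to be spent on the time integral of
e^{-νs}. -/
lemma CollisionAssumption.exists_grad_kernel_le (hL : CollisionAssumption ρ γ ν k) {α : ℝ}
    (hα0 : 0 ≤ α) (hα : α < (1 - ρ) / 2) : ∃ C : ℝ≥0, ∀ v w,
      ‖fderiv ℝ (fun u => k u w) v‖ₑ * gaussWeight α v ≤
        C * ENNReal.ofReal (ν v) * singGauss ((1 - ρ) / 4 - α / 2) 2 (v - w) *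
          gaussWeight α w := by
  obtain ⟨C₁, hC0, hC⟩ := hL.grad_kernel_bound
  obtain ⟨ν₀, hν0, hν⟩ := hL.exists_nu_lower
  have hC' : 0 < C₁ / ν₀ := by positivity
  refine ⟨(C₁ / ν₀).toNNReal, fun v w => ?_⟩
  have hCe : (((C₁ / ν₀).toNNReal : ℝ≥0) : ℝ≥0∞) = ENNReal.ofReal (C₁ / ν₀) := rfl
  have hνv := hL.nu_pos v
  rw [hCe, ← ENNReal.ofReal_mul hC'.le]
  rcases eq_or_ne v w with rfl | hvw
  · rw [sub_self, singGauss_zero two_pos, ENNReal.mul_top (by simp; positivity),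
      ENNReal.top_mul (gaussWeight_pos _ _)]
    exact le_top
  have hr : 0 < ‖v - w‖ := norm_pos_iff.2 (sub_ne_zero.2 hvw)
  have hs := singGauss_of_ne (δ := (1 - ρ) / 4 - α / 2) 2 (sub_ne_zero.2 hvw)
  rw [Nat.cast_ofNat] at hs
  rw [hs, gaussWeight, gaussWeight, ← ofReal_norm,
    ← ENNReal.ofReal_mul (norm_nonneg _), ← ENNReal.ofReal_mul (by positivity),
    ← ENNReal.ofReal_mul (by positivity)]
  refine ENNReal.ofReal_le_ofReal ?_
  have hA : 0 < 1 + ‖v‖ := by positivity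
  have h1 : (1 + ‖v‖) / (‖v - w‖ ^ 2 * (1 + ‖v‖ + ‖w‖) ^ (1 - γ)) ≤
      (‖v - w‖ ^ 2)⁻¹ * (ν v / ν₀) := by
    have h2 : (1 + ‖v‖) ^ (1 - γ) ≤ (1 + ‖v‖ + ‖w‖) ^ (1 - γ) :=
      Real.rpow_le_rpow hA.le (by linarith [norm_nonneg w]) (by linarith [hL.gamma_le_one])
    have h3 : (1 + ‖v‖) ^ γ ≤ ν v / ν₀ := by
      rw [le_div_iff₀ hν0, mul_comm]; exact (hν v).2
    have h4 : (1 + ‖v‖) = (1 + ‖v‖) ^ γ * (1 + ‖v‖) ^ (1 - γ) := by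
      rw [← Real.rpow_add hA]; simp
    have h5 : 0 < (1 + ‖v‖) ^ (1 - γ) := Real.rpow_pos_of_pos hA _
    calc (1 + ‖v‖) / (‖v - w‖ ^ 2 * (1 + ‖v‖ + ‖w‖) ^ (1 - γ))
        ≤ (1 + ‖v‖) / (‖v - w‖ ^ 2 * (1 + ‖v‖) ^ (1 - γ)) := by gcongr
      _ = (‖v - w‖ ^ 2)⁻¹ * (1 + ‖v‖) ^ γ := by
          nth_rewrite 1 [h4]
          field_simp
      _ ≤ _ := by gcongr
  have hg : 0 ≤ gaussFactor ρ v w := (Real.exp_pos _).le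
  calc ‖fderiv ℝ (fun u => k u w) v‖ * Real.exp (α * ‖v‖ ^ 2)
      ≤ C₁ * ((‖v - w‖ ^ 2)⁻¹ * (ν v / ν₀) * gaussFactor ρ v w) * Real.exp (α * ‖v‖ ^ 2) := by
        gcongr
        exact (hC v w hvw).trans (by gcongr)
    _ = C₁ * ((‖v - w‖ ^ 2)⁻¹ * (ν v / ν₀)) *
          (gaussFactor ρ v w * Real.exp (α * ‖v‖ ^ 2)) := by ring
    _ ≤ C₁ * ((‖v - w‖ ^ 2)⁻¹ * (ν v / ν₀)) *
          (Real.exp (-((1 - ρ) / 4 - α / 2) * ‖v - w‖ ^ 2) * Real.exp (α * ‖w‖ ^ 2)) := by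
        exact mul_le_mul_of_nonneg_left (gaussFactor_mul_exp_le hα0 hα hvw) (by positivity)
    _ = _ := by ring

/-- The derivative of the kernel in its first variable, set to zero on the diagonal. -/
def kernelDeriv (k : E3 → E3 → ℝ) (b : E3) (v w : E3) : ℝ :=
  if v = w then 0 else fderiv ℝ (fun u => k u w) v b

/-- Joint measurability comes from writing the derivative as a limit of difference quotients of k
with steps 1/(n+1). -/
lemma measurable_kernelDeriv (hL : CollisionAssumption ρ γ ν k) (b : E3) :
    Measurable fun q : E3 × E3 => kernelDeriv k b q.1 q.2 := by
  have hk := hL.measurable_kernel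
  let F : ℕ → E3 × E3 → ℝ := fun n q =>
    if q.1 = q.2 then 0 else ((n : ℝ) + 1) * (k (q.1 + ((n : ℝ) + 1)⁻¹ • b) q.2 - k q.1 q.2)
  refine measurable_of_tendsto_metrizable (f := F) (fun n => ?_) (tendsto_pi_nhds.2 fun q => ?_)
  · refine Measurable.ite (measurableSet_eq_fun measurable_fst measurable_snd) measurable_const ?_
    refine measurable_const.mul (Measurable.sub ?_ hk)
    exact hk.comp (by fun_prop : Measurable fun q : E3 × E3 => (q.1 + ((n : ℝ) + 1)⁻¹ • b, q.2))
  · by_cases h : q.1 = q.2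
    · simp [F, kernelDeriv, h]
    · simp only [F, kernelDeriv, h, if_false]
      have h1 := (hL.differentiableAt_kernel q.1 q.2 h).hasFDerivAt.hasLineDerivAt b
      have h2 : Tendsto (fun n : ℕ => ((n : ℝ) + 1)⁻¹) atTop (𝓝[≠] 0) := by
        refine tendsto_nhdsWithin_iff.2 ⟨?_, Eventually.of_forall fun n => ?_⟩
        · simpa using tendsto_one_div_add_atTop_nhds_zero_nat (𝕜 := ℝ)
        · simp only [mem_compl_iff, mem_singleton_iff, inv_eq_zero]; positivity
      have h3 := (hasLineDerivAt_iff_tendsto_slope_zero.1 h1).comp h2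
      simpa [Function.comp_def] using h3

lemma enorm_kernelDeriv_le (k : E3 → E3 → ℝ) (b v w : E3) :
    ‖kernelDeriv k b v w‖ₑ ≤ ‖fderiv ℝ (fun u => k u w) v‖ₑ * ‖b‖ₑ := by
  unfold kernelDeriv
  split_ifs
  · simp
  · exact ContinuousLinearMap.le_opENorm _ _

end

section

/-! ### Geometry of convex domains of class `C²` -/

variable {Ω : Set E3}

/-- The planar part of a vector. -/
def planar : E3 →L[ℝ] EuclideanSpace ℝ (Fin 2) :=
  LinearMap.toContinuousLinearMap
    { toFun := fun x => !₂[x 0, x 1]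
      map_add' := fun x y => by ext i; fin_cases i <;> simp
      map_smul' := fun c x => by ext i; fin_cases i <;> simp }

@[simp] lemma planar_apply (x : E3) : planar x = !₂[x 0, x 1] := rfl

lemma norm_planar_le (x : E3) : ‖planar x‖ ≤ ‖x‖ := by
  rw [← sq_le_sq₀ (norm_nonneg _) (norm_nonneg _), EuclideanSpace.norm_sq_eq,
    EuclideanSpace.norm_sq_eq, Fin.sum_univ_three, Fin.sum_univ_two]
  simp [sq_nonneg]

lemma IsConvexC2Domain.notMem_of_mem_frontier (hΩ : IsConvexC2Domain Ω) {z : E3}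
    (hz : z ∈ frontier Ω) : z ∉ Ω := by
  rw [hΩ.isOpen.frontier_eq] at hz; exact hz.2

/-- A `C²` local defining function near a boundary point. -/
lemma IsConvexC2Domain.exists_defining (hΩ : IsConvexC2Domain Ω) {z : E3}
    (hz : z ∈ frontier Ω) : ∃ r > 0, ∃ e : E3 ≃ₗᵢ[ℝ] E3, ∃ ψ : EuclideanSpace ℝ (Fin 2) → ℝ,
      ContDiff ℝ 2 ψ ∧ (∀ x ∈ Metric.ball z r, x ∈ Ω ↔ ψ (planar (e x)) - e x 2 < 0) ∧
      (∀ x ∈ Metric.ball z r, x ∈ frontier Ω → ψ (planar (e x)) - e x 2 = 0) := by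
  obtain ⟨r, hr, e, ψ, hψ, h⟩ := hΩ.boundary z hz
  refine ⟨r, hr, e, ψ, hψ, fun x hx => ?_, fun x hx hxf => ?_⟩
  · rw [h x hx, sub_neg]; rfl
  · have h1 : ¬ (ψ !₂[e x 0, e x 1] < e x 2) := fun h' =>
      hΩ.notMem_of_mem_frontier hxf ((h x hx).2 h')
    rw [planar_apply]
    -- A positive value would persist in a neighbourhood, which would then miss Ω, although x is in
    -- the closure of Ω.
    refine le_antisymm ?_ (by linarith)
    by_contra hpos
    have hc : Continuous fun y : E3 => ψ (planar (e y)) - e y 2 :=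
      (hψ.continuous.comp (planar.continuous.comp e.continuous)).sub (by fun_prop)
    have hev : ∀ᶠ y in 𝓝 x, y ∉ Ω := by
      filter_upwards [Metric.isOpen_ball.mem_nhds hx,
        hc.continuousAt.eventually (lt_mem_nhds (not_le.1 hpos))] with y hy hy' hyΩ
      have := (h y hy).1 hyΩ
      rw [planar_apply] at hy'
      linarith
    obtain ⟨y, hy, hy'⟩ := (mem_closure_iff_frequently.1 hxf.1).and_eventually hev |>.exists
    exact hy' hy

/-- For the graph description, moving in the vertical direction changes the defining function at
rate -1, so its gradient does not vanish. -/
lemma IsConvexC2Domain.exists_defining_fun (hΩ : IsConvexC2Domain Ω) {z : E3}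
    (hz : z ∈ frontier Ω) : ∃ r > 0, ∃ ρ : E3 → ℝ, ContDiff ℝ 2 ρ ∧ fderiv ℝ ρ z ≠ 0 ∧
      (∀ x ∈ Metric.ball z r, x ∈ Ω ↔ ρ x < 0) ∧
      (∀ x ∈ Metric.ball z r, x ∈ frontier Ω → ρ x = 0) := by
  obtain ⟨r, hr, e, ψ, hψ, h1, h2⟩ := hΩ.exists_defining hz
  have hsm : ContDiff ℝ 2 fun x : E3 => ψ (planar (e x)) - e x 2 := by
    refine (hψ.comp (planar.contDiff.comp e.contDiff)).sub ?_
    exact ((EuclideanSpace.proj (𝕜 := ℝ) (2 : Fin 3)).contDiff.comp e.contDiff)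
  refine ⟨r, hr, fun x => ψ (planar (e x)) - e x 2, hsm, fun h0 => ?_, h1, h2⟩
  have hd := ((hsm.differentiable (by norm_num) z).hasFDerivAt).hasLineDerivAt
    (e.symm (EuclideanSpace.single 2 1))
  rw [h0] at hd
  have hd2 : HasDerivAt (fun t : ℝ => ψ (planar (e z)) - (e z 2 + t)) (-1) 0 := by
    simpa using ((hasDerivAt_id (0 : ℝ)).const_add (e z 2)).const_sub (ψ (planar (e z)))
  have heq : (fun t : ℝ => ψ (planar (e (z + t • e.symm (EuclideanSpace.single 2 1)))) -
      e (z + t • e.symm (EuclideanSpace.single 2 1)) 2) =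
      fun t : ℝ => ψ (planar (e z)) - (e z 2 + t) := by
    ext t
    simp
  have hd' : HasDerivAt (fun t : ℝ => ψ (planar (e z)) - (e z 2 + t)) 0 0 := by
    rw [← heq]; exact hd
  have := hd'.unique hd2
  norm_num at this

/-- `n` is an outer unit normal of `Ω` at `z`. -/
def IsOuterNormal (Ω : Set E3) (z n : E3) : Prop :=
  ‖n‖ = 1 ∧ ∀ y ∈ Ω, inner ℝ n (y - z) ≤ 0

/-- Openness leaves room to push y a little in the direction n, which would violate a non-strict
equality. -/
lemma IsOuterNormal.inner_neg {z n : E3} (h : IsOuterNormal Ω z n) (hΩ : IsOpen Ω) {y : E3}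
    (hy : y ∈ Ω) : inner ℝ n (y - z) < 0 := by
  have hc : Tendsto (fun t : ℝ => y + t • n) (𝓝[>] 0) (𝓝 y) := by
    have : Tendsto (fun t : ℝ => y + t • n) (𝓝 0) (𝓝 (y + (0 : ℝ) • n)) :=
      Continuous.tendsto (by fun_prop) _
    simpa using this.mono_left nhdsWithin_le_nhds
  obtain ⟨t, ht, ht0⟩ := ((hc.eventually (hΩ.mem_nhds hy)).and self_mem_nhdsWithin).exists
  have h1 := h.2 _ ht
  rw [show y + t • n - z = (y - z) + t • n by abel, inner_add_right, inner_smul_right,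
    real_inner_self_eq_norm_sq, h.1] at h1
  have : (0 : ℝ) < t := ht0
  linarith

lemma IsConvexC2Domain.exists_isOuterNormal (hΩ : IsConvexC2Domain Ω) {z : E3}
    (hz : z ∈ frontier Ω) : ∃ n, IsOuterNormal Ω z n := by
  obtain ⟨f, hf⟩ := geometric_hahn_banach_open_point hΩ.convex hΩ.isOpen
    (hΩ.notMem_of_mem_frontier hz)
  set m := (InnerProductSpace.toDual ℝ E3).symm f
  have hm : ∀ y, inner ℝ m y = f y := fun y => by simp [m]
  have hm0 : m ≠ 0 := by
    intro h
    obtain ⟨y, hy⟩ := hΩ.nonempty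
    have := hf y hy
    rw [← hm, ← hm, h] at this
    simp at this
  refine ⟨‖m‖⁻¹ • m, norm_smul_inv_norm (𝕜 := ℝ) hm0, fun y hy => ?_⟩
  rw [inner_smul_left, inner_sub_right, hm, hm]
  have := hf y hy
  exact mul_nonpos_of_nonneg_of_nonpos (by simp) (by linarith)

/-- A direction d along which the defining function decreases to first order enters Ω, hence has n·d
≤ 0. So the half-space where the differential is negative lies in the one where n·d ≤ 0, which
forces the differential to be a positive multiple of the functional n. -/
lemma IsConvexC2Domain.fderiv_eq_inner {z n : E3}
    (hz : z ∈ frontier Ω) (hn : IsOuterNormal Ω z n) {r : ℝ} (hr : 0 < r) {ρ : E3 → ℝ}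
    (hρ : ContDiff ℝ 2 ρ) (h0 : fderiv ℝ ρ z ≠ 0)
    (h1 : ∀ x ∈ Metric.ball z r, x ∈ Ω ↔ ρ x < 0)
    (h2 : ∀ x ∈ Metric.ball z r, x ∈ frontier Ω → ρ x = 0) :
    ∃ c > 0, ∀ d, fderiv ℝ ρ z d = c * inner ℝ n d := by
  set g := fderiv ℝ ρ z
  have hz0 : ρ z = 0 := h2 z (Metric.mem_ball_self hr) hz
  have key : ∀ d, g d < 0 → inner ℝ n d ≤ 0 := by
    intro d hd
    have hl := ((hρ.differentiable (by norm_num) z).hasFDerivAt).hasLineDerivAt d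
    have hs := hasLineDerivAt_iff_tendsto_slope_zero.1 hl
    have hc : Tendsto (fun t : ℝ => z + t • d) (𝓝[>] 0) (𝓝 z) := by
      have : Tendsto (fun t : ℝ => z + t • d) (𝓝 0) (𝓝 (z + (0 : ℝ) • d)) :=
        Continuous.tendsto (by fun_prop) _
      simpa using this.mono_left nhdsWithin_le_nhds
    have hs' := (hs.mono_left (nhdsWithin_mono 0 (fun t ht => (ne_of_gt ht : t ≠ 0)) :
      𝓝[>] (0 : ℝ) ≤ 𝓝[≠] 0)).eventually (gt_mem_nhds hd)
    obtain ⟨t, ⟨ht, htb⟩, ht0⟩ := ((hs'.and (hc.eventually (Metric.ball_mem_nhds z hr))).and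
      self_mem_nhdsWithin).exists
    have ht0' : (0 : ℝ) < t := ht0
    rw [hz0, sub_zero, smul_eq_mul] at ht
    have hneg : ρ (z + t • d) < 0 := by
      by_contra hcon
      have := mul_nonneg (inv_nonneg.2 ht0'.le) (not_lt.1 hcon)
      linarith
    have := hn.2 _ ((h1 _ htb).2 hneg)
    rw [add_sub_cancel_left, inner_smul_right] at this
    by_contra hcon
    nlinarith [not_le.1 hcon]
  have hnn : inner ℝ n n = (1 : ℝ) := by rw [real_inner_self_eq_norm_sq, hn.1]; norm_num
  have hge : ∀ d, inner ℝ n d = (0 : ℝ) → 0 ≤ g d := by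
    intro d hd
    by_contra hcon
    have hc : Tendsto (fun t : ℝ => g (d + t • n)) (𝓝[>] 0) (𝓝 (g d)) := by
      have : Tendsto (fun t : ℝ => g (d + t • n)) (𝓝 0) (𝓝 (g (d + (0 : ℝ) • n))) :=
        Continuous.tendsto (by fun_prop) _
      simpa using this.mono_left nhdsWithin_le_nhds
    obtain ⟨t, ht, ht0⟩ := ((hc.eventually (gt_mem_nhds (not_le.1 hcon))).and
      self_mem_nhdsWithin).exists
    have := key _ ht
    rw [inner_add_right, inner_smul_right, hd, hnn] at this
    have : (0 : ℝ) < t := ht0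
    linarith
  have hz' : ∀ d, inner ℝ n d = (0 : ℝ) → g d = 0 := fun d hd =>
    le_antisymm (by have := hge (-d) (by simp [hd]); simpa using this) (hge d hd)
  have hform : ∀ d, g d = g n * inner ℝ n d := by
    intro d
    have := hz' (d - (inner ℝ n d : ℝ) • n) (by
      rw [inner_sub_right, inner_smul_right, hnn]; ring)
    rw [map_sub, map_smul, smul_eq_mul] at this
    linarith
  refine ⟨g n, ?_, hform⟩
  have hn0 : g n ≠ 0 := fun h => h0 (by ext d; rw [hform d, h]; simp)
  refine lt_of_le_of_ne ?_ hn0.symm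
  by_contra hcon
  have := key n (not_le.1 hcon)
  rw [hnn] at this
  linarith

lemma IsConvexC2Domain.isOuterNormal_unique (hΩ : IsConvexC2Domain Ω) {z n n' : E3}
    (hz : z ∈ frontier Ω) (hn : IsOuterNormal Ω z n) (hn' : IsOuterNormal Ω z n') : n = n' := by
  obtain ⟨r, hr, ρ, hρ, h0, h1, h2⟩ := hΩ.exists_defining_fun hz
  obtain ⟨c, hc, h⟩ := fderiv_eq_inner hz hn hr hρ h0 h1 h2
  obtain ⟨c', hc', h'⟩ := fderiv_eq_inner hz hn' hr hρ h0 h1 h2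
  have heq : c • n = c' • n' := ext_inner_right ℝ fun d => by
    rw [inner_smul_left, inner_smul_left]
    simp only [conj_trivial]
    rw [← h, ← h']
  have hcc : c = c' := by
    have := congrArg norm heq
    rwa [norm_smul, norm_smul, hn.1, hn'.1, mul_one, mul_one, Real.norm_of_nonneg hc.le,
      Real.norm_of_nonneg hc'.le] at this
  rw [← hcc] at heq
  exact smul_right_injective _ hc.ne' heq

open Classical in
/-- The outer unit normal on `∂Ω`, extended by zero. -/
def outerNormal (Ω : Set E3) (z : E3) : E3 :=
  if h : z ∈ frontier Ω ∧ ∃ n, IsOuterNormal Ω z n then h.2.choose else 0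

lemma IsConvexC2Domain.outerNormal_spec (hΩ : IsConvexC2Domain Ω) {z : E3}
    (hz : z ∈ frontier Ω) : IsOuterNormal Ω z (outerNormal Ω z) := by
  have h : z ∈ frontier Ω ∧ ∃ n, IsOuterNormal Ω z n := ⟨hz, hΩ.exists_isOuterNormal hz⟩
  rw [outerNormal, dif_pos h]
  exact h.2.choose_spec

/-- The inequalities defining an outer normal are closed conditions, so every cluster point of
nearby normals is a normal at z. Uniqueness and compactness of the sphere then give convergence. -/
lemma IsConvexC2Domain.continuousOn_outerNormal (hΩ : IsConvexC2Domain Ω) :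
    ContinuousOn (outerNormal Ω) (frontier Ω) := by
  intro z hz
  refine IsCompact.le_nhds_of_unique_clusterPt (isCompact_sphere (0 : E3) 1) ?_ ?_
  · refine mem_map.2 ?_
    filter_upwards [self_mem_nhdsWithin] with y hy
    simpa using (hΩ.outerNormal_spec hy).1
  · intro m hm hcl
    refine hΩ.isOuterNormal_unique hz ⟨by simpa using hm, fun y hy => ?_⟩ (hΩ.outerNormal_spec hz)
    by_contra hcon
    have hc : Continuous fun q : E3 × E3 => (inner ℝ q.2 (y - q.1) : ℝ) := by fun_prop
    have hop : {q : E3 × E3 | 0 < (inner ℝ q.2 (y - q.1) : ℝ)} ∈ 𝓝 (z, m) :=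
      (isOpen_lt continuous_const hc).mem_nhds (not_le.1 hcon)
    rw [nhds_prod_eq, Filter.mem_prod_iff] at hop
    obtain ⟨U, hU, V, hV, hUV⟩ := hop
    have hfr : ∃ᶠ x in 𝓝[frontier Ω] z, outerNormal Ω x ∈ V :=
      (mapClusterPt_iff_frequently.1 hcl) V hV
    have hev : ∀ᶠ x in 𝓝[frontier Ω] z, x ∈ U ∧ x ∈ frontier Ω :=
      Filter.Eventually.and (mem_nhdsWithin_of_mem_nhds hU) self_mem_nhdsWithin
    obtain ⟨x, hxV, hxU, hxf⟩ := (hfr.and_eventually hev).exists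
    have h1 : 0 < (inner ℝ (outerNormal Ω x) (y - x) : ℝ) := hUV (mk_mem_prod hxU hxV)
    exact absurd ((hΩ.outerNormal_spec hxf).2 y hy) (not_le.2 h1)

lemma IsConvexC2Domain.measurable_outerNormal (hΩ : IsConvexC2Domain Ω) :
    Measurable (outerNormal Ω) := by
  classical
  have h := hΩ.continuousOn_outerNormal.measurable_piecewise
    (continuousOn_const (c := (0 : E3)) (s := (frontier Ω)ᶜ)) isClosed_frontier.measurableSet
  convert h using 1
  ext1 z
  by_cases hz : z ∈ frontier Ω
  · simp [hz]
  · simp [hz, outerNormal]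

end

section

/-! ### The backward exit time -/

variable {Ω : Set E3}

lemma IsConvexC2Domain.exitTime_set_nonempty (hΩ : IsConvexC2Domain Ω) (x : E3) {v : E3}
    (hv : v ≠ 0) : {s : ℝ | 0 < s ∧ x - s • v ∉ Ω}.Nonempty := by
  obtain ⟨R, hR⟩ := hΩ.isBounded.subset_ball 0
  have hv' : 0 < ‖v‖ := norm_pos_iff.2 hv
  refine ⟨(|R| + ‖x‖ + 1) / ‖v‖, by positivity, fun h => ?_⟩
  have h1 := hR h
  rw [mem_ball_zero_iff] at h1
  have h2 : ‖((|R| + ‖x‖ + 1) / ‖v‖) • v‖ = |R| + ‖x‖ + 1 := by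
    rw [norm_smul, Real.norm_of_nonneg (by positivity)]
    field_simp
  have h3 := norm_sub_norm_le (((|R| + ‖x‖ + 1) / ‖v‖) • v) x
  rw [norm_sub_rev, h2] at h3
  linarith [le_abs_self R]

lemma exitTime_le {x v : E3} {s : ℝ} (hs : 0 < s) (h : x - s • v ∉ Ω) : exitTime Ω x v ≤ s :=
  csInf_le ⟨0, fun _ ht => ht.1.le⟩ ⟨hs, h⟩

lemma exitTime_nonneg (x v : E3) : 0 ≤ exitTime Ω x v :=
  Real.sInf_nonneg fun _ ht => ht.1.le

lemma mem_of_lt_exitTime {x v : E3} (hx : x ∈ Ω) {s : ℝ} (hs0 : 0 ≤ s)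
    (hs : s < exitTime Ω x v) : x - s • v ∈ Ω := by
  rcases hs0.eq_or_lt with rfl | h0
  · simpa using hx
  · by_contra h
    exact absurd (exitTime_le h0 h) (not_le.2 hs)

lemma tendsto_sub_smul_right (x v : E3) (τ : ℝ) (l : Filter ℝ) (hl : l ≤ 𝓝 τ) :
    Tendsto (fun s : ℝ => x - s • v) l (𝓝 (x - τ • v)) :=
  (Continuous.tendsto (by fun_prop : Continuous fun s : ℝ => x - s • v) τ).mono_left hl

/-- Were the trajectory in Ω at a time s past the exit time, openness would keep it there at some s'
> s, while some earlier time lies outside; convexity of the segment from x forbids this. -/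
lemma IsConvexC2Domain.notMem_of_exitTime_le (hΩ : IsConvexC2Domain Ω) {x v : E3} (hx : x ∈ Ω)
    (hv : v ≠ 0) {s : ℝ} (hs : exitTime Ω x v ≤ s) : x - s • v ∉ Ω := by
  intro hmem
  obtain ⟨s', hs', hss'⟩ := ((tendsto_sub_smul_right x v s (𝓝[>] s) nhdsWithin_le_nhds).eventually
    (hΩ.isOpen.mem_nhds hmem)).and self_mem_nhdsWithin |>.exists
  have hlt : exitTime Ω x v < s' := hs.trans_lt hss'
  obtain ⟨u, hu, hus⟩ := exists_lt_of_csInf_lt (hΩ.exitTime_set_nonempty x hv) hlt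
  refine hu.2 ?_
  have h0 : 0 < s' := hu.1.trans hus
  have := hΩ.convex hx hs' (a := 1 - u / s') (b := u / s')
    (by rw [sub_nonneg, div_le_one h0]; exact hus.le) (div_nonneg hu.1.le h0.le) (by ring)
  convert this using 1
  rw [smul_sub, smul_smul, div_mul_cancel₀ _ h0.ne', sub_smul, one_smul]
  abel

lemma IsConvexC2Domain.mem_iff_lt_exitTime (hΩ : IsConvexC2Domain Ω) {x v : E3} (hx : x ∈ Ω)
    (hv : v ≠ 0) {s : ℝ} (hs : 0 ≤ s) : x - s • v ∈ Ω ↔ s < exitTime Ω x v :=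
  ⟨fun h => by
    by_contra hcon
    exact hΩ.notMem_of_exitTime_le hx hv (not_lt.1 hcon) h, mem_of_lt_exitTime hx hs⟩

lemma IsConvexC2Domain.exitTime_pos (hΩ : IsConvexC2Domain Ω) {x v : E3} (hx : x ∈ Ω)
    (hv : v ≠ 0) : 0 < exitTime Ω x v :=
  (hΩ.mem_iff_lt_exitTime hx hv le_rfl).1 (by simpa using hx)

/-- The point at which the backward trajectory leaves `Ω`. -/
def exitPoint (Ω : Set E3) (x v : E3) : E3 := x - exitTime Ω x v • v

lemma IsConvexC2Domain.exitPoint_mem_frontier (hΩ : IsConvexC2Domain Ω) {x v : E3} (hx : x ∈ Ω)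
    (hv : v ≠ 0) : exitPoint Ω x v ∈ frontier Ω := by
  rw [hΩ.isOpen.frontier_eq]
  refine ⟨?_, hΩ.notMem_of_exitTime_le hx hv le_rfl⟩
  refine mem_closure_of_tendsto
    (tendsto_sub_smul_right x v (exitTime Ω x v) (𝓝[<] exitTime Ω x v) nhdsWithin_le_nhds) ?_
  filter_upwards [Ioo_mem_nhdsLT (hΩ.exitTime_pos hx hv)] with s hs
  exact mem_of_lt_exitTime hx hs.1.le hs.2

lemma IsConvexC2Domain.inner_outerNormal_exitPoint_neg (hΩ : IsConvexC2Domain Ω) {x v : E3}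
    (hx : x ∈ Ω) (hv : v ≠ 0) : inner ℝ (outerNormal Ω (exitPoint Ω x v)) v < 0 := by
  have h := (hΩ.outerNormal_spec (hΩ.exitPoint_mem_frontier hx hv)).inner_neg hΩ.isOpen hx
  rw [show x - exitPoint Ω x v = exitTime Ω x v • v by rw [exitPoint]; abel,
    inner_smul_right] at h
  have := hΩ.exitTime_pos hx hv
  by_contra hcon
  nlinarith [not_lt.1 hcon]

/-- The derivative of the exit time in the direction `(a, b)`. -/
def exitTimeDeriv (Ω : Set E3) (a b x v : E3) : ℝ :=
  inner ℝ (outerNormal Ω (exitPoint Ω x v)) (a - exitTime Ω x v • b) /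
    inner ℝ (outerNormal Ω (exitPoint Ω x v)) v

lemma eventually_div_pos {F : ℝ → ℝ} {d : ℝ} (hF : HasDerivAt F d 0) (h0 : F 0 = 0)
    (hd : 0 < d) : ∀ᶠ t in 𝓝[≠] (0 : ℝ), 0 < t⁻¹ * F t := by
  have := (hasDerivAt_iff_tendsto_slope_zero.1 hF).eventually (lt_mem_nhds hd)
  simpa [h0] using this

/-- Compare the exit time with the linear guesses τ₀ + ct. The defining function at the guessed
point has derivative m (n·v)(σ - c) in t, where m > 0 and n·v < 0. Its sign for c = σ ± ε/2 decides
whether the guess is still inside Ω or already outside, and so traps the exit time between the two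
guesses. -/
lemma IsConvexC2Domain.hasDerivAt_exitTime (hΩ : IsConvexC2Domain Ω) {x v : E3} (hx : x ∈ Ω)
    (hv : v ≠ 0) (a b : E3) :
    HasDerivAt (fun t : ℝ => exitTime Ω (x + t • a) (v + t • b)) (exitTimeDeriv Ω a b x v) 0 := by
  set τ₀ := exitTime Ω x v with hτ₀
  set σ := exitTimeDeriv Ω a b x v with hσ
  set q := exitPoint Ω x v with hq
  have hqf := hΩ.exitPoint_mem_frontier hx hv
  have hτpos := hΩ.exitTime_pos hx hv
  have hnv := hΩ.inner_outerNormal_exitPoint_neg hx hv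
  obtain ⟨r, hr, ρ, hρ, h0, h1, h2⟩ := hΩ.exists_defining_fun hqf
  obtain ⟨m, hm, hgrad⟩ := IsConvexC2Domain.fderiv_eq_inner hqf (hΩ.outerNormal_spec hqf) hr hρ h0 h1 h2
  have hxt : ∀ᶠ t in 𝓝[≠] (0 : ℝ), x + t • a ∈ Ω := by
    have : Tendsto (fun t : ℝ => x + t • a) (𝓝 0) (𝓝 (x + (0 : ℝ) • a)) :=
      Continuous.tendsto (by fun_prop) _
    exact nhdsWithin_le_nhds (this.eventually (hΩ.isOpen.mem_nhds (by simpa using hx)))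
  have hvt : ∀ᶠ t in 𝓝[≠] (0 : ℝ), v + t • b ≠ 0 := by
    have : Tendsto (fun t : ℝ => v + t • b) (𝓝 0) (𝓝 (v + (0 : ℝ) • b)) :=
      Continuous.tendsto (by fun_prop) _
    exact nhdsWithin_le_nhds (this.eventually (isOpen_ne.mem_nhds (by simpa using hv)))
  -- the defining function along the curve with exit time replaced by `τ₀ + c t`
  have hcurve : ∀ c : ℝ, HasDerivAt (fun t : ℝ => x + t • a - (τ₀ + c * t) • (v + t • b))
      (a - τ₀ • b - c • v) 0 := by
    intro c
    have e1 : HasDerivAt (fun t : ℝ => x + t • a) a 0 := by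
      simpa using ((hasDerivAt_id (0 : ℝ)).smul_const a).const_add x
    have e2 : HasDerivAt (fun t : ℝ => v + t • b) b 0 := by
      simpa using ((hasDerivAt_id (0 : ℝ)).smul_const b).const_add v
    have e3 : HasDerivAt (fun t : ℝ => τ₀ + c * t) c 0 := by
      simpa using ((hasDerivAt_id (0 : ℝ)).const_mul c).const_add τ₀
    refine (e1.sub (e3.smul e2)).congr_deriv ?_
    simp only [mul_zero, add_zero, zero_smul]
    abel
  have hF : ∀ c : ℝ, HasDerivAt (fun t : ℝ => ρ (x + t • a - (τ₀ + c * t) • (v + t • b)))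
      (m * (inner ℝ (outerNormal Ω q) v * (σ - c))) 0 := by
    intro c
    have hd : HasFDerivAt ρ (fderiv ℝ ρ q)
        (x + (0 : ℝ) • a - (τ₀ + c * 0) • (v + (0 : ℝ) • b)) := by
      simpa [hq, exitPoint] using (hρ.differentiable (by norm_num) q).hasFDerivAt
    refine (hd.comp_hasDerivAt (0 : ℝ) (hcurve c)).congr_deriv ?_
    rw [hgrad]
    congr 1
    rw [inner_sub_right, inner_smul_right, hσ, exitTimeDeriv, mul_sub,
      mul_div_cancel₀ _ hnv.ne]
    ring
  have hF0 : ∀ c : ℝ, ρ (x + (0 : ℝ) • a - (τ₀ + c * 0) • (v + (0 : ℝ) • b)) = 0 := fun c => by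
    simpa [hq, exitPoint] using h2 q (Metric.mem_ball_self hr) hqf
  have hball : ∀ c : ℝ, ∀ᶠ t in 𝓝[≠] (0 : ℝ),
      x + t • a - (τ₀ + c * t) • (v + t • b) ∈ Metric.ball q r := fun c => by
    refine nhdsWithin_le_nhds ((hcurve c).continuousAt.eventually (Metric.isOpen_ball.mem_nhds ?_))
    have hpt : x + (0 : ℝ) • a - (τ₀ + c * 0) • (v + (0 : ℝ) • b) = q := by
      simp [hq, exitPoint, hτ₀]
    beta_reduce
    rw [hpt]
    exact Metric.mem_ball_self hr
  have hpos : ∀ c : ℝ, ∀ᶠ t in 𝓝[≠] (0 : ℝ), 0 < τ₀ + c * t := fun c => by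
    have : Tendsto (fun t : ℝ => τ₀ + c * t) (𝓝 0) (𝓝 (τ₀ + c * 0)) :=
      Continuous.tendsto (by fun_prop) _
    exact nhdsWithin_le_nhds (this.eventually (lt_mem_nhds (by simpa using hτpos)))
  have hτle : ∀ c : ℝ, ∀ᶠ t in 𝓝[≠] (0 : ℝ),
      0 < ρ (x + t • a - (τ₀ + c * t) • (v + t • b)) →
        exitTime Ω (x + t • a) (v + t • b) ≤ τ₀ + c * t := fun c => by
    filter_upwards [hball c, hpos c] with t ht ht' hlt
    exact exitTime_le ht' fun hmem => absurd ((h1 _ ht).1 hmem) (not_lt.2 hlt.le)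
  have hleτ : ∀ c : ℝ, ∀ᶠ t in 𝓝[≠] (0 : ℝ),
      ρ (x + t • a - (τ₀ + c * t) • (v + t • b)) < 0 →
        τ₀ + c * t ≤ exitTime Ω (x + t • a) (v + t • b) := fun c => by
    filter_upwards [hball c, hpos c, hxt, hvt] with t ht ht' htx htv hlt
    exact ((hΩ.mem_iff_lt_exitTime htx htv ht'.le).1 ((h1 _ ht).2 hlt)).le
  rw [hasDerivAt_iff_tendsto_slope_zero]
  simp only [zero_add, zero_smul, add_zero]
  rw [Metric.tendsto_nhds]
  intro ε hε
  have hcp := eventually_div_pos (hF (σ + ε / 2)) (hF0 _) (by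
    rw [show σ - (σ + ε / 2) = -(ε / 2) by ring]
    exact mul_pos hm (mul_pos_of_neg_of_neg hnv (by linarith)))
  have hcm := eventually_div_pos (F := fun t => -ρ (x + t • a - (τ₀ + (σ - ε / 2) * t) • (v + t • b)))
    (hF (σ - ε / 2)).neg (by rw [hF0, neg_zero]) (by
      rw [show σ - (σ - ε / 2) = (ε / 2) by ring, neg_pos]
      exact mul_neg_of_pos_of_neg hm (mul_neg_of_neg_of_pos hnv (by linarith)))
  filter_upwards [hcp, hcm, hτle (σ + ε / 2), hτle (σ - ε / 2), hleτ (σ + ε / 2),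
    hleτ (σ - ε / 2), self_mem_nhdsWithin] with t t1 t2 t3 t4 t5 t6 ht
  have ht0 : t ≠ 0 := ht
  rw [smul_eq_mul, Real.dist_eq]
  refine lt_of_le_of_lt (b := ε / 2) ?_ (by linarith)
  -- For negative t the two guesses exchange roles: the one with c = σ + ε/2 is inside and the one
  -- with c = σ - ε/2 is outside.
  rcases lt_or_gt_of_ne ht0 with hneg | hpos'
  · have i : t⁻¹ < 0 := inv_lt_zero.2 hneg
    have a5 := t5 (by by_contra hc; nlinarith [not_lt.1 hc])
    have a4 := t4 (by by_contra hc; nlinarith [not_lt.1 hc])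
    rw [abs_le, inv_mul_eq_div]
    constructor
    · rw [neg_le_sub_iff_le_add, ← sub_le_iff_le_add, le_div_iff_of_neg hneg]; linarith
    · rw [sub_le_iff_le_add, div_le_iff_of_neg hneg]; linarith
  · have i : 0 < t⁻¹ := inv_pos.2 hpos'
    have a3 := t3 (by by_contra hc; nlinarith [not_lt.1 hc])
    have a6 := t6 (by by_contra hc; nlinarith [not_lt.1 hc])
    rw [abs_le, inv_mul_eq_div]
    constructor
    · rw [neg_le_sub_iff_le_add, ← sub_le_iff_le_add, le_div_iff₀ hpos']; linarith
    · rw [sub_le_iff_le_add, div_le_iff₀ hpos']; linarith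

end

/-! ### Measurability of the exit time; finiteness of the surface measure -/

section

variable {Ω : Set E3}

/-- The phase points at which the exit time is a regular function. -/
def regularSet (Ω : Set E3) : Set (E3 × E3) := {z | z.1 ∈ Ω ∧ z.2 ≠ 0}

lemma IsConvexC2Domain.isOpen_regularSet (hΩ : IsConvexC2Domain Ω) : IsOpen (regularSet Ω) :=
  (hΩ.isOpen.preimage continuous_fst).inter (isOpen_ne.preimage continuous_snd)

/-- The exit time, extended by zero from the regular phase points. -/
def regExitTime (Ω : Set E3) : E3 × E3 → ℝ :=
  (regularSet Ω).indicator fun z => exitTime Ω z.1 z.2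

/-- For c ≥ 0 the set where the exit time exceeds c is open: it is the union over r > c of the
conditions x - rv ∈ Ω on regular points. -/
lemma IsConvexC2Domain.measurable_regExitTime (hΩ : IsConvexC2Domain Ω) :
    Measurable (regExitTime Ω) := by
  refine measurable_of_Ioi fun c => ?_
  rcases lt_or_ge c 0 with hc | hc
  · convert MeasurableSet.univ
    refine eq_univ_of_forall fun z => ?_
    exact hc.trans_le (indicator_nonneg (fun z _ => exitTime_nonneg z.1 z.2) z)
  · have : regExitTime Ω ⁻¹' Ioi c =
        ⋃ r ∈ Ioi c, regularSet Ω ∩ {z : E3 × E3 | z.1 - r • z.2 ∈ Ω} := by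
      ext z
      simp only [mem_preimage, mem_Ioi, mem_iUnion, mem_inter_iff, mem_ofPred_eq, exists_prop]
      constructor
      · intro hz
        have hzr : z ∈ regularSet Ω := by
          by_contra h
          rw [regExitTime, indicator_of_notMem h] at hz
          exact absurd hc (not_le.2 hz)
        rw [regExitTime, indicator_of_mem hzr] at hz
        obtain ⟨r, h1, h2⟩ := exists_between hz
        exact ⟨r, h1, hzr, mem_of_lt_exitTime hzr.1 (hc.trans h1.le) h2⟩
      · rintro ⟨r, h1, hzr, h2⟩
        rw [regExitTime, indicator_of_mem hzr]
        exact lt_trans h1 ((hΩ.mem_iff_lt_exitTime hzr.1 hzr.2 (hc.trans h1.le)).1 h2)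
    rw [this]
    refine (isOpen_biUnion fun r _ => hΩ.isOpen_regularSet.inter ?_).measurableSet
    exact hΩ.isOpen.preimage (by fun_prop)

/-- The exit point, computed with the regularized exit time. -/
def regExitPoint (Ω : Set E3) (z : E3 × E3) : E3 := z.1 - regExitTime Ω z • z.2

lemma IsConvexC2Domain.measurable_regExitPoint (hΩ : IsConvexC2Domain Ω) :
    Measurable (regExitPoint Ω) :=
  measurable_fst.sub (hΩ.measurable_regExitTime.smul measurable_snd)

lemma regExitPoint_of_mem {z : E3 × E3} (hz : z ∈ regularSet Ω) :
    regExitPoint Ω z = exitPoint Ω z.1 z.2 := by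
  rw [regExitPoint, regExitTime, indicator_of_mem hz, exitPoint]

/-! ### Surface measure -/

/-- The surface measure on `∂Ω`. -/
def surfaceMeasure (Ω : Set E3) : Measure E3 :=
  (Measure.euclideanHausdorffMeasure 2).restrict (frontier Ω)

lemma lintegral_eq_height_planar {F : E3 → ℝ≥0∞} (hF : Measurable F) :
    ∫⁻ x, F x = ∫⁻ t : ℝ, ∫⁻ y : EuclideanSpace ℝ (Fin 2), F !₂[y 0, y 1, t] := by
  have e1 := (PiLp.volume_preserving_toLp (Fin 3)).lintegral_comp hF
  have hG : Measurable fun q : ℝ × (Fin 2 → ℝ) => F !₂[q.2 0, q.2 1, q.1] := by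
    refine hF.comp ((PiLp.volume_preserving_toLp (Fin 3)).measurable.comp ?_)
    refine measurable_pi_lambda _ fun i => ?_
    fin_cases i <;> simp <;> fun_prop
  have e2 := (volume_preserving_piFinSuccAbove (fun _ : Fin 3 => ℝ) 2).lintegral_comp hG
  have e3 : ∀ t : ℝ, ∫⁻ y : EuclideanSpace ℝ (Fin 2), F !₂[y 0, y 1, t] =
      ∫⁻ y : Fin 2 → ℝ, F !₂[y 0, y 1, t] := fun t =>
    (PiLp.volume_preserving_ofLp (Fin 2)).lintegral_comp
      (f := fun y : Fin 2 → ℝ => F !₂[y 0, y 1, t]) (hG.comp (by fun_prop : Measurable fun y => (t, y)))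
  simp_rw [e3]
  rw [← lintegral_prod (f := fun q : ℝ × (Fin 2 → ℝ) => F !₂[q.2 0, q.2 1, q.1]) hG.aemeasurable,
    ← Measure.volume_eq_prod, ← e2, ← e1]
  refine lintegral_congr fun x => congrArg F ?_
  ext i
  fin_cases i <;> simp [MeasurableEquiv.piFinSuccAbove] <;> rfl

lemma euclideanHausdorff_image_le {X Y : Type*} [EMetricSpace X] [MeasurableSpace X]
    [BorelSpace X] [EMetricSpace Y] [MeasurableSpace Y] [BorelSpace Y] {K : ℝ≥0} {f : X → Y}
    {s : Set X} (h : LipschitzOnWith K f s) :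
    (Measure.euclideanHausdorffMeasure 2 : Measure Y) (f '' s) ≤
      (K : ℝ≥0∞) ^ 2 * (Measure.euclideanHausdorffMeasure 2 : Measure X) s := by
  rw [Measure.euclideanHausdorffMeasure_def, Measure.euclideanHausdorffMeasure_def,
    Measure.smul_apply, Measure.smul_apply, mul_smul_comm]
  have := h.hausdorffMeasure_image_le (d := (2 : ℕ)) (by norm_num)
  simp only [ENNReal.smul_def, smul_eq_mul]
  refine mul_le_mul_right ?_ _
  simpa using this

/-- The surface measure of the boundary is locally finite. -/
lemma IsConvexC2Domain.isFiniteMeasure_surfaceMeasure (hΩ : IsConvexC2Domain Ω) :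
    IsFiniteMeasure (surfaceMeasure Ω) := by
  have hcomp : IsCompact (frontier Ω) :=
    Metric.isCompact_of_isClosed_isBounded isClosed_frontier
      (hΩ.isBounded.closure.subset frontier_subset_closure)
  refine ⟨?_⟩
  rw [surfaceMeasure, Measure.restrict_apply_univ]
  -- The boundary is compact, so it is enough to cover it locally by a Lipschitz graph over a planar
  -- disc.
  refine hcomp.measure_lt_top_of_nhdsWithin fun z hz => ?_
  obtain ⟨r, hr, e, ψ, hψ, -, h2⟩ := hΩ.exists_defining hz
  obtain ⟨K, t, ht, hK⟩ := ((hψ.of_le one_le_two).contDiffAt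
    (x := planar (e z))).exists_lipschitzOnWith
  obtain ⟨s, hs, hst⟩ := Metric.mem_nhds_iff.1 ht
  set u := Metric.ball (planar (e z)) s
  have hψu : LipschitzOnWith K ψ u := hK.mono hst
  set f : EuclideanSpace ℝ (Fin 2) → E3 := fun y => e.symm !₂[y 0, y 1, ψ y]
  -- The squared length of an increment of the graph is at most (1 + K²)|y - y'|² ≤ (1 + K)²|y -
  -- y'|².
  have hf : LipschitzOnWith (1 + K) f u := by
    refine LipschitzOnWith.of_dist_le_mul fun y hy y' hy' => ?_
    rw [dist_eq_norm, ← map_sub, LinearIsometryEquiv.norm_map, NNReal.coe_add, NNReal.coe_one]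
    have hψd := hψu.dist_le_mul y hy y' hy'
    rw [Real.dist_eq] at hψd
    have hd : ‖y - y'‖ ^ 2 = (y 0 - y' 0) ^ 2 + (y 1 - y' 1) ^ 2 := by
      simp [EuclideanSpace.norm_sq_eq, Fin.sum_univ_two]
    rw [dist_eq_norm] at hψd ⊢
    refine abs_le_of_sq_le_sq' ?_ (by positivity) |>.2
    have : ‖!₂[y 0, y 1, ψ y] - !₂[y' 0, y' 1, ψ y']‖ ^ 2 =
        (y 0 - y' 0) ^ 2 + (y 1 - y' 1) ^ 2 + |ψ y - ψ y'| ^ 2 := by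
      simp [EuclideanSpace.norm_sq_eq, Fin.sum_univ_three]
    rw [this, ← hd]
    nlinarith [norm_nonneg (y - y'), abs_nonneg (ψ y - ψ y'), K.coe_nonneg,
      mul_nonneg K.coe_nonneg (sq_nonneg ‖y - y'‖)]
  have hfin : (Measure.euclideanHausdorffMeasure 2 : Measure E3) (f '' u) < ⊤ := by
    refine (euclideanHausdorff_image_le hf).trans_lt (ENNReal.mul_lt_top (by finiteness) ?_)
    rw [EuclideanSpace.euclideanHausdorffMeasure_eq_volume]
    exact Metric.isBounded_ball.measure_lt_top
  refine ⟨f '' u, ?_, hfin⟩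
  have hpre : (fun x : E3 => planar (e x)) ⁻¹' u ∈ 𝓝 z :=
    (planar.continuous.comp e.continuous).continuousAt.preimage_mem_nhds
      (Metric.ball_mem_nhds _ hs)
  filter_upwards [mem_nhdsWithin_of_mem_nhds hpre,
    mem_nhdsWithin_of_mem_nhds (Metric.ball_mem_nhds z hr), self_mem_nhdsWithin] with x hx hxb hxf
  refine ⟨planar (e x), hx, ?_⟩
  have := h2 x hxb hxf
  simp only [f]
  rw [LinearIsometryEquiv.symm_apply_eq]
  ext i
  fin_cases i
  · simp
  · simp
  · simp only [planar_apply] at this ⊢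
    simp; linarith

end

/-! ### Change of variables from the domain to its boundary -/

section

variable {Ω : Set E3}

/-- Nearby boundary points differ almost tangentially. -/
lemma IsConvexC2Domain.eventually_abs_inner_sub_le (hΩ : IsConvexC2Domain Ω) {z : E3}
    (hz : z ∈ frontier Ω) {ε : ℝ} (hε : 0 < ε) :
    ∃ U ∈ 𝓝 z, ∀ a ∈ U ∩ frontier Ω, ∀ a' ∈ U ∩ frontier Ω,
      |inner ℝ (outerNormal Ω z) (a - a')| ≤ ε * ‖a - a'‖ := by
  obtain ⟨r, hr, ρ, hρ, h0, h1, h2⟩ := hΩ.exists_defining_fun hz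
  obtain ⟨m, hm, hgrad⟩ := IsConvexC2Domain.fderiv_eq_inner hz (hΩ.outerNormal_spec hz) hr hρ h0 h1 h2
  -- Strict differentiability compares two moving points. The defining function vanishes at both
  -- boundary points, so only the error term m ε |a - a'| is left against m |n·(a - a')|.
  have hst := (hρ.contDiffAt (x := z)).hasStrictFDerivAt (by norm_num)
  have hlo := (hst.isLittleO.def (mul_pos hm hε))
  obtain ⟨t, ht, hlo⟩ : ∃ t ∈ 𝓝 z, ∀ a ∈ t, ∀ a' ∈ t,
      ‖ρ a - ρ a' - fderiv ℝ ρ z (a - a')‖ ≤ m * ε * ‖a - a'‖ := by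
    rw [nhds_prod_eq] at hlo
    obtain ⟨t, ht, h⟩ := mem_prod_same_iff.1 hlo
    exact ⟨t, ht, fun a ha a' ha' => h (mk_mem_prod ha ha')⟩
  refine ⟨t ∩ Metric.ball z r, inter_mem ht (Metric.ball_mem_nhds z hr), fun a ha a' ha' => ?_⟩
  have := hlo a ha.1.1 a' ha'.1.1
  rw [h2 a ha.1.2 ha.2, h2 a' ha'.1.2 ha'.2, hgrad, sub_self, zero_sub, norm_neg, Real.norm_eq_abs,
    abs_mul, abs_of_pos hm, mul_assoc] at this
  exact le_of_mul_le_mul_left this hm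

/-- The projection along `v` onto the plane of the first two coordinates. -/
def obliqueProj (v : E3) (x : E3) : EuclideanSpace ℝ (Fin 2) :=
  planar x - (x 2 / v 2) • planar v

/-- Cavalieri's principle along v. The oblique projection is constant on trajectories, so the set
lies over the projection of A. Each fibre is a part of a line parallel to v of length at most the
diameter, and its extent in height is smaller by the factor |e v 2|/|v|. -/
lemma IsConvexC2Domain.volume_exit_le (hΩ : IsConvexC2Domain Ω) {v : E3} (hv : v ≠ 0)
    (e : E3 ≃ₗᵢ[ℝ] E3) (he : e v 2 ≠ 0) {A : Set E3}
    (hA : MeasurableSet {x ∈ Ω | exitPoint Ω x v ∈ A}) :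
    volume {x ∈ Ω | exitPoint Ω x v ∈ A} ≤ ENNReal.ofReal (Metric.diam Ω * |e v 2| / ‖v‖) *
      volume ((fun x => obliqueProj (e v) (e x)) '' A) := by
  set B := {x ∈ Ω | exitPoint Ω x v ∈ A}
  set P := (fun x => obliqueProj (e v) (e x)) '' A
  set c := ENNReal.ofReal (Metric.diam Ω * |e v 2| / ‖v‖)
  have hv' : 0 < ‖v‖ := norm_pos_iff.2 hv
  have hes : Measurable fun x : E3 => B.indicator (1 : E3 → ℝ≥0∞) (e.symm x) :=
    (measurable_one.indicator hA).comp e.symm.continuous.measurable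
  -- Skew coordinates: y is the oblique projection and t the height. At fixed height they differ
  -- from orthogonal ones by a translation of y, so they preserve volume, while the lines of
  -- constant y are parallel to v.
  set pt : ℝ → EuclideanSpace ℝ (Fin 2) → E3 := fun t y =>
    e.symm !₂[y 0 + t / e v 2 * e v 0, y 1 + t / e v 2 * e v 1, t]
  have hpt : Continuous fun q : ℝ × EuclideanSpace ℝ (Fin 2) => pt q.1 q.2 := by
    refine e.symm.continuous.comp ((PiLp.continuous_toLp 2 _).comp ?_)
    refine continuous_pi fun i => ?_
    fin_cases i <;> simp <;> fun_prop
  have hI : volume B = ∫⁻ y, ∫⁻ t, B.indicator (1 : E3 → ℝ≥0∞) (pt t y) := by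
    calc volume B = ∫⁻ x, B.indicator (1 : E3 → ℝ≥0∞) (e.symm x) := by
          rw [e.symm.measurePreserving.lintegral_comp (measurable_one.indicator hA),
            lintegral_indicator_one hA]
      _ = ∫⁻ t : ℝ, ∫⁻ y : EuclideanSpace ℝ (Fin 2),
            B.indicator (1 : E3 → ℝ≥0∞) (e.symm !₂[y 0, y 1, t]) := lintegral_eq_height_planar hes
      _ = ∫⁻ t : ℝ, ∫⁻ y : EuclideanSpace ℝ (Fin 2), B.indicator (1 : E3 → ℝ≥0∞) (pt t y) := by
          refine lintegral_congr fun t => ?_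
          rw [← lintegral_add_right_eq_self _ ((t / e v 2) • planar (e v))]
          refine lintegral_congr fun y => ?_
          simp [pt]
      _ = _ := lintegral_lintegral_swap
          ((measurable_one.indicator hA).comp hpt.measurable).aemeasurable
  have hdiff : ∀ t t' y, pt t y - pt t' y = ((t - t') / e v 2) • v := by
    intro t t' y
    simp only [pt]
    rw [← map_sub, LinearIsometryEquiv.symm_apply_eq, map_smul]
    ext i
    fin_cases i <;> simp <;> field_simp
  have hproj : ∀ t y, obliqueProj (e v) (e (pt t y)) = y := by
    intro t y
    simp only [pt, LinearIsometryEquiv.apply_symm_apply, obliqueProj]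
    ext i
    fin_cases i <;> simp
  have hline : ∀ (x : E3) (s : ℝ), obliqueProj (e v) (e (x - s • v)) = obliqueProj (e v) (e x) := by
    intro x s
    simp only [obliqueProj, map_sub, map_smul, PiLp.sub_apply, PiLp.smul_apply, smul_eq_mul]
    rw [sub_div, mul_div_assoc, div_self he, mul_one, sub_smul]
    abel
  -- The projection of A need not be measurable, so a measurable hull takes its place.
  have hslice : ∀ y, ∫⁻ t, B.indicator (1 : E3 → ℝ≥0∞) (pt t y) ≤
      (toMeasurable volume P).indicator (fun _ => c) y := by
    intro y
    have hm : MeasurableSet ((fun t => pt t y) ⁻¹' B) :=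
      (hpt.comp (by fun_prop : Continuous fun t : ℝ => (t, y))).measurable hA
    have e1 : ∫⁻ t, B.indicator (1 : E3 → ℝ≥0∞) (pt t y) = volume ((fun t => pt t y) ⁻¹' B) := by
      rw [← lintegral_indicator_one hm]; rfl
    rw [e1]
    rcases ((fun t => pt t y) ⁻¹' B).eq_empty_or_nonempty with h | ⟨t, ht⟩
    · simp [h]
    · have hyP : y ∈ P := ⟨_, ht.2, by
        simp only [exitPoint]
        rw [hline, hproj]⟩
      rw [indicator_of_mem (subset_toMeasurable _ _ hyP)]
      refine (Real.volume_le_diam _).trans (Metric.ediam_le fun t ht t' ht' => ?_)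
      rw [edist_dist, Real.dist_eq]
      refine ENNReal.ofReal_le_ofReal ?_
      have h1 := Metric.dist_le_diam_of_mem hΩ.isBounded ht.1 ht'.1
      rw [dist_eq_norm, hdiff, norm_smul, Real.norm_eq_abs, abs_div] at h1
      rw [le_div_iff₀ hv']
      have h2 : 0 < |e v 2| := abs_pos.2 he
      rw [div_mul_eq_mul_div, div_le_iff₀ h2] at h1
      exact h1
  rw [hI]
  refine (lintegral_mono hslice).trans ?_
  rw [lintegral_indicator (measurableSet_toMeasurable _ _), setLIntegral_const,
    measure_toMeasurable]

/-- Away from tangency the oblique projection of a small boundary patch is 2-Lipschitz, because the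
patch is almost flat; hence it multiplies area by at most 4. Continuity of the normal makes |n·v|
comparable over the patch. -/
lemma IsConvexC2Domain.exists_nhds_volume_exit_le (hΩ : IsConvexC2Domain Ω) {v z : E3}
    (hz : z ∈ frontier Ω) (hzv : inner ℝ (outerNormal Ω z) v ≠ (0 : ℝ)) :
    ∃ U, IsOpen U ∧ z ∈ U ∧
      (∀ a ∈ U ∩ frontier Ω, |(inner ℝ (outerNormal Ω z) v : ℝ)| ≤
        2 * |(inner ℝ (outerNormal Ω a) v : ℝ)|) ∧
      ∀ A ⊆ U ∩ frontier Ω, MeasurableSet {x ∈ Ω | exitPoint Ω x v ∈ A} →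
        volume {x ∈ Ω | exitPoint Ω x v ∈ A} ≤
          ENNReal.ofReal (Metric.diam Ω * |(inner ℝ (outerNormal Ω z) v : ℝ)| / ‖v‖) *
            (4 * Measure.euclideanHausdorffMeasure 2 A) := by
  have hv : v ≠ 0 := by rintro rfl; simp at hzv
  have hv' : 0 < ‖v‖ := norm_pos_iff.2 hv
  obtain ⟨e, he⟩ := exists_isometry_coord (hΩ.outerNormal_spec hz).1
  rw [he v] at hzv ⊢
  have h2 : 0 < |e v 2| := abs_pos.2 hzv
  -- With this slope the oblique correction has length at most (|e v 2|/|v|)|a - a'|/|e v 2| · |v| =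
  -- |a - a'|, no more than the orthogonal projection itself.
  obtain ⟨U₁, hU₁, h1⟩ := hΩ.eventually_abs_inner_sub_le hz (ε := |e v 2| / ‖v‖) (by positivity)
  have hev : ∀ᶠ a in 𝓝[frontier Ω] z, |e v 2| / 2 < |(inner ℝ (outerNormal Ω a) v : ℝ)| := by
    have hc : ContinuousWithinAt (fun a => |(inner ℝ (outerNormal Ω a) v : ℝ)|) (frontier Ω) z :=
      ((hΩ.continuousOn_outerNormal z hz).inner continuousWithinAt_const).abs
    refine hc.eventually (lt_mem_nhds ?_)
    beta_reduce
    rw [he v]; linarith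
  obtain ⟨U₂, hU₂, h3⟩ := mem_nhdsWithin_iff_exists_mem_nhds_inter.1 hev
  obtain ⟨U, hU, hUo, hzU⟩ := mem_nhds_iff.1 (inter_mem hU₁ hU₂)
  refine ⟨U, hUo, hzU, fun a ha => ?_, fun A hA hm => ?_⟩
  · have := h3 ⟨(hU ha.1).2, ha.2⟩
    simp only [mem_ofPred_eq] at this
    linarith
  · refine (hΩ.volume_exit_le hv e hzv hm).trans (mul_le_mul_right ?_ _)
    have hlip : LipschitzOnWith 2 (fun x => obliqueProj (e v) (e x)) A := by
      refine LipschitzOnWith.of_dist_le_mul fun a ha a' ha' => ?_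
      have hb := h1 a ⟨(hU (hA ha).1).1, (hA ha).2⟩ a' ⟨(hU (hA ha').1).1, (hA ha').2⟩
      rw [he] at hb
      rw [dist_eq_norm, dist_eq_norm]
      have e1 : obliqueProj (e v) (e a) - obliqueProj (e v) (e a') =
          planar (e (a - a')) - (e (a - a') 2 / e v 2) • planar (e v) := by
        simp only [obliqueProj, map_sub, PiLp.sub_apply, sub_div, sub_smul]
        abel
      rw [e1]
      refine (norm_sub_le _ _).trans ?_
      have e2 : ‖planar (e (a - a'))‖ ≤ ‖a - a'‖ := (norm_planar_le _).trans (e.norm_map _).le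
      have e3 : ‖(e (a - a') 2 / e v 2) • planar (e v)‖ ≤ ‖a - a'‖ := by
        rw [norm_smul, Real.norm_eq_abs, abs_div]
        calc |e (a - a') 2| / |e v 2| * ‖planar (e v)‖
            ≤ (|e v 2| / ‖v‖ * ‖a - a'‖) / |e v 2| * ‖v‖ := by
              gcongr
              exact (norm_planar_le _).trans (e.norm_map _).le
          _ = ‖a - a'‖ := by field_simp
      rw [NNReal.coe_ofNat]
      linarith
    have := euclideanHausdorff_image_le hlip
    rw [EuclideanSpace.euclideanHausdorffMeasure_eq_volume] at this
    refine this.trans (le_of_eq ?_)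
    norm_num

/-- The push-forward of the volume under the exit map is controlled by `|n·v| dΣ`. -/
lemma IsConvexC2Domain.lintegral_exitPoint_le (hΩ : IsConvexC2Domain Ω) {v : E3} (hv : v ≠ 0)
    {F : E3 → ℝ≥0∞} (hF : Measurable F) :
    ∫⁻ x in Ω, F (regExitPoint Ω (x, v)) ≤ 8 * ENNReal.ofReal (Metric.diam Ω) * ‖v‖ₑ⁻¹ *
      ∫⁻ z, ‖(inner ℝ (outerNormal Ω z) v : ℝ)‖ₑ * F z ∂surfaceMeasure Ω := by
  have hv' : 0 < ‖v‖ := norm_pos_iff.2 hv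
  have hq : Measurable fun x => regExitPoint Ω (x, v) :=
    hΩ.measurable_regExitPoint.comp (by fun_prop)
  have hn : Measurable fun z => ‖(inner ℝ (outerNormal Ω z) v : ℝ)‖ₑ :=
    (hΩ.measurable_outerNormal.inner measurable_const).enorm
  -- The 8 is 4 from the area distortion of the oblique projection times 2 from the variation of
  -- |n·v| over a patch. Only its independence of Ω matters.
  set c : ℝ≥0∞ := 8 * ENNReal.ofReal (Metric.diam Ω) * ‖v‖ₑ⁻¹
  set lam := Measure.map (fun x => regExitPoint Ω (x, v)) (volume.restrict Ω)
  set kap := (surfaceMeasure Ω).withDensity fun z => c * ‖(inner ℝ (outerNormal Ω z) v : ℝ)‖ₑ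
  have hset : ∀ A, {x ∈ Ω | exitPoint Ω x v ∈ A} = (fun x => regExitPoint Ω (x, v)) ⁻¹' A ∩ Ω := by
    intro A
    ext x
    by_cases hx : x ∈ Ω
    · have : regExitPoint Ω (x, v) = exitPoint Ω x v := regExitPoint_of_mem ⟨hx, hv⟩
      simp [hx, this]
    · simp [hx]
  have hlam : ∀ A, MeasurableSet A → lam A = volume {x ∈ Ω | exitPoint Ω x v ∈ A} := by
    intro A hA
    rw [Measure.map_apply hq hA, Measure.restrict_apply (hq hA), hset]
  -- Every exit point is non-tangential, so the push-forward gives no mass to the complement of this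
  -- set.
  set G : Set E3 := {z ∈ frontier Ω | inner ℝ (outerNormal Ω z) v ≠ (0 : ℝ)}
  have hGm : MeasurableSet G := isClosed_frontier.measurableSet.inter
    ((hΩ.measurable_outerNormal.inner measurable_const) (measurableSet_singleton (0 : ℝ)).compl)
  have hGc : lam Gᶜ = 0 := by
    rw [hlam _ hGm.compl]
    have : {x ∈ Ω | exitPoint Ω x v ∈ Gᶜ} = ∅ := by
      refine eq_empty_of_forall_notMem fun x hx => hx.2 ?_
      exact ⟨hΩ.exitPoint_mem_frontier hx.1 hv, (hΩ.inner_outerNormal_exitPoint_neg hx.1 hv).ne⟩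
    rw [this, measure_empty]
  choose! U hUo hzU hUn hUA using fun z (hz : z ∈ G) => hΩ.exists_nhds_volume_exit_le hz.1 hz.2
  -- By the Lindelöf property countably many good patches cover G. Made disjoint, they turn the
  -- local comparison into a comparison of measures.
  obtain ⟨t, htG, htc, htcov⟩ := TopologicalSpace.countable_cover_nhdsWithin (s := G) (f := U)
    fun z hz => mem_nhdsWithin_of_mem_nhds ((hUo z hz).mem_nhds (hzU z hz))
  have hloc : ∀ z ∈ t, ∀ A, MeasurableSet A → A ⊆ U z ∩ frontier Ω → lam A ≤ kap A := by
    intro z hz A hA hAU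
    rw [hlam A hA]
    refine (hUA z (htG hz) A hAU (by rw [hset]; exact (hq hA).inter hΩ.isOpen.measurableSet)).trans ?_
    rw [withDensity_apply _ hA, surfaceMeasure, Measure.restrict_restrict hA,
      inter_eq_left.2 (hAU.trans inter_subset_right)]
    have hle : ∫⁻ _ in A, c * (‖(inner ℝ (outerNormal Ω z) v : ℝ)‖ₑ / 2)
        ∂(Measure.euclideanHausdorffMeasure 2 : Measure E3) ≤
        ∫⁻ a in A, c * ‖(inner ℝ (outerNormal Ω a) v : ℝ)‖ₑ
          ∂(Measure.euclideanHausdorffMeasure 2 : Measure E3) := by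
      refine setLIntegral_mono (measurable_const.mul hn) fun a ha => mul_le_mul_right ?_ _
      refine ENNReal.div_le_of_le_mul ?_
      have := hUn z (htG hz) a (hAU ha)
      have h' := ENNReal.ofReal_le_ofReal this
      rwa [ENNReal.ofReal_mul (by norm_num), ENNReal.ofReal_ofNat, ← Real.enorm_eq_ofReal_abs,
        ← Real.enorm_eq_ofReal_abs, mul_comm] at h'
    refine le_trans (le_of_eq ?_) hle
    rw [setLIntegral_const, ← mul_assoc, mul_div_assoc, ENNReal.ofReal_mul Metric.diam_nonneg,
      ENNReal.ofReal_div_of_pos hv', ← Real.enorm_eq_ofReal_abs, ofReal_norm]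
    simp only [c, div_eq_mul_inv]
    have h8 : (8 : ℝ≥0∞) * 2⁻¹ = 4 := by
      rw [show (8 : ℝ≥0∞) = 4 * 2 by norm_num, mul_assoc,
        ENNReal.mul_inv_cancel (by norm_num) (by norm_num), mul_one]
    rw [show ∀ D N I M : ℝ≥0∞, 8 * D * N * (I * 2⁻¹) * M = (8 * 2⁻¹) * D * N * I * M by
      intros; ring, h8]
    ring
  have hmain : lam ≤ kap := by
    refine Measure.le_iff.2 fun A hA => ?_
    have h1 : lam A ≤ lam (A ∩ G) := by
      rw [← measure_inter_add_sdiff A hGm, ← add_zero (lam (A ∩ G))]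
      refine add_le_add (by simp) (le_of_eq (measure_mono_null ?_ hGc))
      exact fun x hx => hx.2
    refine h1.trans ?_
    rcases t.eq_empty_or_nonempty with rfl | hne
    · have : G = ∅ := by simpa using htcov
      simp [this]
    obtain ⟨f, hf⟩ := htc.exists_eq_range hne
    set V : ℕ → Set E3 := fun i => A ∩ G ∩ U (f i)
    have hft : ∀ i, f i ∈ t := fun i => hf ▸ mem_range_self i
    have hVm : ∀ i, MeasurableSet (V i) := fun i =>
      (hA.inter hGm).inter (hUo _ (htG (hft i))).measurableSet
    have hcov : A ∩ G = ⋃ i, disjointed V i := by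
      rw [iUnion_disjointed]
      refine Subset.antisymm (fun x hx => ?_) (iUnion_subset fun i => inter_subset_left)
      obtain ⟨z, hz, hxz⟩ := mem_iUnion₂.1 (htcov hx.2)
      rw [hf] at hz
      obtain ⟨i, rfl⟩ := hz
      exact mem_iUnion.2 ⟨i, hx, hxz⟩
    have hdm : ∀ i, MeasurableSet (disjointed V i) := MeasurableSet.disjointed hVm
    calc lam (A ∩ G) = ∑' i, lam (disjointed V i) := by
          rw [hcov, measure_iUnion (disjoint_disjointed V) hdm]
      _ ≤ ∑' i, kap (disjointed V i) := by
          refine ENNReal.tsum_le_tsum fun i => hloc (f i) (hft i) _ (hdm i) ?_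
          exact (disjointed_subset V i).trans fun x hx => ⟨hx.2, hx.1.2.1⟩
      _ = kap (A ∩ G) := by rw [hcov, measure_iUnion (disjoint_disjointed V) hdm]
      _ ≤ kap A := measure_mono inter_subset_left
  calc ∫⁻ x in Ω, F (regExitPoint Ω (x, v)) = ∫⁻ z, F z ∂lam := (lintegral_map hF hq).symm
    _ ≤ ∫⁻ z, F z ∂kap := lintegral_mono' hmain le_rfl
    _ = _ := by
      rw [show kap = (surfaceMeasure Ω).withDensity fun z =>
        c * ‖(inner ℝ (outerNormal Ω z) v : ℝ)‖ₑ from rfl,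
        lintegral_withDensity_eq_lintegral_mul _ (hn.const_mul c) hF,
        ← lintegral_const_mul (f := fun z => ‖(inner ℝ (outerNormal Ω z) v : ℝ)‖ₑ * F z) c
          (hn.mul hF)]
      simp only [Pi.mul_apply, mul_assoc]

end

section

/-! ### Integral operators bounded on weighted Lebesgue spaces -/

lemma lintegral_rpow_le_measure_mul {X : Type*} [MeasurableSpace X] (m : Measure X) {p : ℝ}
    (hp : 1 ≤ p) {f : X → ℝ≥0∞} (hf : AEMeasurable f m) :
    (∫⁻ x, f x ∂m) ^ p ≤ m univ ^ (p - 1) * ∫⁻ x, f x ^ p ∂m := by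
  have hp0 : 0 < p := by linarith
  have h := eLpNorm'_le_eLpNorm'_mul_rpow_measure_univ (p := 1) (q := p) (μ := m) (f := f)
    zero_lt_one hp hf.aestronglyMeasurable
  simp only [eLpNorm', enorm_eq_self, ENNReal.rpow_one, div_one, one_div] at h
  have h2 := ENNReal.rpow_le_rpow h hp0.le
  rw [ENNReal.mul_rpow_of_nonneg _ _ hp0.le, ← ENNReal.rpow_mul, inv_mul_cancel₀ hp0.ne',
    ENNReal.rpow_one, ← ENNReal.rpow_mul] at h2
  rw [show p - 1 = (1 - p⁻¹) * p by rw [sub_mul, inv_mul_cancel₀ hp0.ne', one_mul]]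
  rw [mul_comm]
  simpa using h2

/-- Hölder's inequality for the measure with density Q. This is the first half of the Schur test: p
- 1 powers go to the total mass of the kernel, and one power of the kernel remains to be integrated
in the other variables. -/
lemma lintegral_mul_rpow_le {X : Type*} [MeasurableSpace X] (m : Measure X) {p : ℝ}
    (hp : 1 ≤ p) {Q f : X → ℝ≥0∞} (hQ : Measurable Q) (hf : Measurable f) :
    (∫⁻ x, Q x * f x ∂m) ^ p ≤ (∫⁻ x, Q x ∂m) ^ (p - 1) * ∫⁻ x, Q x * f x ^ p ∂m := by
  have h := lintegral_rpow_le_measure_mul (m.withDensity Q) hp hf.aemeasurable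
  rwa [lintegral_withDensity_eq_lintegral_mul _ hQ hf, withDensity_apply _ MeasurableSet.univ,
    Measure.restrict_univ, lintegral_withDensity_eq_lintegral_mul _ hQ (hf.pow_const p)] at h

variable {W : Type*} [MeasurableSpace W]

/-- The positive operator with kernel `|R|`, precomposed with `T`, is bounded between weighted
Lebesgue spaces. -/
def KernelBound (p α : ℝ) (μ η : Measure (E3 × E3)) (m : Measure W) (R : (E3 × E3) × W → ℝ)
    (T : (E3 × E3) × W → E3 × E3) (C : ℝ≥0∞) : Prop :=
  ∀ u : E3 × E3 → ℝ≥0∞, Measurable u →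
    ∫⁻ z, (gaussWeight α z.2 * ∫⁻ o, ‖R (z, o)‖ₑ * u (T (z, o)) ∂m) ^ p ∂μ ≤
      C * ∫⁻ y, (gaussWeight α y.2 * u y) ^ p ∂η

/-- The integral operator with kernel `R`, precomposed with `T`. -/
def kernelOp (m : Measure W) (R : (E3 × E3) × W → ℝ) (T : (E3 × E3) × W → E3 × E3)
    (u : E3 × E3 → ℝ) (z : E3 × E3) : ℝ :=
  ∫ o, R (z, o) * u (T (z, o)) ∂m

lemma weightedLpNorm_eq {F : Type*} [NormedAddCommGroup F] {p : ℝ} (hp : 0 ≤ p) (α : ℝ)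
    (μ : Measure (E3 × E3)) (f : E3 × E3 → F) :
    weightedLpNorm p α μ f = (∫⁻ z, (gaussWeight α z.2 * ‖f z‖ₑ) ^ p ∂μ) ^ (1 / p) := by
  rw [weightedLpNorm]
  congr 1
  refine lintegral_congr fun z => ?_
  rw [ENNReal.mul_rpow_of_nonneg _ _ hp, gaussWeight, ENNReal.ofReal_rpow_of_pos (Real.exp_pos _),
    ← Real.exp_mul, mul_comm]
  ring_nf

lemma one_le_gaussWeight {α : ℝ} (hα : 0 ≤ α) (v : E3) : 1 ≤ gaussWeight α v := by
  rw [gaussWeight, ENNReal.one_le_ofReal]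
  exact Real.one_le_exp (by positivity)

section

variable {p α : ℝ} {μ η : Measure (E3 × E3)} {m : Measure W} [SFinite m]
  {R : (E3 × E3) × W → ℝ} {T : (E3 × E3) × W → E3 × E3} {C : ℝ≥0∞}

/-- Apply the bound to the indicator of a null set: the kernel never sends mass there. Hence the
operator acts on almost everywhere classes, although T itself is not assumed to pull null sets back
to null sets. -/
lemma KernelBound.ae_prod (hK : KernelBound p α μ η m R T C) (hp : 0 < p) (hR : Measurable R)
    (hT : Measurable T) {N : Set (E3 × E3)} (hN : MeasurableSet N) (hN0 : η N = 0) :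
    ∀ᵐ q ∂μ.prod m, R q = 0 ∨ T q ∉ N := by
  have hu : Measurable (N.indicator (1 : E3 × E3 → ℝ≥0∞)) := measurable_one.indicator hN
  have h := hK _ hu
  have h0 : ∫⁻ y, (gaussWeight α y.2 * N.indicator (1 : E3 × E3 → ℝ≥0∞) y) ^ p ∂η = 0 := by
    have hm0 : Measurable fun y : E3 × E3 =>
        (gaussWeight α y.2 * N.indicator (1 : E3 × E3 → ℝ≥0∞) y) ^ p :=
      (((measurable_gaussWeight α).comp measurable_snd).mul hu).pow_const p
    rw [lintegral_eq_zero_iff hm0]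
    have : ∀ᵐ y ∂η, y ∉ N := measure_eq_zero_iff_ae_notMem.1 hN0
    filter_upwards [this] with y hy
    simp [hy, hp]
  rw [h0, mul_zero, nonpos_iff_eq_zero] at h
  have hm1 : Measurable fun q => ‖R q‖ₑ * N.indicator (1 : E3 × E3 → ℝ≥0∞) (T q) :=
    hR.enorm.mul (hu.comp hT)
  have hm2 : Measurable fun z => ∫⁻ o, ‖R (z, o)‖ₑ * N.indicator (1 : E3 × E3 → ℝ≥0∞) (T (z, o)) ∂m :=
    hm1.lintegral_prod_right'
  have hm3 : Measurable fun z : E3 × E3 => (gaussWeight α z.2 *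
      ∫⁻ o, ‖R (z, o)‖ₑ * N.indicator (1 : E3 × E3 → ℝ≥0∞) (T (z, o)) ∂m) ^ p :=
    (((measurable_gaussWeight α).comp measurable_snd).mul hm2).pow_const p
  rw [lintegral_eq_zero_iff hm3] at h
  have h1 : ∫⁻ q, ‖R q‖ₑ * N.indicator (1 : E3 × E3 → ℝ≥0∞) (T q) ∂μ.prod m = 0 := by
    rw [lintegral_prod _ hm1.aemeasurable, lintegral_eq_zero_iff hm2]
    filter_upwards [h] with z hz
    have := (ENNReal.rpow_eq_zero_iff_of_pos hp).1 hz
    exact (mul_eq_zero.1 this).resolve_left (gaussWeight_pos _ _)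
  rw [lintegral_eq_zero_iff hm1] at h1
  filter_upwards [h1] with q hq
  rcases mul_eq_zero.1 hq with h' | h'
  · left; simpa using h'
  · right; intro hqN; simp [hqN] at h'

lemma KernelBound.ae_eq (hK : KernelBound p α μ η m R T C) (hp : 0 < p) (hR : Measurable R)
    (hT : Measurable T) {u u' : E3 × E3 → ℝ} (huu : u =ᵐ[η] u') :
    ∀ᵐ q ∂μ.prod m, R q * u (T q) = R q * u' (T q) := by
  set N := toMeasurable η {y | u y ≠ u' y}
  have hN0 : η N = 0 := by rw [measure_toMeasurable]; exact huu
  filter_upwards [hK.ae_prod hp hR hT (measurableSet_toMeasurable _ _) hN0] with q hq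
  rcases hq with h | h
  · simp [h]
  · have : u (T q) = u' (T q) := by
      by_contra hne
      exact h (subset_toMeasurable _ _ hne)
    rw [this]

lemma KernelBound.aestronglyMeasurable (hK : KernelBound p α μ η m R T C) (hp : 0 < p)
    (hR : Measurable R) (hT : Measurable T) {u : E3 × E3 → ℝ} (hu : AEStronglyMeasurable u η) :
    AEStronglyMeasurable (fun q => R q * u (T q)) (μ.prod m) :=
  ⟨fun q => R q * hu.mk u (T q),
    (hR.mul (hu.stronglyMeasurable_mk.measurable.comp hT)).stronglyMeasurable,
    hK.ae_eq hp hR hT hu.ae_eq_mk⟩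

lemma KernelBound.lintegral_le (hK : KernelBound p α μ η m R T C) (hp : 0 < p)
    (hR : Measurable R) (hT : Measurable T) {u : E3 × E3 → ℝ} (hu : AEStronglyMeasurable u η) :
    ∫⁻ z, (gaussWeight α z.2 * ∫⁻ o, ‖R (z, o) * u (T (z, o))‖ₑ ∂m) ^ p ∂μ ≤
      C * ∫⁻ y, (gaussWeight α y.2 * ‖u y‖ₑ) ^ p ∂η := by
  have h1 := hK _ hu.stronglyMeasurable_mk.measurable.enorm
  have e1 : ∫⁻ y, (gaussWeight α y.2 * ‖u y‖ₑ) ^ p ∂η =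
      ∫⁻ y, (gaussWeight α y.2 * ‖hu.mk u y‖ₑ) ^ p ∂η := by
    refine lintegral_congr_ae ?_
    filter_upwards [hu.ae_eq_mk] with y hy
    rw [hy]
  rw [e1]
  refine le_trans (le_of_eq (lintegral_congr_ae ?_)) h1
  filter_upwards [Measure.ae_ae_of_ae_prod (hK.ae_eq hp hR hT hu.ae_eq_mk)] with z hz
  rw [lintegral_congr_ae (g := fun o => ‖R (z, o)‖ₑ * ‖hu.mk u (T (z, o))‖ₑ)]
  filter_upwards [hz] with o ho
  rw [ho, enorm_mul]

lemma KernelBound.weightedLpNorm_le (hK : KernelBound p α μ η m R T C) (hp : 0 < p)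
    (hR : Measurable R) (hT : Measurable T) {u : E3 × E3 → ℝ} (hu : AEStronglyMeasurable u η) :
    weightedLpNorm p α μ (kernelOp m R T u) ≤ C ^ (1 / p) * weightedLpNorm p α η u := by
  rw [weightedLpNorm_eq hp.le, weightedLpNorm_eq hp.le,
    ← ENNReal.mul_rpow_of_nonneg _ _ (by positivity)]
  refine ENNReal.rpow_le_rpow ((lintegral_mono fun z => ?_).trans (hK.lintegral_le hp hR hT hu))
    (by positivity)
  refine ENNReal.rpow_le_rpow (mul_le_mul_right ?_ _) hp.le
  exact enorm_integral_le_lintegral_enorm _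

/-- On the finite-measure support of a test function the bound in L^p gives one in L¹. It is linear
in the norm of u, which makes the pairings continuous. -/
lemma KernelBound.lintegral_test_le (hK : KernelBound p 0 μ η m R T C) (hp : 1 ≤ p)
    (hR : Measurable R) (hT : Measurable T) {u : E3 × E3 → ℝ} (hu : AEStronglyMeasurable u η)
    {χ : E3 × E3 → ℝ} {A : Set (E3 × E3)} {B : ℝ≥0∞} (hA : MeasurableSet A)
    (hχA : ∀ z ∉ A, χ z = 0) (hχB : ∀ z, ‖χ z‖ₑ ≤ B) :
    ∫⁻ q, ‖χ q.1 * (R q * u (T q))‖ₑ ∂μ.prod m ≤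
      B * (μ A ^ (p - 1) * C) ^ (1 / p) * weightedLpNorm p 0 η u := by
  have hp0 : 0 < p := by linarith
  have hRm := hK.aestronglyMeasurable hp0 hR hT hu
  have hgw : ∀ v, gaussWeight 0 v = 1 := fun v => by simp [gaussWeight]
  set f : E3 × E3 → ℝ≥0∞ := fun z => ∫⁻ o, ‖R (z, o) * u (T (z, o))‖ₑ ∂m
  have hf : AEMeasurable f μ := hRm.enorm.lintegral_prod_right'
  calc ∫⁻ q, ‖χ q.1 * (R q * u (T q))‖ₑ ∂μ.prod m
      ≤ ∫⁻ q, A.indicator (fun _ => B) q.1 * ‖R q * u (T q)‖ₑ ∂μ.prod m := by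
        refine lintegral_mono fun q => ?_
        rw [enorm_mul]
        refine mul_le_mul_left ?_ _
        by_cases hq : q.1 ∈ A
        · rw [indicator_of_mem hq]; exact hχB _
        · simp [hχA _ hq]
    _ = ∫⁻ z, A.indicator (fun _ => B) z * f z ∂μ := by
        have hm1 : AEMeasurable (fun q : (E3 × E3) × W =>
            A.indicator (fun _ => B) q.1 * ‖R q * u (T q)‖ₑ) (μ.prod m) :=
          ((measurable_const.indicator hA).comp measurable_fst).aemeasurable.mul hRm.enorm
        rw [lintegral_prod _ hm1]
        refine lintegral_congr_ae ?_
        filter_upwards [hRm.prodMk_left] with z hz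
        exact lintegral_const_mul'' _ hz.enorm
    _ = B * ∫⁻ z in A, f z ∂μ := by
        rw [← lintegral_const_mul'' _ hf.restrict, ← lintegral_indicator hA]
        refine lintegral_congr fun z => ?_
        by_cases hz : z ∈ A <;> simp [hz]
    _ ≤ B * ((μ A ^ (p - 1) * C) ^ (1 / p) * weightedLpNorm p 0 η u) := by
        refine mul_le_mul_right ?_ _
        have h1 := lintegral_rpow_le_measure_mul (μ.restrict A) hp hf.restrict
        rw [Measure.restrict_apply_univ] at h1
        have h2 := hK.lintegral_le hp0 hR hT hu
        simp only [hgw, one_mul] at h2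
        have h3 : (∫⁻ z in A, f z ∂μ) ^ p ≤
            (μ A ^ (p - 1) * C) * ∫⁻ y, ‖u y‖ₑ ^ p ∂η := by
          refine h1.trans ?_
          rw [mul_assoc]
          exact mul_le_mul_right ((setLIntegral_le_lintegral _ _).trans h2) _
        rw [weightedLpNorm_eq hp0.le, ← ENNReal.mul_rpow_of_nonneg _ _ (by positivity)]
        simp only [hgw, one_mul]
        rw [one_div, ENNReal.le_rpow_inv_iff hp0]
        exact h3
    _ = _ := by rw [mul_assoc]

/-- The integral of a test function against the image of `u`, as an integral over the product. -/
def testPairing (μ : Measure (E3 × E3)) (m : Measure W) (R : (E3 × E3) × W → ℝ)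
    (T : (E3 × E3) × W → E3 × E3) (χ u : E3 × E3 → ℝ) : ℝ :=
  ∫ q, χ q.1 * (R q * u (T q)) ∂μ.prod m

lemma KernelBound.integrable_test (hK : KernelBound p 0 μ η m R T C) (hC : C ≠ ⊤) (hp : 1 ≤ p)
    (hR : Measurable R) (hT : Measurable T) {u : E3 × E3 → ℝ} (hu : AEStronglyMeasurable u η)
    (huf : weightedLpNorm p 0 η u < ⊤)
    {χ : E3 × E3 → ℝ} {A : Set (E3 × E3)} {B : ℝ≥0} (hA : MeasurableSet A) (hAf : μ A < ⊤)
    (hχ : Measurable χ) (hχA : ∀ z ∉ A, χ z = 0) (hχB : ∀ z, ‖χ z‖ₑ ≤ B) :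
    Integrable (fun q => χ q.1 * (R q * u (T q))) (μ.prod m) := by
  refine ⟨(hχ.comp measurable_fst).aestronglyMeasurable.mul
    (hK.aestronglyMeasurable (by linarith) hR hT hu), ?_⟩
  refine (hK.lintegral_test_le hp hR hT hu hA hχA hχB).trans_lt ?_
  refine ENNReal.mul_lt_top (ENNReal.mul_lt_top ENNReal.coe_lt_top ?_) huf
  exact ENNReal.rpow_lt_top_of_nonneg (by positivity)
    (ENNReal.mul_ne_top (ENNReal.rpow_ne_top_of_nonneg (by linarith) hAf.ne) hC)

lemma KernelBound.tendsto_testPairing (hK : KernelBound p 0 μ η m R T C) (hC : C ≠ ⊤) (hp : 1 ≤ p)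
    (hR : Measurable R) (hT : Measurable T) {u : E3 × E3 → ℝ} (hu : AEStronglyMeasurable u η)
    (huf : weightedLpNorm p 0 η u < ⊤) {w : ℕ → E3 × E3 → ℝ}
    (hw : ∀ n, AEStronglyMeasurable (w n) η)
    (hwu : Tendsto (fun n => weightedLpNorm p 0 η (u - w n)) atTop (𝓝 0))
    {χ : E3 × E3 → ℝ} {A : Set (E3 × E3)} {B : ℝ≥0} (hA : MeasurableSet A) (hAf : μ A < ⊤)
    (hχ : Measurable χ) (hχA : ∀ z ∉ A, χ z = 0) (hχB : ∀ z, ‖χ z‖ₑ ≤ B) :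
    Tendsto (fun n => testPairing μ m R T χ (w n)) atTop (𝓝 (testPairing μ m R T χ u)) := by
  have hfin : ∀ᶠ n in atTop, weightedLpNorm p 0 η (u - w n) < ⊤ :=
    hwu.eventually (gt_mem_nhds ENNReal.zero_lt_top)
  set K : ℝ≥0∞ := B * (μ A ^ (p - 1) * C) ^ (1 / p)
  have hKf : K ≠ ⊤ := ENNReal.mul_ne_top ENNReal.coe_ne_top
    (ENNReal.rpow_ne_top_of_nonneg (by positivity)
    (ENNReal.mul_ne_top (ENNReal.rpow_ne_top_of_nonneg (by linarith) hAf.ne) hC))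
  rw [tendsto_iff_edist_tendsto_0]
  have hlim : Tendsto (fun n => K * weightedLpNorm p 0 η (u - w n)) atTop (𝓝 0) := by
    have := ENNReal.Tendsto.const_mul hwu (Or.inr hKf)
    rwa [mul_zero] at this
  refine tendsto_of_tendsto_of_tendsto_of_le_of_le' tendsto_const_nhds hlim
    (Eventually.of_forall fun _ => zero_le) ?_
  filter_upwards [hfin] with n hn
  have hI1 := hK.integrable_test hC hp hR hT hu huf hA hAf hχ hχA hχB
  have hI2 := hK.integrable_test hC hp hR hT (hu.sub (hw n)) hn hA hAf hχ hχA hχB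
  -- Finite norm is known for u and for u - w n, so the pairing with w n is written as a difference
  -- of two convergent integrals.
  have heq : testPairing μ m R T χ (w n) =
      testPairing μ m R T χ u - testPairing μ m R T χ (u - w n) := by
    rw [testPairing, testPairing, testPairing, ← integral_sub hI1 hI2]
    refine integral_congr_ae (Eventually.of_forall fun q => ?_)
    simp only [Pi.sub_apply]
    ring
  rw [heq, edist_comm, edist_eq_enorm_sub, sub_sub_cancel]
  exact (enorm_integral_le_lintegral_enorm _).trans
    (hK.lintegral_test_le hp hR hT (hu.sub (hw n)) hA hχA hχB)

lemma testPairing_eq [SFinite μ] {χ u : E3 × E3 → ℝ}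
    (h : Integrable (fun q => χ q.1 * (R q * u (T q))) (μ.prod m)) :
    testPairing μ m R T χ u = ∫ z, χ z * kernelOp m R T u z ∂μ := by
  rw [testPairing, integral_prod _ h]
  simp only [kernelOp, integral_const_mul]

lemma KernelBound.aestronglyMeasurable_kernelOp [SFinite μ] (hK : KernelBound p α μ η m R T C)
    (hp : 0 < p) (hR : Measurable R) (hT : Measurable T) {u : E3 × E3 → ℝ}
    (hu : AEStronglyMeasurable u η) : AEStronglyMeasurable (kernelOp m R T u) μ :=
  (hK.aestronglyMeasurable hp hR hT hu).integral_prod_right'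

end

end

section

/-! ### Boundedness of the interior operators -/

variable {Ω : Set E3}

/-- The parameter space `(w, s)` of the interior operators. -/
def streamMeasure : Measure (E3 × ℝ) := (volume : Measure E3).prod (volume.restrict (Ioi (0 : ℝ)))

instance : SFinite streamMeasure := by unfold streamMeasure; infer_instance

/-- Backward free streaming. -/
def streamMap (q : (E3 × E3) × (E3 × ℝ)) : E3 × E3 := (q.1.1 - q.2.2 • q.1.2, q.2.1)

lemma measurable_streamMap : Measurable streamMap := by unfold streamMap; fun_prop

/-- The kernel `1_Ω(x - s v) r(v, w, s)`. -/
def interiorKernel (Ω : Set E3) (r : E3 × E3 × ℝ → ℝ) (q : (E3 × E3) × (E3 × ℝ)) : ℝ :=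
  Ω.indicator (fun _ => r (q.1.2, q.2)) (q.1.1 - q.2.2 • q.1.2)

lemma measurable_interiorKernel (hΩ : IsOpen Ω) {r : E3 × E3 × ℝ → ℝ} (hr : Measurable r) :
    Measurable (interiorKernel Ω r) := by
  have h : MeasurableSet {q : (E3 × E3) × (E3 × ℝ) | q.1.1 - q.2.2 • q.1.2 ∈ Ω} :=
    (hΩ.preimage (by fun_prop : Continuous fun q : (E3 × E3) × (E3 × ℝ) =>
      q.1.1 - q.2.2 • q.1.2)).measurableSet
  have h2 : Measurable fun q : (E3 × E3) × (E3 × ℝ) => r (q.1.2, q.2) := by fun_prop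
  exact h2.indicator h

lemma phaseMeasure_eq (Ω : Set E3) :
    phaseMeasure Ω = (volume.restrict Ω).prod (volume : Measure E3) := by
  rw [phaseMeasure, Measure.volume_eq_prod, ← Measure.prod_restrict, Measure.restrict_univ]

instance : SFinite (phaseMeasure Ω) := by rw [phaseMeasure_eq]; infer_instance

/-- Tonelli and the translation y = x - sv, under which the condition that x and x - sv lie in Ω
becomes that y and y + sv do. -/
lemma lintegral_stream_swap (hΩ : IsOpen Ω) {Q : E3 × E3 × ℝ → ℝ≥0∞} (hQ : Measurable Q)
    {f : E3 × E3 → ℝ≥0∞} (hf : Measurable f) :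
    ∫⁻ z, ∫⁻ o, Ω.indicator 1 (z.1 - o.2 • z.2) * Q (z.2, o) * f (z.1 - o.2 • z.2, o.1)
        ∂streamMeasure ∂phaseMeasure Ω =
      ∫⁻ y in Ω, ∫⁻ w, f (y, w) *
        ∫⁻ v, ∫⁻ s in Ioi (0 : ℝ), Ω.indicator 1 (y + s • v) * Q (v, w, s) := by
  set i : E3 → ℝ≥0∞ := Ω.indicator 1
  have hi : Measurable i := measurable_one.indicator hΩ.measurableSet
  have hGm : Measurable fun q : (E3 × E3) × (E3 × ℝ) =>
      i (q.1.1 - q.2.2 • q.1.2) * Q (q.1.2, q.2) * f (q.1.1 - q.2.2 • q.1.2, q.2.1) := by fun_prop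
  calc _ = ∫⁻ x in Ω, ∫⁻ v, ∫⁻ w, ∫⁻ s in Ioi (0 : ℝ),
        i (x - s • v) * Q (v, w, s) * f (x - s • v, w) := by
        rw [phaseMeasure_eq, lintegral_prod _ hGm.lintegral_prod_right'.aemeasurable]
        refine lintegral_congr fun x => lintegral_congr fun v => ?_
        rw [streamMeasure, lintegral_prod]
        exact Measurable.aemeasurable (by fun_prop)
    _ = ∫⁻ v, ∫⁻ w, ∫⁻ s in Ioi (0 : ℝ), ∫⁻ x in Ω,
        i (x - s • v) * Q (v, w, s) * f (x - s • v, w) := by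
        rw [lintegral_lintegral_swap (Measurable.aemeasurable (by unfold Function.uncurry; fun_prop))]
        refine lintegral_congr fun v => ?_
        rw [lintegral_lintegral_swap (Measurable.aemeasurable (by unfold Function.uncurry; fun_prop))]
        refine lintegral_congr fun w => ?_
        rw [lintegral_lintegral_swap (Measurable.aemeasurable (by unfold Function.uncurry; fun_prop))]
    _ = ∫⁻ v, ∫⁻ w, ∫⁻ s in Ioi (0 : ℝ), ∫⁻ y in Ω, i (y + s • v) * Q (v, w, s) * f (y, w) := by
        refine lintegral_congr fun v => lintegral_congr fun w => lintegral_congr fun s => ?_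
        rw [← lintegral_indicator hΩ.measurableSet, ← lintegral_indicator hΩ.measurableSet,
          ← lintegral_add_right_eq_self _ (s • v)]
        refine lintegral_congr fun y => ?_
        by_cases h1 : y ∈ Ω <;> by_cases h2 : y + s • v ∈ Ω <;> simp [i, h1, h2]
    _ = ∫⁻ y in Ω, ∫⁻ w, ∫⁻ v, ∫⁻ s in Ioi (0 : ℝ), i (y + s • v) * Q (v, w, s) * f (y, w) := by
        have e1 : ∀ v w, (∫⁻ s in Ioi (0 : ℝ), ∫⁻ y in Ω, i (y + s • v) * Q (v, w, s) * f (y, w)) =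
            ∫⁻ y in Ω, ∫⁻ s in Ioi (0 : ℝ), i (y + s • v) * Q (v, w, s) * f (y, w) := fun v w =>
          lintegral_lintegral_swap (Measurable.aemeasurable (by unfold Function.uncurry; fun_prop))
        simp_rw [e1]
        have e2 : ∀ v, (∫⁻ w, ∫⁻ y in Ω, ∫⁻ s in Ioi (0 : ℝ),
            i (y + s • v) * Q (v, w, s) * f (y, w)) =
            ∫⁻ y in Ω, ∫⁻ w, ∫⁻ s in Ioi (0 : ℝ), i (y + s • v) * Q (v, w, s) * f (y, w) :=
          fun v => lintegral_lintegral_swap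
            (Measurable.aemeasurable (by unfold Function.uncurry; fun_prop))
        simp_rw [e2]
        rw [lintegral_lintegral_swap (Measurable.aemeasurable (by unfold Function.uncurry; fun_prop))]
        refine lintegral_congr fun y => ?_
        exact lintegral_lintegral_swap
          (Measurable.aemeasurable (by unfold Function.uncurry; fun_prop))
    _ = _ := by
        refine lintegral_congr fun y => lintegral_congr fun w => ?_
        rw [← lintegral_const_mul _ (by fun_prop)]
        refine lintegral_congr fun v => ?_
        rw [← lintegral_const_mul _ (by fun_prop)]
        refine lintegral_congr fun s => ?_
        ring

/-- The Schur test for free streaming: M bounds the mass of the kernel for fixed outgoing v, and N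
its mass for fixed source point (y,w). The restriction y + sv ∈ Ω is kept in N only; that is where
the size of Ω can be exploited. -/
lemma kernelBound_interior {p α : ℝ} (hp : 1 ≤ p) (hΩ : IsOpen Ω) {r : E3 × E3 × ℝ → ℝ}
    {Q : E3 × E3 × ℝ → ℝ≥0∞} (hQ : Measurable Q)
    (hrQ : ∀ v w s, 0 < s → ‖r (v, w, s)‖ₑ * gaussWeight α v ≤ Q (v, w, s) * gaussWeight α w)
    {M N : ℝ≥0∞} (hM : ∀ v, ∫⁻ w, ∫⁻ s in Ioi (0 : ℝ), Q (v, w, s) ≤ M)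
    (hN : ∀ y ∈ Ω, ∀ w, ∫⁻ v, ∫⁻ s in Ioi (0 : ℝ), Ω.indicator 1 (y + s • v) * Q (v, w, s) ≤ N) :
    KernelBound p α (phaseMeasure Ω) (phaseMeasure Ω) streamMeasure (interiorKernel Ω r) streamMap
      (M ^ (p - 1) * N) := by
  intro u hu
  have hp0 : 0 < p := by linarith
  have hg := measurable_gaussWeight α
  set i : E3 → ℝ≥0∞ := Ω.indicator 1
  have hi : Measurable i := measurable_one.indicator hΩ.measurableSet
  set f : E3 × E3 → ℝ≥0∞ := fun y => gaussWeight α y.2 * u y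
  have hf : Measurable f := by fun_prop
  have hpt : ∀ z : E3 × E3, (gaussWeight α z.2 * ∫⁻ o, ‖interiorKernel Ω r (z, o)‖ₑ *
      u (streamMap (z, o)) ∂streamMeasure) ^ p ≤
      M ^ (p - 1) * ∫⁻ o, i (z.1 - o.2 • z.2) * Q (z.2, o) * (f (z.1 - o.2 • z.2, o.1)) ^ p
        ∂streamMeasure := by
    intro z
    have hpos : ∀ᵐ o ∂streamMeasure, 0 < o.2 := by
      refine Measure.ae_prod_mem_iff_ae_ae_mem (s := {o : E3 × ℝ | 0 < o.2})
        (measurableSet_lt measurable_const measurable_snd) |>.2 ?_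
      exact Eventually.of_forall fun w => ae_restrict_mem measurableSet_Ioi
    calc _ ≤ (∫⁻ o, (i (z.1 - o.2 • z.2) * Q (z.2, o)) * f (z.1 - o.2 • z.2, o.1)
          ∂streamMeasure) ^ p := by
          refine ENNReal.rpow_le_rpow ?_ hp0.le
          rw [← lintegral_const_mul' _ _ (gaussWeight_ne_top _ _)]
          refine lintegral_mono_ae ?_
          filter_upwards [hpos] with o ho
          simp only [interiorKernel, streamMap, f]
          by_cases h : z.1 - o.2 • z.2 ∈ Ω
          · simp only [i, indicator_of_mem h, Pi.one_apply, one_mul]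
            have := hrQ z.2 o.1 o.2 ho
            calc gaussWeight α z.2 * (‖r (z.2, o)‖ₑ * u (z.1 - o.2 • z.2, o.1))
                = (‖r (z.2, o)‖ₑ * gaussWeight α z.2) * u (z.1 - o.2 • z.2, o.1) := by ring
              _ ≤ (Q (z.2, o) * gaussWeight α o.1) * u (z.1 - o.2 • z.2, o.1) :=
                  mul_le_mul_left this _
              _ = _ := by ring
          · simp [h]
      _ ≤ (∫⁻ o, i (z.1 - o.2 • z.2) * Q (z.2, o) ∂streamMeasure) ^ (p - 1) *
          ∫⁻ o, i (z.1 - o.2 • z.2) * Q (z.2, o) * (f (z.1 - o.2 • z.2, o.1)) ^ p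
            ∂streamMeasure := by
          refine lintegral_mul_rpow_le streamMeasure hp ?_ ?_ <;> fun_prop
      _ ≤ _ := by
          refine mul_le_mul_left (ENNReal.rpow_le_rpow ?_ (by linarith)) _
          refine le_trans (lintegral_mono (g := fun o => Q (z.2, o)) fun o => ?_)
            (le_trans (le_of_eq ?_) (hM z.2))
          · refine mul_le_of_le_one_left' ?_
            by_cases h : z.1 - o.2 • z.2 ∈ Ω <;> simp [i, h]
          · rw [streamMeasure, lintegral_prod _ (Measurable.aemeasurable (by fun_prop))]
  refine (lintegral_mono hpt).trans ?_
  rw [lintegral_const_mul _ (Measurable.lintegral_prod_right' (f := fun q : (E3 × E3) × (E3 × ℝ) =>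
    i (q.1.1 - q.2.2 • q.1.2) * Q (q.1.2, q.2) * f (q.1.1 - q.2.2 • q.1.2, q.2.1) ^ p)
    (by fun_prop)), mul_assoc]
  refine mul_le_mul_right ?_ _
  rw [lintegral_stream_swap hΩ hQ (f := fun y => f y ^ p) (by fun_prop), phaseMeasure_eq,
    lintegral_prod _ (Measurable.aemeasurable (by fun_prop)), ← lintegral_const_mul _ (by fun_prop)]
  refine setLIntegral_mono' hΩ.measurableSet fun y hy => ?_
  rw [← lintegral_const_mul _ (by fun_prop)]
  refine lintegral_mono fun w => ?_
  rw [mul_comm]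
  exact mul_le_mul_left (hN y hy w) _

lemma lintegral_exp_decay {c : ℝ} (hc : 0 < c) :
    ∫⁻ s in Ioi (0 : ℝ), ENNReal.ofReal (Real.exp (-(c * s))) = ENNReal.ofReal c⁻¹ := by
  rw [← ofReal_integral_eq_lintegral_ofReal]
  · congr 1
    have := integral_exp_mul_Ioi (neg_lt_zero.2 hc) 0
    simpa [neg_mul, div_neg, neg_div] using this
  · have := exp_neg_integrableOn_Ioi 0 hc
    simpa [IntegrableOn] using this
  · exact Eventually.of_forall fun s => (Real.exp_pos _).le

end

/-! ### Interior kernels: decay in time versus residence time in the domain -/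

section

variable {Ω : Set E3} {ρ γ : ℝ} {ν : E3 → ℝ} {k : E3 → E3 → ℝ}

/-- The value 2 does not depend on the collision frequency, so a factor ν(v) in a kernel costs
nothing. -/
lemma lintegral_exp_decay_mul_le {n : ℝ} (hn : 0 < n) (J : ℝ≥0∞) :
    ∫⁻ s in Ioi (0 : ℝ), ENNReal.ofReal n * ENNReal.ofReal (Real.exp (-(n / 2 * s))) * J
      = 2 * J := by
  rw [lintegral_mul_const _ (by fun_prop), lintegral_const_mul _ (by fun_prop),
    lintegral_exp_decay (by positivity), ← ENNReal.ofReal_mul hn.le]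
  congr 1
  rw [inv_div, mul_div_cancel₀ _ hn.ne', ENNReal.ofReal_ofNat]

/-- Interior kernels that carry a factor of the collision frequency: no smallness in the
diameter. -/
lemma kernelBound_of_nu {p α : ℝ} (hp : 1 ≤ p) (hΩ : IsOpen Ω)
    (hL : CollisionAssumption ρ γ ν k) {r : E3 × E3 × ℝ → ℝ} {J : E3 → ℝ≥0∞} (hJ : Measurable J)
    (hrQ : ∀ v w s, 0 < s → ‖r (v, w, s)‖ₑ * gaussWeight α v ≤
      ENNReal.ofReal (ν v) * ENNReal.ofReal (Real.exp (-(ν v / 2 * s))) * J (v - w) *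
        gaussWeight α w) :
    KernelBound p α (phaseMeasure Ω) (phaseMeasure Ω) streamMeasure (interiorKernel Ω r) streamMap
      ((2 * ∫⁻ u, J u) ^ (p - 1) * (2 * ∫⁻ u, J u)) := by
  have hν : Measurable ν := hL.differentiable_nu.continuous.measurable
  refine kernelBound_interior hp hΩ (Q := fun q => ENNReal.ofReal (ν q.1) *
    ENNReal.ofReal (Real.exp (-(ν q.1 / 2 * q.2.2))) * J (q.1 - q.2.1)) (by fun_prop) hrQ ?_ ?_
  · intro v
    simp only [lintegral_exp_decay_mul_le (hL.nu_pos v)]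
    rw [lintegral_const_mul _ (by fun_prop), lintegral_sub_left_eq_self]
  · intro y _ w
    calc _ ≤ ∫⁻ v, ∫⁻ s in Ioi (0 : ℝ), ENNReal.ofReal (ν v) *
          ENNReal.ofReal (Real.exp (-(ν v / 2 * s))) * J (v - w) := by
          refine lintegral_mono fun v => lintegral_mono fun s => mul_le_of_le_one_left' ?_
          by_cases h : y + s • v ∈ Ω <;> simp [h]
      _ ≤ _ := by
          simp only [lintegral_exp_decay_mul_le (hL.nu_pos _)]
          rw [lintegral_const_mul _ (by fun_prop), lintegral_sub_right_eq_self]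

lemma lintegral_stay_le (hb : Bornology.IsBounded Ω) {y v : E3} (hv : v ≠ 0) :
    ∫⁻ s in Ioi (0 : ℝ), Ω.indicator (1 : E3 → ℝ≥0∞) (y + s • v) ≤
      ENNReal.ofReal (Metric.diam Ω) * ‖v‖ₑ⁻¹ := by
  have hv' : 0 < ‖v‖ := norm_pos_iff.2 hv
  set S : Set ℝ := (fun s : ℝ => y + s • v) ⁻¹' Ω
  -- Ω is not assumed measurable here, hence the measurable hull of the set of residence times.
  have h1 : ∀ s : ℝ, Ω.indicator (1 : E3 → ℝ≥0∞) (y + s • v) ≤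
      (toMeasurable volume S).indicator 1 s := by
    intro s
    by_cases h : y + s • v ∈ Ω
    · rw [indicator_of_mem h, indicator_of_mem (subset_toMeasurable volume S h)]
      simp
    · simp [h]
  calc _ ≤ ∫⁻ s in Ioi (0 : ℝ), (toMeasurable volume S).indicator 1 s := lintegral_mono h1
    _ ≤ ∫⁻ s, (toMeasurable volume S).indicator 1 s := setLIntegral_le_lintegral _ _
    _ = volume S := by
        rw [lintegral_indicator_one (measurableSet_toMeasurable _ _), measure_toMeasurable]
    _ ≤ Metric.ediam S := Real.volume_le_diam S
    _ ≤ ENNReal.ofReal (Metric.diam Ω / ‖v‖) := by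
        refine Metric.ediam_le fun s hs s' hs' => ?_
        rw [edist_dist]
        refine ENNReal.ofReal_le_ofReal ?_
        have h := Metric.dist_le_diam_of_mem hb hs hs'
        rw [dist_add_left, dist_eq_norm, ← sub_smul, norm_smul, Real.norm_eq_abs,
          ← Real.dist_eq] at h
        rwa [le_div_iff₀ hv']
    _ = _ := by rw [ENNReal.ofReal_div_of_pos hv', div_eq_mul_inv, ofReal_norm]

/-- This is the grazing integral at p = 1, where the power of n·v is trivial and any unit vector
serves as n. -/
lemma lintegral_inv_mul_singGauss_le {δ : ℝ} (hδ : 0 < δ) :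
    ∃ C : ℝ≥0, ∀ w : E3, ∫⁻ v : E3, ‖v‖ₑ⁻¹ * singGauss δ 1 (v - w) ≤ C := by
  obtain ⟨C, hC⟩ := exists_lintegral_grazing_le (p := 1) le_rfl one_lt_two hδ
  refine ⟨C, fun w => ?_⟩
  have := hC (EuclideanSpace.single 0 1) (by simp) w
  simpa only [sub_self, ENNReal.rpow_zero, one_mul] using this

/-- Interior kernels without derivative: the operator norm is small for small diameter. -/
lemma exists_kernelBound_diam {p α δ : ℝ} (hp : 1 ≤ p) (hδ : 0 < δ)
    (hL : CollisionAssumption ρ γ ν k) (c : ℝ≥0) : ∃ C : ℝ≥0, ∀ Ω : Set E3, IsOpen Ω →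
      Bornology.IsBounded Ω → ∀ r : E3 × E3 × ℝ → ℝ,
      (∀ v w s, 0 < s → ‖r (v, w, s)‖ₑ * gaussWeight α v ≤
        c * ENNReal.ofReal (Real.exp (-(ν v / 2 * s))) * singGauss δ 1 (v - w) *
          gaussWeight α w) →
      KernelBound p α (phaseMeasure Ω) (phaseMeasure Ω) streamMeasure (interiorKernel Ω r)
        streamMap (C * ENNReal.ofReal (Metric.diam Ω)) := by
  have hν : Measurable ν := hL.differentiable_nu.continuous.measurable
  have hJ := measurable_singGauss δ 1
  obtain ⟨C, hC⟩ := lintegral_inv_mul_singGauss_le hδ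
  obtain ⟨ν₀, hν0, hνl⟩ := hL.exists_nu_lower
  have hJf : ∫⁻ u, singGauss δ 1 u ≠ ⊤ :=
    (lintegral_singGauss_lt_top hδ zero_le_one (by norm_num)).ne
  set M : ℝ≥0∞ := c * (ENNReal.ofReal (ν₀ / 2)⁻¹ * ∫⁻ u, singGauss δ 1 u)
  have hMf : M ≠ ⊤ := ENNReal.mul_ne_top ENNReal.coe_ne_top
    (ENNReal.mul_ne_top ENNReal.ofReal_ne_top hJf)
  -- The integral for fixed v uses the decay e^{-νs/2} with ν ≥ ν₀ and does not see Ω. The integral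
  -- for fixed source point drops the exponential in favour of the residence time diam(Ω)/|v|. So
  -- exactly one power of the diameter appears before the p-th root.
  refine ⟨(M ^ (p - 1) * (c * C)).toNNReal, fun Ω hΩ hb r hr => ?_⟩
  rw [ENNReal.coe_toNNReal (ENNReal.mul_ne_top (ENNReal.rpow_ne_top_of_nonneg (by linarith) hMf)
    (by finiteness)), mul_assoc]
  refine kernelBound_interior hp hΩ (Q := fun q => c *
    ENNReal.ofReal (Real.exp (-(ν q.1 / 2 * q.2.2))) * singGauss δ 1 (q.1 - q.2.1))
    (by fun_prop) hr ?_ ?_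
  · intro v
    have h1 : ∀ w, ∫⁻ s in Ioi (0 : ℝ), c * ENNReal.ofReal (Real.exp (-(ν v / 2 * s))) *
        singGauss δ 1 (v - w) ≤ c * (ENNReal.ofReal (ν₀ / 2)⁻¹ * singGauss δ 1 (v - w)) := by
      intro w
      rw [lintegral_mul_const _ (by fun_prop), lintegral_const_mul _ (by fun_prop), mul_assoc]
      refine mul_le_mul_right (mul_le_mul_left ?_ _) _
      rw [lintegral_exp_decay (half_pos (hL.nu_pos v))]
      exact ENNReal.ofReal_le_ofReal (inv_anti₀ (by positivity) (by linarith [(hνl v).1]))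
    refine (lintegral_mono h1).trans (le_of_eq ?_)
    rw [lintegral_const_mul _ (by fun_prop), lintegral_const_mul _ (by fun_prop),
      lintegral_sub_left_eq_self]
  · intro y _ w
    have hae : ∀ᵐ v : E3, v ≠ 0 := by
      simp [ae_iff, measure_singleton]
    calc _ ≤ ∫⁻ v, (c * ENNReal.ofReal (Metric.diam Ω)) * (‖v‖ₑ⁻¹ * singGauss δ 1 (v - w)) := by
          refine lintegral_mono_ae ?_
          filter_upwards [hae] with v hv
          calc _ ≤ ∫⁻ s in Ioi (0 : ℝ), Ω.indicator (1 : E3 → ℝ≥0∞) (y + s • v) *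
                (c * singGauss δ 1 (v - w)) := by
                refine setLIntegral_mono' measurableSet_Ioi fun s hs => mul_le_mul_right ?_ _
                refine mul_le_mul_left (mul_le_of_le_one_right' ?_) _
                rw [ENNReal.ofReal_le_one, Real.exp_le_one_iff, neg_nonpos]
                have := hL.nu_pos v
                have hs' : (0 : ℝ) < s := hs
                positivity
            _ = (∫⁻ s in Ioi (0 : ℝ), Ω.indicator (1 : E3 → ℝ≥0∞) (y + s • v)) *
                (c * singGauss δ 1 (v - w)) := by
                refine lintegral_mul_const _ ?_
                exact (measurable_one.indicator hΩ.measurableSet).comp (by fun_prop)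
            _ ≤ (ENNReal.ofReal (Metric.diam Ω) * ‖v‖ₑ⁻¹) * (c * singGauss δ 1 (v - w)) :=
                mul_le_mul_left (lintegral_stay_le hb hv) _
            _ = _ := by ring
      _ = (c * ENNReal.ofReal (Metric.diam Ω)) * ∫⁻ v, ‖v‖ₑ⁻¹ * singGauss δ 1 (v - w) :=
          lintegral_const_mul _ (by fun_prop)
      _ ≤ (c * ENNReal.ofReal (Metric.diam Ω)) * C := mul_le_mul_right (hC w) _
      _ = _ := by ring

/-! ### Boundedness of the boundary operator -/

/-- The map `(x, v, w) ↦ (q(x, v), w)`. -/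
def exitMap (Ω : Set E3) (q : (E3 × E3) × E3) : E3 × E3 := (regExitPoint Ω q.1, q.2)

lemma IsConvexC2Domain.measurable_exitMap (hΩ : IsConvexC2Domain Ω) : Measurable (exitMap Ω) :=
  (hΩ.measurable_regExitPoint.comp measurable_fst).prodMk measurable_snd

lemma boundaryMeasure_eq (Ω : Set E3) :
    boundaryMeasure Ω = (surfaceMeasure Ω).prod (volume : Measure E3) := rfl

lemma lintegral_surface_swap {σ : Measure E3} [SFinite σ] {c : ℝ≥0∞} {a : E3 → ℝ≥0∞}
    {b : E3 × E3 → ℝ≥0∞} {S : E3 → ℝ≥0∞} {g : E3 × E3 → ℝ≥0∞} (ha : Measurable a)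
    (hb : Measurable b) (hS : Measurable S) (hg : Measurable g) :
    ∫⁻ v, ∫⁻ z, c * (a v * b (z, v) * ∫⁻ w, S (v - w) * g (z, w)) ∂σ =
      c * ∫⁻ z, (∫⁻ w, g (z, w) * ∫⁻ v, b (z, v) * a v * S (v - w)) ∂σ := by
  have hm : Measurable fun q : E3 × E3 => ∫⁻ w, S (q.1 - w) * g (q.2, w) :=
    Measurable.lintegral_prod_right' (f := fun q : (E3 × E3) × E3 =>
      S (q.1.1 - q.2) * g (q.1.2, q.2)) (by fun_prop)
  have hm2 : Measurable fun q : E3 × E3 => a q.1 * b (q.2, q.1) *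
      ∫⁻ w, S (q.1 - w) * g (q.2, w) := Measurable.mul (by fun_prop) hm
  have hm4 : Measurable fun q : E3 × E3 => ∫⁻ v, b (q.1, v) * a v * S (v - q.2) :=
    Measurable.lintegral_prod_right' (f := fun q : (E3 × E3) × E3 =>
      b (q.1.1, q.2) * a q.2 * S (q.2 - q.1.2)) (by fun_prop)
  have hm5 : Measurable fun q : E3 × E3 => g (q.1, q.2) * ∫⁻ v, b (q.1, v) * a v * S (v - q.2) :=
    hg.mul hm4
  rw [lintegral_lintegral_swap (hm2.const_mul c).aemeasurable,
    ← lintegral_const_mul _ hm5.lintegral_prod_right']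
  refine lintegral_congr fun z => ?_
  have hm3 : Measurable fun v : E3 => a v * b (z, v) * ∫⁻ w, S (v - w) * g (z, w) :=
    hm2.comp (by fun_prop : Measurable fun v : E3 => (v, z))
  rw [lintegral_const_mul _ hm3]
  congr 1
  have e1 : ∀ v : E3, a v * b (z, v) * ∫⁻ w, S (v - w) * g (z, w) =
      ∫⁻ w, a v * b (z, v) * (S (v - w) * g (z, w)) := fun v =>
    (lintegral_const_mul _ (by fun_prop)).symm
  simp_rw [e1]
  rw [lintegral_lintegral_swap (Measurable.aemeasurable (by unfold Function.uncurry; fun_prop))]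
  refine lintegral_congr fun w => ?_
  rw [← lintegral_const_mul _ (by fun_prop)]
  refine lintegral_congr fun v => ?_
  ring

/-- After Hölder in w, the change of variables to the exit point replaces the integral over x by a
surface integral with density |n·v|/|v| times the diameter. Combined with |n·v|^{-p} this is
|n·v|^{1-p}/|v|, whose integral in v against the singular Gaussian is bounded uniformly in n and w.
-/
lemma exists_kernelBound_boundary {p α δ : ℝ} (hp : 1 ≤ p) (hp2 : p < 2) (hδ : 0 < δ) (c : ℝ≥0) :
    ∃ C : ℝ≥0, ∀ Ω : Set E3, IsConvexC2Domain Ω → ∀ R : (E3 × E3) × E3 → ℝ,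
      (∀ z w, ‖R (z, w)‖ₑ * gaussWeight α z.2 ≤
        c * ‖(inner ℝ (outerNormal Ω (regExitPoint Ω z)) z.2 : ℝ)‖ₑ⁻¹ *
          singGauss δ 1 (z.2 - w) * gaussWeight α w) →
      KernelBound p α (phaseMeasure Ω) (boundaryMeasure Ω) (volume : Measure E3) R (exitMap Ω)
        (C * ENNReal.ofReal (Metric.diam Ω)) := by
  have hJ := measurable_singGauss δ 1
  have hg := measurable_gaussWeight α
  have hp0 : 0 < p := by linarith
  obtain ⟨C, hC⟩ := exists_lintegral_grazing_le hp hp2 hδ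
  have hJf : ∫⁻ u, singGauss δ 1 u ≠ ⊤ :=
    (lintegral_singGauss_lt_top hδ zero_le_one (by norm_num)).ne
  set M : ℝ≥0∞ := ∫⁻ u, singGauss δ 1 u
  set D : ℝ≥0∞ := (c : ℝ≥0∞) ^ p * M ^ (p - 1)
  have hD : D ≠ ⊤ := ENNReal.mul_ne_top (ENNReal.rpow_ne_top_of_nonneg hp0.le ENNReal.coe_ne_top)
    (ENNReal.rpow_ne_top_of_nonneg (by linarith) hJf)
  refine ⟨(D * (8 * C)).toNNReal, fun Ω hΩ R hR u hu => ?_⟩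
  rw [ENNReal.coe_toNNReal (by finiteness)]
  have := hΩ.isFiniteMeasure_surfaceMeasure
  have hn := hΩ.measurable_outerNormal
  have hq := hΩ.measurable_regExitPoint
  set f : E3 × E3 → ℝ≥0∞ := fun y => gaussWeight α y.2 * u y
  have hf : Measurable f := by fun_prop
  -- the integrand on the boundary
  obtain ⟨F, hFd⟩ : ∃ F : E3 × E3 → ℝ≥0∞, F = fun q =>
      (‖(inner ℝ (outerNormal Ω q.2) q.1 : ℝ)‖ₑ⁻¹) ^ p *
        ∫⁻ w, singGauss δ 1 (q.1 - w) * f (q.2, w) ^ p := ⟨_, rfl⟩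
  have hF : Measurable F := by
    rw [hFd]
    refine Measurable.mul (by fun_prop) ?_
    exact Measurable.lintegral_prod_right' (f := fun q : (E3 × E3) × E3 =>
      singGauss δ 1 (q.1.1 - q.2) * f (q.1.2, q.2) ^ p) (by fun_prop)
  have hpt : ∀ z : E3 × E3, (gaussWeight α z.2 * ∫⁻ w, ‖R (z, w)‖ₑ * u (exitMap Ω (z, w))) ^ p ≤
      D * F (z.2, regExitPoint Ω z) := by
    intro z
    set n : ℝ≥0∞ := ‖(inner ℝ (outerNormal Ω (regExitPoint Ω z)) z.2 : ℝ)‖ₑ⁻¹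
    calc _ ≤ ((c * n) * ∫⁻ w, singGauss δ 1 (z.2 - w) * f (regExitPoint Ω z, w)) ^ p := by
          refine ENNReal.rpow_le_rpow ?_ hp0.le
          rw [← lintegral_const_mul' _ _ (gaussWeight_ne_top _ _),
            ← lintegral_const_mul _ (by fun_prop)]
          refine lintegral_mono fun w => ?_
          calc gaussWeight α z.2 * (‖R (z, w)‖ₑ * u (exitMap Ω (z, w)))
              = (‖R (z, w)‖ₑ * gaussWeight α z.2) * u (exitMap Ω (z, w)) := by ring
            _ ≤ (c * n * singGauss δ 1 (z.2 - w) * gaussWeight α w) * u (exitMap Ω (z, w)) :=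
                mul_le_mul_left (hR z w) _
            _ = _ := by simp only [exitMap, f]; ring
      _ = (c : ℝ≥0∞) ^ p * n ^ p * (∫⁻ w, singGauss δ 1 (z.2 - w) * f (regExitPoint Ω z, w)) ^ p := by
          rw [ENNReal.mul_rpow_of_nonneg _ _ hp0.le, ENNReal.mul_rpow_of_nonneg _ _ hp0.le]
      _ ≤ (c : ℝ≥0∞) ^ p * n ^ p * (M ^ (p - 1) *
            ∫⁻ w, singGauss δ 1 (z.2 - w) * f (regExitPoint Ω z, w) ^ p) := by
          refine mul_le_mul_right ?_ _
          have := lintegral_mul_rpow_le (volume : Measure E3) hp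
            (Q := fun w => singGauss δ 1 (z.2 - w)) (f := fun w => f (regExitPoint Ω z, w))
            (by fun_prop) (by fun_prop)
          rwa [lintegral_sub_left_eq_self] at this
      _ = _ := by simp only [D, hFd, n]; ring
  have hae : ∀ᵐ v : E3, v ≠ 0 := by
    simp [ae_iff, measure_singleton]
  -- An inequality is enough, and at x = 0 the left side vanishes by the convention 0 · ∞ = 0.
  have hcancel : ∀ x : ℝ≥0∞, x ≠ ⊤ → x * (x⁻¹) ^ p ≤ x ^ (1 - p) := by
    intro x hx
    rcases eq_or_ne x 0 with rfl | h0
    · simp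
    · rw [ENNReal.inv_rpow, ← ENNReal.rpow_neg, sub_eq_add_neg,
        ENNReal.rpow_add _ _ h0 hx, ENNReal.rpow_one]
  calc _ ≤ ∫⁻ z, D * F (z.2, regExitPoint Ω z) ∂phaseMeasure Ω := lintegral_mono hpt
    _ = D * ∫⁻ v, ∫⁻ x in Ω, F (v, regExitPoint Ω (x, v)) := by
        have hm : Measurable fun z : E3 × E3 => F (z.2, regExitPoint Ω z) :=
          by fun_prop
        rw [lintegral_const_mul _ hm, phaseMeasure_eq, lintegral_prod_symm _ hm.aemeasurable]
    _ ≤ D * ∫⁻ v, ∫⁻ z, 8 * ENNReal.ofReal (Metric.diam Ω) * (‖v‖ₑ⁻¹ *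
          ‖(inner ℝ (outerNormal Ω z) v : ℝ)‖ₑ ^ (1 - p) *
          ∫⁻ w, singGauss δ 1 (v - w) * f (z, w) ^ p) ∂surfaceMeasure Ω := by
        refine mul_le_mul_right (lintegral_mono_ae ?_) _
        filter_upwards [hae] with v hv
        refine (hΩ.lintegral_exitPoint_le hv (F := fun z => F (v, z)) (by fun_prop)).trans ?_
        rw [← lintegral_const_mul _ (by fun_prop)]
        refine lintegral_mono fun z => ?_
        calc _ = 8 * ENNReal.ofReal (Metric.diam Ω) * (‖v‖ₑ⁻¹ *
              (‖(inner ℝ (outerNormal Ω z) v : ℝ)‖ₑ *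
                (‖(inner ℝ (outerNormal Ω z) v : ℝ)‖ₑ⁻¹) ^ p) *
              ∫⁻ w, singGauss δ 1 (v - w) * f (z, w) ^ p) := by
                simp only [hFd]; ring
          _ ≤ _ := by
              refine mul_le_mul_right (mul_le_mul_left (mul_le_mul_right ?_ _) _) _
              exact hcancel _ enorm_ne_top
    _ = D * (8 * ENNReal.ofReal (Metric.diam Ω) * ∫⁻ z, (∫⁻ w, f (z, w) ^ p *
          ∫⁻ v, ‖(inner ℝ (outerNormal Ω z) v : ℝ)‖ₑ ^ (1 - p) * ‖v‖ₑ⁻¹ * singGauss δ 1 (v - w))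
          ∂surfaceMeasure Ω) := by
        rw [lintegral_surface_swap (c := 8 * ENNReal.ofReal (Metric.diam Ω))
          (a := fun v : E3 => ‖v‖ₑ⁻¹)
          (b := fun q : E3 × E3 => ‖(inner ℝ (outerNormal Ω q.1) q.2 : ℝ)‖ₑ ^ (1 - p))
          (S := singGauss δ 1) (g := fun q => f q ^ p) (by fun_prop) (by fun_prop) (by fun_prop)
          (by fun_prop)]
    _ ≤ D * (8 * ENNReal.ofReal (Metric.diam Ω) * ∫⁻ z, (∫⁻ w, f (z, w) ^ p * C)
          ∂surfaceMeasure Ω) := by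
        refine mul_le_mul_right (mul_le_mul_right ?_ _) _
        refine setLIntegral_mono' isClosed_frontier.measurableSet fun z hz => ?_
        refine lintegral_mono fun w => mul_le_mul_right ?_ _
        exact hC _ (hΩ.outerNormal_spec hz).1 w
    _ = _ := by
        rw [boundaryMeasure_eq, lintegral_prod _ (Measurable.aemeasurable (by fun_prop))]
        have e2 : ∀ z, ∫⁻ w, f (z, w) ^ p * C = (∫⁻ w, f (z, w) ^ p) * C := fun z =>
          lintegral_mul_const _ (by fun_prop)
        simp_rw [e2]
        rw [lintegral_mul_const _ (Measurable.lintegral_prod_right' (f := fun q => f q ^ p)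
          (by fun_prop))]
        ring

end

section

/-! ### The kernels of the derivatives of `S_Ω K h` -/

variable {Ω : Set E3} {ρ γ : ℝ} {ν : E3 → ℝ} {k : E3 → E3 → ℝ}

/-- The kernel of `S_Ω K`. -/
def baseKernel (ν : E3 → ℝ) (k : E3 → E3 → ℝ) (q : E3 × E3 × ℝ) : ℝ :=
  Real.exp (-(ν q.1 * q.2.2)) * k q.1 q.2.1

/-- The part of the derivative kernel in which the velocity derivative falls on `ν` or `k`. -/
def velKernel (ν : E3 → ℝ) (k : E3 → E3 → ℝ) (b : E3) (q : E3 × E3 × ℝ) : ℝ :=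
  Real.exp (-(ν q.1 * q.2.2)) *
    (kernelDeriv k b q.1 q.2.1 - q.2.2 * fderiv ℝ ν q.1 b * k q.1 q.2.1)

/-- The part of the derivative kernel in which the derivative falls on `h`. -/
def gradKernel (ν : E3 → ℝ) (k : E3 → E3 → ℝ) (a b : E3) (i : Fin 3) (q : E3 × E3 × ℝ) : ℝ :=
  Real.exp (-(ν q.1 * q.2.2)) * (k q.1 q.2.1 * (a i - q.2.2 * b i))

/-- The part of the derivative kernel in which the derivative falls on the exit time. -/
def exitKernel (Ω : Set E3) (ν : E3 → ℝ) (k : E3 → E3 → ℝ) (a b : E3) (q : (E3 × E3) × E3) : ℝ :=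
  (regularSet Ω).indicator (fun z =>
    inner ℝ (outerNormal Ω (regExitPoint Ω z)) (a - regExitTime Ω z • b) /
      inner ℝ (outerNormal Ω (regExitPoint Ω z)) z.2) q.1 *
  (Real.exp (-(ν q.1.2 * regExitTime Ω q.1)) * k q.1.2 q.2)

lemma measurable_baseKernel (hL : CollisionAssumption ρ γ ν k) : Measurable (baseKernel ν k) := by
  have hν : Measurable ν := hL.differentiable_nu.continuous.measurable
  have hk : Measurable fun q : E3 × E3 × ℝ => k q.1 q.2.1 :=
    hL.measurable_kernel.comp (by fun_prop : Measurable fun q : E3 × E3 × ℝ => (q.1, q.2.1))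
  exact Measurable.mul (by fun_prop) hk

lemma measurable_velKernel (hL : CollisionAssumption ρ γ ν k) (b : E3) :
    Measurable (velKernel ν k b) := by
  have hν : Measurable ν := hL.differentiable_nu.continuous.measurable
  have hk : Measurable fun q : E3 × E3 × ℝ => k q.1 q.2.1 :=
    hL.measurable_kernel.comp (by fun_prop : Measurable fun q : E3 × E3 × ℝ => (q.1, q.2.1))
  have hd : Measurable fun q : E3 × E3 × ℝ => kernelDeriv k b q.1 q.2.1 :=
    (measurable_kernelDeriv hL b).comp
      (by fun_prop : Measurable fun q : E3 × E3 × ℝ => (q.1, q.2.1))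
  have hd2 : Measurable fun v => fderiv ℝ ν v b := measurable_fderiv_apply_const ℝ ν b
  exact Measurable.mul (by fun_prop) (hd.sub (Measurable.mul (by fun_prop) hk))

lemma measurable_gradKernel (hL : CollisionAssumption ρ γ ν k) (a b : E3) (i : Fin 3) :
    Measurable (gradKernel ν k a b i) := by
  have hν : Measurable ν := hL.differentiable_nu.continuous.measurable
  have hk : Measurable fun q : E3 × E3 × ℝ => k q.1 q.2.1 :=
    hL.measurable_kernel.comp (by fun_prop : Measurable fun q : E3 × E3 × ℝ => (q.1, q.2.1))
  exact Measurable.mul (by fun_prop) (hk.mul (by fun_prop))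

lemma measurable_exitKernel (hΩ : IsConvexC2Domain Ω) (hL : CollisionAssumption ρ γ ν k)
    (a b : E3) : Measurable (exitKernel Ω ν k a b) := by
  have hν : Measurable ν := hL.differentiable_nu.continuous.measurable
  have hk : Measurable fun q : (E3 × E3) × E3 => k q.1.2 q.2 :=
    hL.measurable_kernel.comp (by fun_prop : Measurable fun q : (E3 × E3) × E3 => (q.1.2, q.2))
  have h1 := hΩ.measurable_regExitPoint
  have h2 := hΩ.measurable_regExitTime
  have h3 := hΩ.measurable_outerNormal
  have h4 := hΩ.isOpen_regularSet.measurableSet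
  refine Measurable.mul ?_ (Measurable.mul (by fun_prop) hk)
  refine Measurable.comp (Measurable.indicator ?_ h4) measurable_fst
  fun_prop

lemma exp_neg_le_exp_half {n s : ℝ} (hn : 0 ≤ n) (hs : 0 ≤ s) :
    Real.exp (-(n * s)) ≤ Real.exp (-(n / 2 * s)) := by
  rw [Real.exp_le_exp]; nlinarith [mul_nonneg hn hs]

/-- From y ≤ e^y at y = ns/2: half of the exponential decay pays for the factor s. -/
lemma mul_exp_neg_le {n s : ℝ} (hn : 0 < n) :
    s * Real.exp (-(n * s)) ≤ 2 / n * Real.exp (-(n / 2 * s)) := by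
  rw [show -(n * s) = -(n / 2 * s) + -(n / 2 * s) by ring, Real.exp_add, ← mul_assoc]
  refine mul_le_mul_of_nonneg_right ?_ (Real.exp_pos _).le
  have h1 : n / 2 * s ≤ Real.exp (n / 2 * s) := by linarith [Real.add_one_le_exp (n / 2 * s)]
  rw [Real.exp_neg, ← div_eq_mul_inv, div_le_div_iff₀ (Real.exp_pos _) hn]
  linarith

/-- Since ν ≥ ν₀, the missing factor of the collision frequency may be inserted as ν/ν₀ ≥ 1. -/
lemma exists_kernelBound_base (hL : CollisionAssumption ρ γ ν k) {p α : ℝ} (hp : 1 ≤ p)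
    (hα0 : 0 ≤ α) (hα : α < (1 - ρ) / 2) :
    ∃ C : ℝ≥0, ∀ Ω, IsConvexC2Domain Ω → KernelBound p α (phaseMeasure Ω) (phaseMeasure Ω)
      streamMeasure (interiorKernel Ω (baseKernel ν k)) streamMap C := by
  obtain ⟨ν₀, hν0, hν⟩ := hL.exists_nu_lower
  obtain ⟨C, hC⟩ := hL.exists_kernel_le hα0 hα
  set δ := (1 - ρ) / 4 - α / 2 with hδd
  have hδ : 0 < δ := by linarith
  have hm1 := measurable_singGauss δ 1
  set J : E3 → ℝ≥0∞ := fun u => ENNReal.ofReal ν₀⁻¹ * (C * singGauss δ 1 u)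
  have hJ : Measurable J := by fun_prop
  have hJf : ∫⁻ u, J u ≠ ⊤ := by
    simp only [J]
    rw [lintegral_const_mul _ (by fun_prop), lintegral_const_mul _ (by fun_prop)]
    have := (lintegral_singGauss_lt_top hδ zero_le_one (by norm_num)).ne
    finiteness
  have hJf2 : (2 * ∫⁻ u, J u) ^ (p - 1) ≠ ⊤ :=
    ENNReal.rpow_ne_top_of_nonneg (by linarith) (by finiteness)
  refine ⟨((2 * ∫⁻ u, J u) ^ (p - 1) * (2 * ∫⁻ u, J u)).toNNReal, fun Ω hΩ => ?_⟩
  rw [ENNReal.coe_toNNReal (by finiteness)]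
  refine kernelBound_of_nu hp hΩ.isOpen hL hJ fun v w s hs => ?_
  have h1 : (1 : ℝ≥0∞) ≤ ENNReal.ofReal (ν v) * ENNReal.ofReal ν₀⁻¹ := by
    rw [← ENNReal.ofReal_mul (hL.nu_pos v).le, ENNReal.one_le_ofReal, ← div_eq_mul_inv,
      one_le_div hν0]
    exact (hν v).1
  have h2 : ‖Real.exp (-(ν v * s))‖ₑ ≤ ENNReal.ofReal (Real.exp (-(ν v / 2 * s))) := by
    rw [Real.enorm_of_nonneg (Real.exp_pos _).le]
    exact ENNReal.ofReal_le_ofReal (exp_neg_le_exp_half (hL.nu_pos v).le hs.le)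
  simp only [baseKernel, enorm_mul, J]
  set E := ENNReal.ofReal (Real.exp (-(ν v / 2 * s)))
  calc ‖Real.exp (-(ν v * s))‖ₑ * ‖k v w‖ₑ * gaussWeight α v
      = 1 * ‖Real.exp (-(ν v * s))‖ₑ * (‖k v w‖ₑ * gaussWeight α v) := by ring
    _ ≤ (ENNReal.ofReal (ν v) * ENNReal.ofReal ν₀⁻¹) * E *
        (C * singGauss δ 1 (v - w) * gaussWeight α w) := mul_le_mul' (mul_le_mul' h1 h2) (hC v w)
    _ = _ := by ring

/-- The derivative of k already carries ν(v), with the integrable singularity |v-w|^{-2}. The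
derivative of e^{-νs} produces s ∇ν; ∇ν is bounded, and s is paid for by half of the decay. -/
lemma exists_kernelBound_vel (hL : CollisionAssumption ρ γ ν k) {p α : ℝ} (hp : 1 ≤ p)
    (hα0 : 0 ≤ α) (hα : α < (1 - ρ) / 2) :
    ∃ C : ℝ≥0, ∀ Ω, IsConvexC2Domain Ω → ∀ b : E3, ‖b‖ ≤ 1 →
      KernelBound p α (phaseMeasure Ω) (phaseMeasure Ω)
        streamMeasure (interiorKernel Ω (velKernel ν k b)) streamMap C := by
  obtain ⟨ν₀, hν0, hν⟩ := hL.exists_nu_lower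
  obtain ⟨C, hC⟩ := hL.exists_kernel_le hα0 hα
  obtain ⟨C', hC'⟩ := hL.exists_grad_kernel_le hα0 hα
  obtain ⟨N, hN0, hN⟩ := hL.exists_fderiv_nu_le
  set δ := (1 - ρ) / 4 - α / 2 with hδd
  have hδ : 0 < δ := by linarith
  have hm1 := measurable_singGauss δ 1
  have hm2 := measurable_singGauss δ 2
  set c₂ : ℝ≥0∞ := ENNReal.ofReal (2 / ν₀) * ENNReal.ofReal N * ENNReal.ofReal ν₀⁻¹
  set J : E3 → ℝ≥0∞ := fun u => C' * singGauss δ 2 u + c₂ * (C * singGauss δ 1 u)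
  have hJ : Measurable J := by fun_prop
  have hJf : ∫⁻ u, J u ≠ ⊤ := by
    simp only [J]
    rw [lintegral_add_left (by fun_prop), lintegral_const_mul _ (by fun_prop),
      lintegral_const_mul _ (by fun_prop), lintegral_const_mul _ (by fun_prop)]
    have h1 := (lintegral_singGauss_lt_top hδ zero_le_one (by norm_num)).ne
    have h2 := (lintegral_singGauss_lt_top hδ zero_le_two (by norm_num)).ne
    simp only [c₂]
    finiteness
  have hJf2 : (2 * ∫⁻ u, J u) ^ (p - 1) ≠ ⊤ :=
    ENNReal.rpow_ne_top_of_nonneg (by linarith) (by finiteness)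
  refine ⟨((2 * ∫⁻ u, J u) ^ (p - 1) * (2 * ∫⁻ u, J u)).toNNReal, fun Ω hΩ b hb => ?_⟩
  rw [ENNReal.coe_toNNReal (by finiteness)]
  refine kernelBound_of_nu hp hΩ.isOpen hL hJ fun v w s hs => ?_
  have hνv := hL.nu_pos v
  have h1 : (1 : ℝ≥0∞) ≤ ENNReal.ofReal (ν v) * ENNReal.ofReal ν₀⁻¹ := by
    rw [← ENNReal.ofReal_mul hνv.le, ENNReal.one_le_ofReal, ← div_eq_mul_inv,
      one_le_div hν0]
    exact (hν v).1
  have h2 : ‖Real.exp (-(ν v * s))‖ₑ ≤ ENNReal.ofReal (Real.exp (-(ν v / 2 * s))) := by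
    rw [Real.enorm_of_nonneg (Real.exp_pos _).le]
    exact ENNReal.ofReal_le_ofReal (exp_neg_le_exp_half hνv.le hs.le)
  have h3 : ‖s * Real.exp (-(ν v * s))‖ₑ ≤
      ENNReal.ofReal (2 / ν₀) * ENNReal.ofReal (Real.exp (-(ν v / 2 * s))) := by
    rw [Real.enorm_of_nonneg (by positivity), ← ENNReal.ofReal_mul (by positivity)]
    refine ENNReal.ofReal_le_ofReal ((mul_exp_neg_le hνv).trans ?_)
    gcongr
    exact (hν v).1
  have hbe : ‖b‖ₑ ≤ 1 := by
    rw [← ofReal_norm, ENNReal.ofReal_le_one]; exact hb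
  have h4 : ‖fderiv ℝ ν v b‖ₑ ≤ ENNReal.ofReal N := by
    rw [← ofReal_norm]
    refine ENNReal.ofReal_le_ofReal ((ContinuousLinearMap.le_opNorm _ _).trans ?_)
    exact (mul_le_of_le_one_right (norm_nonneg _) hb).trans (hN v)
  have h5 : ‖kernelDeriv k b v w‖ₑ ≤ ‖fderiv ℝ (fun u => k u w) v‖ₑ :=
    (enorm_kernelDeriv_le k b v w).trans (mul_le_of_le_one_right' hbe)
  have e1 : velKernel ν k b (v, w, s) = Real.exp (-(ν v * s)) * kernelDeriv k b v w -
      (s * Real.exp (-(ν v * s))) * (fderiv ℝ ν v b * k v w) := by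
    simp only [velKernel]; ring
  rw [e1]
  set E := ENNReal.ofReal (Real.exp (-(ν v / 2 * s)))
  calc _ ≤ (‖Real.exp (-(ν v * s))‖ₑ * ‖kernelDeriv k b v w‖ₑ + ‖s * Real.exp (-(ν v * s))‖ₑ *
        (‖fderiv ℝ ν v b‖ₑ * ‖k v w‖ₑ)) * gaussWeight α v := by
        refine mul_le_mul_left ((enorm_sub_le).trans ?_) _
        simp only [enorm_mul, le_refl]
    _ ≤ (E * ‖fderiv ℝ (fun u => k u w) v‖ₑ + ENNReal.ofReal (2 / ν₀) * E *
        (ENNReal.ofReal N * ‖k v w‖ₑ)) * gaussWeight α v := by gcongr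
    _ = E * (‖fderiv ℝ (fun u => k u w) v‖ₑ * gaussWeight α v) + 1 * (ENNReal.ofReal (2 / ν₀) * E *
        ENNReal.ofReal N) * (‖k v w‖ₑ * gaussWeight α v) := by ring
    _ ≤ E * (C' * ENNReal.ofReal (ν v) * singGauss δ 2 (v - w) * gaussWeight α w) +
        (ENNReal.ofReal (ν v) * ENNReal.ofReal ν₀⁻¹) * (ENNReal.ofReal (2 / ν₀) * E *
        ENNReal.ofReal N) * (C * singGauss δ 1 (v - w) * gaussWeight α w) :=
        add_le_add (mul_le_mul_right (hC' v w) _) (mul_le_mul' (mul_le_mul_left h1 _) (hC v w))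
    _ = _ := by simp only [J, c₂]; ring

/-- The velocity moves the base point x - sv at rate s, so the extra factor is at most 1 + s, again
absorbed by half of the decay. The singularity is only |v-w|^{-1}, so the residence time estimate
applies. -/
lemma exists_kernelBound_grad (hL : CollisionAssumption ρ γ ν k) {p α : ℝ} (hp : 1 ≤ p)
    (hα0 : 0 ≤ α) (hα : α < (1 - ρ) / 2) :
    ∃ C : ℝ≥0, ∀ Ω, IsConvexC2Domain Ω → ∀ a b : E3, ‖a‖ ≤ 1 → ‖b‖ ≤ 1 → ∀ i,
      KernelBound p α (phaseMeasure Ω) (phaseMeasure Ω)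
        streamMeasure (interiorKernel Ω (gradKernel ν k a b i)) streamMap
        (C * ENNReal.ofReal (Metric.diam Ω)) := by
  obtain ⟨ν₀, hν0, hν⟩ := hL.exists_nu_lower
  obtain ⟨C, hC⟩ := hL.exists_kernel_le hα0 hα
  have hδ : 0 < (1 - ρ) / 4 - α / 2 := by linarith
  obtain ⟨K, hK⟩ := exists_kernelBound_diam (α := α) hp hδ hL (C * (1 + (2 / ν₀).toNNReal))
  refine ⟨K, fun Ω hΩ a b ha hb i => hK Ω hΩ.isOpen hΩ.isBounded _ fun v w s hs => ?_⟩
  have hνv := hL.nu_pos v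
  have h2 : ‖Real.exp (-(ν v * s)) * (a i - s * b i)‖ₑ ≤
      (1 + ENNReal.ofReal (2 / ν₀)) * ENNReal.ofReal (Real.exp (-(ν v / 2 * s))) := by
    rw [← ENNReal.ofReal_one, ← ENNReal.ofReal_add zero_le_one (by positivity),
      ← ENNReal.ofReal_mul (by positivity), ← ofReal_norm]
    refine ENNReal.ofReal_le_ofReal ?_
    have h3 : ‖a i - s * b i‖ ≤ 1 + s := by
      refine (norm_sub_le _ _).trans (add_le_add ((PiLp.norm_apply_le a i).trans ha) ?_)
      rw [norm_mul, Real.norm_of_nonneg hs.le]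
      exact mul_le_of_le_one_right hs.le ((PiLp.norm_apply_le b i).trans hb)
    rw [norm_mul, Real.norm_of_nonneg (Real.exp_pos _).le]
    calc _ ≤ Real.exp (-(ν v * s)) * (1 + s) := by gcongr
      _ = Real.exp (-(ν v * s)) + s * Real.exp (-(ν v * s)) := by ring
      _ ≤ Real.exp (-(ν v / 2 * s)) + 2 / ν v * Real.exp (-(ν v / 2 * s)) :=
          add_le_add (exp_neg_le_exp_half hνv.le hs.le) (mul_exp_neg_le hνv)
      _ ≤ Real.exp (-(ν v / 2 * s)) + 2 / ν₀ * Real.exp (-(ν v / 2 * s)) := by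
          gcongr
          exact (hν v).1
      _ = _ := by ring
  have e1 : gradKernel ν k a b i (v, w, s) =
      (Real.exp (-(ν v * s)) * (a i - s * b i)) * k v w := by simp only [gradKernel]; ring
  rw [e1, enorm_mul]
  calc _ = ‖Real.exp (-(ν v * s)) * (a i - s * b i)‖ₑ * (‖k v w‖ₑ * gaussWeight α v) := by ring
    _ ≤ (1 + ENNReal.ofReal (2 / ν₀)) * ENNReal.ofReal (Real.exp (-(ν v / 2 * s))) *
        (C * singGauss ((1 - ρ) / 4 - α / 2) 1 (v - w) * gaussWeight α w) :=
        mul_le_mul' h2 (hC v w)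
    _ = _ := by
        rw [ENNReal.coe_mul, ENNReal.coe_add, ENNReal.coe_one, ENNReal.ofReal]
        ring

lemma regExitTime_of_mem {z : E3 × E3} (hz : z ∈ regularSet Ω) :
    regExitTime Ω z = exitTime Ω z.1 z.2 := by
  rw [regExitTime, indicator_of_mem hz]

/-- The numerator satisfies |n·(a - τb)| e^{-ντ} ≤ (1 + τ)e^{-ντ} ≤ 1 + 2/ν₀, so only the grazing
factor 1/|n·v| remains unbounded. -/
lemma exists_kernelBound_exit (hL : CollisionAssumption ρ γ ν k) {p α : ℝ} (hp : 1 ≤ p)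
    (hp2 : p < 2) (hα0 : 0 ≤ α) (hα : α < (1 - ρ) / 2) :
    ∃ C : ℝ≥0, ∀ Ω, IsConvexC2Domain Ω → ∀ a b : E3, ‖a‖ ≤ 1 → ‖b‖ ≤ 1 →
      KernelBound p α (phaseMeasure Ω) (boundaryMeasure Ω) (volume : Measure E3)
        (exitKernel Ω ν k a b) (exitMap Ω) (C * ENNReal.ofReal (Metric.diam Ω)) := by
  obtain ⟨ν₀, hν0, hν⟩ := hL.exists_nu_lower
  obtain ⟨C, hC⟩ := hL.exists_kernel_le hα0 hα
  have hδ : 0 < (1 - ρ) / 4 - α / 2 := by linarith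
  obtain ⟨K, hK⟩ := exists_kernelBound_boundary (α := α) hp hp2 hδ (C * (1 + (2 / ν₀).toNNReal))
  refine ⟨K, fun Ω hΩ a b ha hb => hK Ω hΩ _ fun z w => ?_⟩
  by_cases hz : z ∈ regularSet Ω
  swap
  · simp [exitKernel, hz]
  have hνv := hL.nu_pos z.2
  have hq := hΩ.exitPoint_mem_frontier hz.1 hz.2
  have hin := hΩ.inner_outerNormal_exitPoint_neg hz.1 hz.2
  have hτ := exitTime_nonneg (Ω := Ω) z.1 z.2
  have hn1 := (hΩ.outerNormal_spec hq).1
  simp only [exitKernel]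
  rw [indicator_of_mem hz, regExitPoint_of_mem hz, regExitTime_of_mem hz]
  set τ := exitTime Ω z.1 z.2
  set n := outerNormal Ω (exitPoint Ω z.1 z.2)
  have h2 : ‖inner ℝ n (a - τ • b) * Real.exp (-(ν z.2 * τ))‖ₑ ≤
      (1 + ENNReal.ofReal (2 / ν₀)) := by
    rw [← ENNReal.ofReal_one, ← ENNReal.ofReal_add zero_le_one (by positivity), ← ofReal_norm]
    refine ENNReal.ofReal_le_ofReal ?_
    have h3 : ‖(inner ℝ n (a - τ • b) : ℝ)‖ ≤ 1 + τ := by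
      refine (norm_inner_le_norm _ _).trans ?_
      rw [hn1, one_mul]
      refine (norm_sub_le _ _).trans (add_le_add ha ?_)
      rw [norm_smul, Real.norm_of_nonneg hτ]
      exact mul_le_of_le_one_right hτ hb
    rw [norm_mul, Real.norm_of_nonneg (Real.exp_pos _).le]
    have h4 : Real.exp (-(ν z.2 / 2 * τ)) ≤ 1 := by
      rw [Real.exp_le_one_iff]; have := mul_nonneg hνv.le hτ; linarith
    calc _ ≤ (1 + τ) * Real.exp (-(ν z.2 * τ)) := by gcongr
      _ = Real.exp (-(ν z.2 * τ)) + τ * Real.exp (-(ν z.2 * τ)) := by ring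
      _ ≤ Real.exp (-(ν z.2 / 2 * τ)) + 2 / ν z.2 * Real.exp (-(ν z.2 / 2 * τ)) :=
          add_le_add (exp_neg_le_exp_half hνv.le hτ) (mul_exp_neg_le hνv)
      _ ≤ 1 + 2 / ν₀ * 1 := by
          gcongr
          exact (hν _).1
      _ = _ := by ring
  have e1 : inner ℝ n (a - τ • b) / inner ℝ n z.2 * (Real.exp (-(ν z.2 * τ)) * k z.2 w) =
      (inner ℝ n (a - τ • b) * Real.exp (-(ν z.2 * τ))) * (inner ℝ n z.2)⁻¹ * k z.2 w := by
    rw [div_eq_mul_inv]; ring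
  rw [e1, enorm_mul, enorm_mul, enorm_inv hin.ne]
  calc _ = ‖inner ℝ n (a - τ • b) * Real.exp (-(ν z.2 * τ))‖ₑ * ‖inner ℝ n z.2‖ₑ⁻¹ *
        (‖k z.2 w‖ₑ * gaussWeight α z.2) := by ring
    _ ≤ (1 + ENNReal.ofReal (2 / ν₀)) * ‖inner ℝ n z.2‖ₑ⁻¹ *
        (C * singGauss ((1 - ρ) / 4 - α / 2) 1 (z.2 - w) * gaussWeight α w) :=
        mul_le_mul' (mul_le_mul_left h2 _) (hC _ _)
    _ = _ := by
        rw [ENNReal.coe_mul, ENNReal.coe_add, ENNReal.coe_one, ENNReal.ofReal]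
        ring

end

section

/-! ### Integrals of derivatives along lines -/

lemma measurePreserving_shear {V : Type*} [AddCommGroup V] [Module ℝ V] [MeasurableSpace V]
    [TopologicalSpace V] [MeasurableAdd₂ V] [MeasurableSMul₂ ℝ V]
    (μ : Measure V) [SFinite μ] [μ.IsAddRightInvariant] (m : Measure ℝ) [SFinite m] (e : V) :
    MeasurePreserving (fun q : ℝ × V => (q.1, q.2 + q.1 • e)) (m.prod μ) (m.prod μ) := by
  refine (MeasurePreserving.id m).skew_product (g := fun t z => z + t • e) ?_ ?_
  · unfold Function.uncurry; fun_prop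
  · exact Eventually.of_forall fun t => (measurePreserving_add_right μ (t • e)).map_eq

/-- Average D over translates by te with 0 ≤ t ≤ 1, which does not change its integral. By the
fundamental theorem of calculus the average at z is F(z + e) - F(z), whose integral vanishes by
translation invariance. Neither continuity in z nor compact support is needed. -/
lemma integral_eq_zero_of_hasDerivAt_line {F D : E3 × E3 → ℝ} {e : E3 × E3} (hF : Integrable F)
    (hD : Integrable D) (h : ∀ᵐ z, ∀ t : ℝ,
      HasDerivAt (fun s : ℝ => F (z + t • e + s • e)) (D (z + t • e)) 0) : ∫ z, D z = 0 := by
  have hH : ((volume : Measure E3).prod (volume : Measure E3)).IsAddHaarMeasure := inferInstance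
  have : (volume : Measure (E3 × E3)).IsAddHaarMeasure := hH
  have : (volume : Measure (E3 × E3)).IsAddRightInvariant := inferInstance
  set m : Measure ℝ := volume.restrict (Ioc 0 1) with hm
  have hI : Integrable (fun q : ℝ × (E3 × E3) => D (q.2 + q.1 • e)) (m.prod volume) := by
    have h1 : Integrable (fun q : ℝ × (E3 × E3) => D q.2) (m.prod volume) := hD.comp_snd m
    exact (measurePreserving_shear (volume : Measure (E3 × E3)) m e).integrable_comp_of_integrable h1
  have h1 : ∫ q, D (q.2 + q.1 • e) ∂(m.prod (volume : Measure (E3 × E3))) = ∫ z, D z := by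
    rw [integral_prod _ hI]
    simp only [integral_add_right_eq_self]
    simp [m]
  have h2 : ∀ᵐ z : E3 × E3, ∫ t, D (z + t • e) ∂m = F (z + e) - F z := by
    filter_upwards [h, hI.prod_left_ae] with z hz hi
    rw [hm, ← intervalIntegral.integral_of_le zero_le_one,
      intervalIntegral.integral_eq_sub_of_hasDerivAt (f := fun t : ℝ => F (z + t • e))]
    · simp
    · intro t _
      have := (hz t)
      rw [← sub_self t] at this
      have h3 := HasDerivAt.comp_sub_const t t this
      refine h3.congr_of_eventuallyEq (Eventually.of_forall fun s => ?_)
      simp only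
      congr 1
      rw [add_assoc, ← add_smul]; simp
    · rw [intervalIntegrable_iff_integrableOn_Ioc_of_le zero_le_one]
      exact hi
  rw [← h1, integral_prod_symm _ hI, integral_congr_ae h2, integral_sub (hF.comp_add_right e) hF,
    integral_add_right_eq_self, sub_self]

/-! ### Differentiation of the transport integral -/

/-- Split at the unperturbed endpoint T 0: differentiate under the integral on the fixed interval,
and treat the short remaining interval by continuity of H at the endpoint. -/
lemma hasDerivAt_integral_moving_endpoint {H H' : ℝ → ℝ → ℝ} {T : ℝ → ℝ} {σ B : ℝ}
    (hH : Continuous (Function.uncurry H)) (hH' : Measurable (H' 0)) (hT0 : 0 ≤ T 0)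
    (hT : HasDerivAt T σ 0)
    (hd : ∀ t ∈ Metric.ball (0 : ℝ) 1, ∀ s ∈ Icc 0 (T 0), HasDerivAt (fun t => H t s) (H' t s) t)
    (hB : ∀ t ∈ Metric.ball (0 : ℝ) 1, ∀ s ∈ Icc 0 (T 0), |H' t s| ≤ B) :
    HasDerivAt (fun t => ∫ s in (0 : ℝ)..T t, H t s)
      ((∫ s in (0 : ℝ)..T 0, H' 0 s) + σ * H 0 (T 0)) 0 := by
  have hcont : ∀ t, Continuous (H t) := fun t =>
    hH.comp (by fun_prop : Continuous fun s : ℝ => (t, s))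
  have hint : ∀ t a b, IntervalIntegrable (H t) volume a b := fun t a b =>
    (hcont t).intervalIntegrable a b
  have hsub : uIoc 0 (T 0) ⊆ Icc 0 (T 0) := by
    rw [uIoc_of_le hT0]; exact Ioc_subset_Icc_self
  have h1 : HasDerivAt (fun t => ∫ s in (0 : ℝ)..T 0, H t s) (∫ s in (0 : ℝ)..T 0, H' 0 s) 0 := by
    refine (intervalIntegral.hasDerivAt_integral_of_dominated_loc_of_deriv_le (bound := fun _ => B)
      (Metric.ball_mem_nhds (0 : ℝ) one_pos) (Eventually.of_forall fun t =>
        (hcont t).aestronglyMeasurable) (hint 0 _ _) hH'.aestronglyMeasurable ?_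
        intervalIntegrable_const ?_).2
    · exact Eventually.of_forall fun s hs t ht => hB t ht s (hsub hs)
    · exact Eventually.of_forall fun s hs t ht => hd t ht s (hsub hs)
  have h2 : HasDerivAt (fun t => ∫ s in (T 0)..T t, H t s) (σ * H 0 (T 0)) 0 := by
    have h3 : HasDerivAt (fun t => (T t - T 0) * H 0 (T 0)) (σ * H 0 (T 0)) 0 :=
      (hT.sub_const _).mul_const _
    -- The interval has length O(t) and the integrand tends to zero on it, so this error is o(t).
    have h4 : HasDerivAt (fun t => ∫ s in (T 0)..T t, (H t s - H 0 (T 0))) 0 0 := by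
      rw [hasDerivAt_iff_isLittleO]
      simp only [intervalIntegral.integral_same, sub_zero, smul_zero]
      have hO : (fun t => T t - T 0) =O[𝓝 0] fun t => t := by
        simpa using hT.isBigO_sub
      refine Asymptotics.IsLittleO.trans_isBigO ?_ hO
      rw [Asymptotics.isLittleO_iff]
      intro c hc
      have hca : ContinuousAt (Function.uncurry H) (0, T 0) := hH.continuousAt
      obtain ⟨d, hd0, hdd⟩ := Metric.continuousAt_iff.1 hca c hc
      have hTd : ∀ᶠ t in 𝓝 (0 : ℝ), dist (T t) (T 0) < d :=
        hT.continuousAt.eventually (Metric.ball_mem_nhds _ hd0)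
      filter_upwards [hTd, Metric.ball_mem_nhds (0 : ℝ) hd0] with t ht1 ht2
      refine intervalIntegral.norm_integral_le_of_norm_le_const fun s hs => ?_
      have hs' : dist s (T 0) < d := by
        refine lt_of_le_of_lt ?_ ht1
        rw [Real.dist_eq, Real.dist_eq]
        exact abs_sub_left_of_mem_uIcc (uIoc_subset_uIcc hs)
      have := hdd (x := (t, s)) (by rw [Prod.dist_eq]; exact max_lt ht2 hs')
      rw [Real.dist_eq] at this
      exact this.le
    refine ((h3.add h4).congr_deriv (add_zero _)).congr_of_eventuallyEq
      (Eventually.of_forall fun t => ?_)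
    simp only [Pi.add_apply]
    rw [intervalIntegral.integral_sub (hint _ _ _) intervalIntegrable_const,
      intervalIntegral.integral_const, smul_eq_mul]
    ring
  refine (h1.add h2).congr_of_eventuallyEq (Eventually.of_forall fun t => ?_)
  simp only [Pi.add_apply]
  rw [intervalIntegral.integral_add_adjacent_intervals (hint _ _ _) (hint _ _ _)]

variable {Ω : Set E3} {ρ γ : ℝ} {ν : E3 → ℝ} {k : E3 → E3 → ℝ}

/-- The transport integral `∫₀^τ e^{-ν(v) s} Φ(x - s v) ds`. -/
def transportInt (ν : E3 → ℝ) (Ω : Set E3) (Φ : E3 → ℝ) (z : E3 × E3) : ℝ :=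
  ∫ s in (0 : ℝ)..exitTime Ω z.1 z.2, Real.exp (-(ν z.2 * s)) * Φ (z.1 - s • z.2)

/-- Φ lives on all of space, so the integrand makes sense past the exit point and the moving
endpoint rule applies. Compact support of Φ and boundedness of ∇ν give the dominating constant. -/
lemma hasDerivAt_transportInt (hΩ : IsConvexC2Domain Ω) (hL : CollisionAssumption ρ γ ν k)
    {Φ : E3 → ℝ} (hΦ : ContDiff ℝ 1 Φ) (hc : HasCompactSupport Φ) {z : E3 × E3}
    (hz : z ∈ regularSet Ω) (a b : E3) :
    HasDerivAt (fun t : ℝ => transportInt ν Ω Φ (z + t • (a, b)))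
      ((∫ s in (0 : ℝ)..exitTime Ω z.1 z.2, Real.exp (-(ν z.2 * s)) *
          (fderiv ℝ Φ (z.1 - s • z.2) (a - s • b) - s * fderiv ℝ ν z.2 b * Φ (z.1 - s • z.2))) +
        exitTimeDeriv Ω a b z.1 z.2 * (Real.exp (-(ν z.2 * exitTime Ω z.1 z.2)) *
          Φ (exitPoint Ω z.1 z.2))) 0 := by
  obtain ⟨x, v⟩ := z
  have hνd := hL.differentiable_nu
  have hνc := hνd.continuous
  obtain ⟨N, hN0, hN⟩ := hL.exists_fderiv_nu_le
  obtain ⟨B₀, hB₀⟩ := hc.exists_bound_of_continuous hΦ.continuous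
  have hΦ' := hΦ.continuous_fderiv one_ne_zero
  obtain ⟨B₁, hB₁⟩ := (hc.fderiv ℝ).exists_bound_of_continuous hΦ'
  have hΦc := hΦ.continuous
  have hτ := exitTime_nonneg (Ω := Ω) x v
  have key := hasDerivAt_integral_moving_endpoint
    (H := fun t s => Real.exp (-(ν (v + t • b) * s)) * Φ (x + t • a - s • (v + t • b)))
    (H' := fun t s => Real.exp (-(ν (v + t • b) * s)) *
      (fderiv ℝ Φ (x + t • a - s • (v + t • b)) (a - s • b) -
        s * fderiv ℝ ν (v + t • b) b * Φ (x + t • a - s • (v + t • b))))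
    (T := fun t => exitTime Ω (x + t • a) (v + t • b))
    (σ := exitTimeDeriv Ω a b x v)
    (B := B₁ * (‖a‖ + exitTime Ω x v * ‖b‖) + exitTime Ω x v * (N * ‖b‖) * B₀)
    (by unfold Function.uncurry; fun_prop) ?_ (by simpa using hτ)
    (hΩ.hasDerivAt_exitTime hz.1 hz.2 a b) ?_ ?_
  · simpa [transportInt, exitPoint] using key
  · refine Continuous.measurable ?_
    fun_prop
  · intro t _ s _
    have e1 : HasDerivAt (fun t : ℝ => x + t • a) a t := by
      simpa using ((hasDerivAt_id t).smul_const a).const_add x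
    have e2 : HasDerivAt (fun t : ℝ => v + t • b) b t := by
      simpa using ((hasDerivAt_id t).smul_const b).const_add v
    have e3 : HasDerivAt (fun t : ℝ => x + t • a - s • (v + t • b)) (a - s • b) t :=
      e1.sub (e2.const_smul s)
    have e4 := ((hΦ.differentiable one_ne_zero) (x + t • a - s • (v + t • b))).hasFDerivAt.comp_hasDerivAt
      t e3
    have e5 := (hνd (v + t • b)).hasFDerivAt.comp_hasDerivAt t e2
    have e6 := ((e5.mul_const s).neg.exp).mul e4
    refine e6.congr_deriv ?_
    simp only [Function.comp_apply, Pi.neg_apply]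
    ring
  · intro t _ s hs
    simp only [zero_smul, add_zero] at hs
    rw [abs_mul, Real.abs_exp]
    have h0 : Real.exp (-(ν (v + t • b) * s)) ≤ 1 := by
      rw [Real.exp_le_one_iff]
      have := mul_nonneg (hL.nu_pos (v + t • b)).le hs.1
      linarith
    refine (mul_le_of_le_one_left (abs_nonneg _) h0).trans ((abs_sub _ _).trans ?_)
    refine add_le_add ?_ ?_
    · refine ((fderiv ℝ Φ (x + t • a - s • (v + t • b))).le_opNorm (a - s • b)).trans ?_
      have hB1 : 0 ≤ B₁ := (norm_nonneg _).trans (hB₁ x)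
      refine mul_le_mul (hB₁ _) ?_ (norm_nonneg _) hB1
      refine (norm_sub_le _ _).trans (add_le_add le_rfl ?_)
      rw [norm_smul, Real.norm_of_nonneg hs.1]
      exact mul_le_mul_of_nonneg_right hs.2 (norm_nonneg _)
    · rw [abs_mul, abs_mul, abs_of_nonneg hs.1]
      have h3 : |fderiv ℝ ν (v + t • b) b| ≤ N * ‖b‖ :=
        ((fderiv ℝ ν (v + t • b)).le_opNorm b).trans
          (mul_le_mul_of_nonneg_right (hN _) (norm_nonneg _))
      have hB0 : 0 ≤ B₀ := (norm_nonneg _).trans (hB₀ x)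
      exact mul_le_mul (mul_le_mul hs.2 h3 (abs_nonneg _) hτ) (hB₀ _) (abs_nonneg _)
        (by positivity)

end

section

/-! ### The weak derivative identity for smooth functions -/

variable {Ω : Set E3} {ρ γ : ℝ} {ν : E3 → ℝ} {k : E3 → E3 → ℝ}

/-- The time integral has to be carried out first, with w frozen, because k(·,w) can be
differentiated only off v = w. -/
lemma integrable_slice {μ : Measure (E3 × E3)} [SFinite μ] {G : (E3 × E3) × (E3 × ℝ) → ℝ}
    (hG : Integrable G (μ.prod streamMeasure)) :
    Integrable (fun q : (E3 × E3) × E3 => ∫ s in Ioi (0 : ℝ), G (q.1, (q.2, s)))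
        (μ.prod volume) ∧
      ∫ q : (E3 × E3) × E3, (∫ s in Ioi (0 : ℝ), G (q.1, (q.2, s))) ∂(μ.prod volume) =
        ∫ q, G q ∂(μ.prod streamMeasure) := by
  have hp : MeasurePreserving (MeasurableEquiv.prodAssoc (α := E3 × E3) (β := E3) (γ := ℝ))
      ((μ.prod volume).prod (volume.restrict (Ioi (0 : ℝ)))) (μ.prod streamMeasure) :=
    measurePreserving_prodAssoc _ _ _
  have h1 : Integrable (G ∘ MeasurableEquiv.prodAssoc)
      ((μ.prod volume).prod (volume.restrict (Ioi (0 : ℝ)))) :=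
    (hp.integrable_comp_emb (MeasurableEquiv.measurableEmbedding _)).2 hG
  refine ⟨h1.integral_prod_left, ?_⟩
  rw [← hp.integral_comp' (g := G)]
  exact (integral_prod _ h1).symm

/-- By convexity, being in Ω at time s is the same as s preceding the exit time. -/
lemma integral_interiorKernel (hΩ : IsConvexC2Domain Ω) {z : E3 × E3} (hz : z ∈ regularSet Ω)
    (r : E3 × E3 × ℝ → ℝ) (u : E3 × E3 → ℝ) (w : E3) :
    ∫ s in Ioi (0 : ℝ), interiorKernel Ω r (z, (w, s)) * u (streamMap (z, (w, s))) =
      ∫ s in (0 : ℝ)..exitTime Ω z.1 z.2, r (z.2, w, s) * u (z.1 - s • z.2, w) := by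
  rw [intervalIntegral.integral_of_le (exitTime_nonneg _ _), integral_Ioc_eq_integral_Ioo,
    ← Ioi_inter_Iio, ← setIntegral_indicator measurableSet_Iio]
  refine setIntegral_congr_fun measurableSet_Ioi fun s hs => ?_
  have hiff := hΩ.mem_iff_lt_exitTime hz.1 hz.2 (le_of_lt hs)
  simp only [interiorKernel, streamMap]
  by_cases h : s < exitTime Ω z.1 z.2
  · rw [indicator_of_mem (hiff.2 h), indicator_of_mem (show s ∈ Iio _ from h)]
  · rw [indicator_of_notMem (fun hc => h (hiff.1 hc)), indicator_of_notMem (show s ∉ Iio _ from h),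
      zero_mul]

/-- The `i`-th partial derivative in the position variable. -/
def partialX (φ : E3 × E3 → ℝ) (i : Fin 3) (z : E3 × E3) : ℝ :=
  fderiv ℝ φ z (EuclideanSpace.single i 1, 0)

lemma sum_coord_mul_partialX (φ : E3 × E3 → ℝ) (z : E3 × E3) (u : E3) :
    ∑ i, u i * partialX φ i z = fderiv ℝ φ z (u, 0) := by
  have hu : u = ∑ i, u i • EuclideanSpace.single i (1 : ℝ) := by
    ext j
    simp [Finset.sum_apply, Pi.single_apply]
  have h2 : ((u, 0) : E3 × E3) = ∑ i, u i • ((EuclideanSpace.single i (1 : ℝ), 0) : E3 × E3) := by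
    refine Prod.ext ?_ ?_
    · rw [Prod.fst_sum]; exact hu
    · rw [Prod.snd_sum]; simp
  rw [h2, map_sum]
  simp only [map_smul, smul_eq_mul, partialX]

lemma fderiv_slice {φ : E3 × E3 → ℝ} (hφ : ContDiff ℝ ∞ φ) (y w u : E3) :
    fderiv ℝ (fun y => φ (y, w)) y u = fderiv ℝ φ (y, w) (u, 0) := by
  have h1 : HasFDerivAt φ (fderiv ℝ φ (y, w)) (y, w) :=
    ((hφ.differentiable (by simp)) (y, w)).hasFDerivAt
  have h2 := HasFDerivAt.comp (g := φ) (f := fun y : E3 => (y, w)) y h1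
    (hasFDerivAt_prodMk_left (𝕜 := ℝ) y w)
  have h3 := h2.fderiv
  simp only [Function.comp_def] at h3
  rw [h3]
  simp

/-- The pointwise derivative of `ψ(x, v) k(v, w) ∫₀^τ e^{-ν(v) s} φ(x - s v, w) ds` in the direction
`(a, b)`, written with the integral kernels. -/
def sliceDeriv (Ω : Set E3) (ν : E3 → ℝ) (k : E3 → E3 → ℝ) (a b : E3) (ψ φ : E3 × E3 → ℝ)
    (q : (E3 × E3) × E3) : ℝ :=
  (∫ s in Ioi (0 : ℝ), fderiv ℝ ψ q.1 (a, b) *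
      (interiorKernel Ω (baseKernel ν k) (q.1, (q.2, s)) * φ (streamMap (q.1, (q.2, s))))) +
    (∫ s in Ioi (0 : ℝ), ψ q.1 *
      (interiorKernel Ω (velKernel ν k b) (q.1, (q.2, s)) * φ (streamMap (q.1, (q.2, s))))) +
    (∑ i, ∫ s in Ioi (0 : ℝ), ψ q.1 * (interiorKernel Ω (gradKernel ν k a b i) (q.1, (q.2, s)) *
      partialX φ i (streamMap (q.1, (q.2, s))))) +
    ψ q.1 * (exitKernel Ω ν k a b q * φ (exitMap Ω q))

/-- The product rule for ψ, k(·,w) and the transport integral. The exclusions v ≠ 0 and v ≠ w are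
what differentiability of the exit time and of the kernel requires. -/
lemma hasDerivAt_slice (hΩ : IsConvexC2Domain Ω) (hL : CollisionAssumption ρ γ ν k)
    {φ ψ : E3 × E3 → ℝ} (hφ : ContDiff ℝ ∞ φ) (hφc : HasCompactSupport φ) (hψ : ContDiff ℝ ∞ ψ)
    (hψs : tsupport ψ ⊆ Ω ×ˢ univ) (a b : E3) {z : E3 × E3} {w : E3} (hz0 : z.2 ≠ 0)
    (hzw : z.2 ≠ w) :
    HasDerivAt (fun t : ℝ => ∫ s in Ioi (0 : ℝ), ψ (z + t • (a, b)) *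
      (interiorKernel Ω (baseKernel ν k) (z + t • (a, b), (w, s)) *
        φ (streamMap (z + t • (a, b), (w, s))))) (sliceDeriv Ω ν k a b ψ φ (z, w)) 0 := by
  have htend : Tendsto (fun t : ℝ => z + t • (a, b)) (𝓝 0) (𝓝 z) := by
    have : Tendsto (fun t : ℝ => z + t • (a, b)) (𝓝 0) (𝓝 (z + (0 : ℝ) • (a, b))) :=
      Continuous.tendsto (by fun_prop) _
    simpa using this
  -- Off the closed support of ψ the function is zero near z, so the exit time is never
  -- differentiated at a point outside Ω.
  by_cases hzs : z ∈ tsupport ψ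
  swap
  · have h0 : ψ =ᶠ[𝓝 z] 0 := notMem_tsupport_iff_eventuallyEq.1 hzs
    have h1 : sliceDeriv Ω ν k a b ψ φ (z, w) = 0 := by
      simp [sliceDeriv, h0.eq_of_nhds, fderiv_of_notMem_tsupport ℝ hzs]
    rw [h1]
    refine (hasDerivAt_const (0 : ℝ) (0 : ℝ)).congr_of_eventuallyEq ?_
    filter_upwards [htend.eventually h0] with t ht
    rw [ht]
    simp
  have hz : z ∈ regularSet Ω := ⟨(hψs hzs).1, hz0⟩
  set Φ : E3 → ℝ := fun y => φ (y, w) with hΦ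
  have hΦd : ContDiff ℝ 1 Φ :=
    (hφ.comp (by fun_prop : ContDiff ℝ ∞ fun y : E3 => (y, w))).of_le (by simp)
  have hΦc : HasCompactSupport Φ :=
    hφc.comp_isClosedEmbedding
      (Topology.IsClosedEmbedding.of_continuous_injective_isClosedMap (by fun_prop)
        (fun y y' h => (Prod.mk.inj h).1) (isClosedMap_prodMk_right w))
  have hA := hasDerivAt_transportInt hΩ hL hΦd hΦc hz a b
  have hk : HasDerivAt (fun t : ℝ => k (z.2 + t • b) w) (kernelDeriv k b z.2 w) 0 := by
    rw [kernelDeriv, if_neg hzw]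
    exact (hL.differentiableAt_kernel z.2 w hzw).hasFDerivAt.hasLineDerivAt b
  have hψd : HasDerivAt (fun t : ℝ => ψ (z + t • (a, b))) (fderiv ℝ ψ z (a, b)) 0 :=
    ((hψ.differentiable (by simp)) z).hasFDerivAt.hasLineDerivAt (a, b)
  have hprod := hψd.mul (hk.mul hA)
  have hbase : ∀ z' ∈ regularSet Ω, ∀ c : ℝ, ∫ s in Ioi (0 : ℝ), c *
      (interiorKernel Ω (baseKernel ν k) (z', (w, s)) * φ (streamMap (z', (w, s)))) =
      c * (k z'.2 w * transportInt ν Ω Φ z') := by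
    intro z' hz' c
    rw [integral_const_mul, integral_interiorKernel hΩ hz', transportInt,
      ← intervalIntegral.integral_const_mul (k z'.2 w)]
    congr 1
    refine intervalIntegral.integral_congr fun s _ => ?_
    simp only [baseKernel, Φ]
    ring
  refine (hprod.congr_of_eventuallyEq ?_).congr_deriv ?_
  · filter_upwards [htend.eventually (hΩ.isOpen_regularSet.mem_nhds hz)] with t ht
    rw [hbase _ ht]
    rfl
  · have hνc := hL.differentiable_nu.continuous
    have hφcont := hφ.continuous
    have hφ' : Continuous (fderiv ℝ φ) := hφ.continuous_fderiv (by simp)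
    have hpc : ∀ i, Continuous (partialX φ i) := fun i => by unfold partialX; fun_prop
    have hgc : ∀ i, Continuous fun s : ℝ => gradKernel ν k a b i (z.2, w, s) *
        partialX φ i (z.1 - s • z.2, w) := fun i => by
      have := hpc i
      simp only [gradKernel]
      fun_prop
    have hvc : Continuous fun s : ℝ => velKernel ν k b (z.2, w, s) * φ (z.1 - s • z.2, w) := by
      simp only [velKernel]
      fun_prop
    -- All contributions except those of ψ and of the exit time, regrouped by whether the derivative
    -- falls on e^{-νs}k or, coordinate by coordinate, on φ.
    have hvel : (∫ s in (0 : ℝ)..exitTime Ω z.1 z.2, velKernel ν k b (z.2, w, s) *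
          φ (z.1 - s • z.2, w)) +
        (∑ i, ∫ s in (0 : ℝ)..exitTime Ω z.1 z.2, gradKernel ν k a b i (z.2, w, s) *
          partialX φ i (z.1 - s • z.2, w)) =
        kernelDeriv k b z.2 w * transportInt ν Ω Φ z + k z.2 w *
        ∫ s in (0 : ℝ)..exitTime Ω z.1 z.2, Real.exp (-(ν z.2 * s)) *
          (fderiv ℝ Φ (z.1 - s • z.2) (a - s • b) -
            s * fderiv ℝ ν z.2 b * Φ (z.1 - s • z.2)) := by
      have hΦ'c : Continuous fun s : ℝ => fderiv ℝ Φ (z.1 - s • z.2) (a - s • b) := by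
        have := hΦd.continuous_fderiv one_ne_zero
        fun_prop
      have hΦcont := hΦd.continuous
      rw [transportInt, ← intervalIntegral.integral_finsetSum fun i _ =>
          (hgc i).intervalIntegrable _ _,
        ← intervalIntegral.integral_const_mul, ← intervalIntegral.integral_const_mul,
        ← intervalIntegral.integral_add, ← intervalIntegral.integral_add]
      · refine intervalIntegral.integral_congr fun s _ => ?_
        simp only [hΦ, fderiv_slice hφ, ← sum_coord_mul_partialX, velKernel, gradKernel]
        simp only [PiLp.sub_apply, PiLp.smul_apply, smul_eq_mul, Fin.sum_univ_three]
        ring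
      · exact Continuous.intervalIntegrable (by fun_prop) _ _
      · exact Continuous.intervalIntegrable (by fun_prop) _ _
      · exact hvc.intervalIntegrable _ _
      · exact (continuous_finsetSum _ fun i _ => hgc i).intervalIntegrable _ _
    have hsum : sliceDeriv Ω ν k a b ψ φ (z, w) =
        fderiv ℝ ψ z (a, b) * (k z.2 w * transportInt ν Ω Φ z) +
        ψ z * ((∫ s in (0 : ℝ)..exitTime Ω z.1 z.2, velKernel ν k b (z.2, w, s) *
          φ (z.1 - s • z.2, w)) +
        (∑ i, ∫ s in (0 : ℝ)..exitTime Ω z.1 z.2, gradKernel ν k a b i (z.2, w, s) *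
          partialX φ i (z.1 - s • z.2, w))) +
        ψ z * (exitTimeDeriv Ω a b z.1 z.2 * (Real.exp (-(ν z.2 * exitTime Ω z.1 z.2)) * k z.2 w) *
          Φ (exitPoint Ω z.1 z.2)) := by
      simp only [sliceDeriv]
      rw [hbase z hz]
      simp only [integral_const_mul]
      rw [integral_interiorKernel hΩ hz]
      simp only [integral_interiorKernel hΩ hz]
      rw [← Finset.mul_sum, exitKernel, indicator_of_mem hz, exitMap, regExitPoint_of_mem hz,
        regExitTime_of_mem hz, exitTimeDeriv]
      ring
    rw [hsum, hvel]
    simp only [Pi.mul_apply, zero_smul, add_zero]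
    ring

end

/-! ### Integration by parts for smooth functions -/

section

variable {Ω : Set E3} {ρ γ : ℝ} {ν : E3 → ℝ} {k : E3 → E3 → ℝ}

/-- The line through v in direction b meets w only if v - w lies in the span of b, a subspace of
dimension at most one and hence null. -/
lemma ae_line_ne (b w : E3) : ∀ᵐ z : E3 × E3, ∀ t : ℝ, z.2 + t • b ≠ w := by
  have h1 : ∀ᵐ v : E3, v ∉ Submodule.span ℝ {b} := by
    refine measure_eq_zero_iff_ae_notMem.1 (Measure.addHaar_submodule volume _ fun htop => ?_)
    have h2 := finrank_span_le_card (R := ℝ) ({b} : Set E3)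
    rw [htop, finrank_top, finrank_euclideanSpace, Fintype.card_fin] at h2
    simp at h2
  have h3 : ∀ᵐ v : E3, ∀ t : ℝ, v + t • b ≠ w := by
    have h4 := (measurePreserving_sub_right (volume : Measure E3) w).quasiMeasurePreserving.ae h1
    filter_upwards [h4] with v hv t ht
    refine hv ?_
    rw [← ht, sub_add_cancel_left, ← neg_smul]
    exact Submodule.smul_mem _ _ (Submodule.mem_span_singleton_self b)
  exact Measure.quasiMeasurePreserving_snd.ae h3

/-- The support of ψ lies inside the phase domain, so both the function and its derivative extend by
zero and whole lines may be used, even where they leave Ω. -/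
lemma integral_sliceDeriv_eq_zero (hΩ : IsConvexC2Domain Ω) (hL : CollisionAssumption ρ γ ν k)
    {φ ψ : E3 × E3 → ℝ} (hφ : ContDiff ℝ ∞ φ) (hφc : HasCompactSupport φ) (hψ : ContDiff ℝ ∞ ψ)
    (hψs : tsupport ψ ⊆ Ω ×ˢ univ) (a b w : E3)
    (hF : Integrable (fun z => ∫ s in Ioi (0 : ℝ), ψ z *
      (interiorKernel Ω (baseKernel ν k) (z, (w, s)) * φ (streamMap (z, (w, s)))))
      (phaseMeasure Ω))
    (hD : Integrable (fun z => sliceDeriv Ω ν k a b ψ φ (z, w)) (phaseMeasure Ω)) :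
    ∫ z, sliceDeriv Ω ν k a b ψ φ (z, w) ∂phaseMeasure Ω = 0 := by
  have h0 : ∀ z ∉ Ω ×ˢ (univ : Set E3), ψ z = 0 := fun z hz =>
    image_eq_zero_of_notMem_tsupport fun h => hz (hψs h)
  have h1 : ∀ z ∉ Ω ×ˢ (univ : Set E3), fderiv ℝ ψ z = 0 := fun z hz =>
    fderiv_of_notMem_tsupport ℝ fun h => hz (hψs h)
  have hD0 : ∀ z ∉ Ω ×ˢ (univ : Set E3), sliceDeriv Ω ν k a b ψ φ (z, w) = 0 := fun z hz => by
    simp [sliceDeriv, h0 z hz, h1 z hz]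
  rw [phaseMeasure, setIntegral_eq_integral_of_forall_compl_eq_zero hD0]
  refine integral_eq_zero_of_hasDerivAt_line (F := fun z => ∫ s in Ioi (0 : ℝ), ψ z *
      (interiorKernel Ω (baseKernel ν k) (z, (w, s)) * φ (streamMap (z, (w, s))))) (e := (a, b))
      ?_ ?_ ?_
  · refine (integrableOn_iff_integrable_of_support_subset fun z hz => ?_).1 hF
    by_contra hcon
    exact hz (by simp [h0 z hcon])
  · refine (integrableOn_iff_integrable_of_support_subset fun z hz => ?_).1 hD
    by_contra hcon
    exact hz (hD0 z hcon)
  · filter_upwards [ae_line_ne b 0, ae_line_ne b w] with z hz1 hz2 t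
    exact hasDerivAt_slice hΩ hL hφ hφc hψ hψs a b (hz1 t) (hz2 t)

/-- The weak derivative of `S_Ω K φ` in the direction `(a, b)`, for a smooth function `φ`. -/
lemma testPairing_smooth (hΩ : IsConvexC2Domain Ω) (hL : CollisionAssumption ρ γ ν k)
    {φ ψ : E3 × E3 → ℝ} (hφ : ContDiff ℝ ∞ φ) (hφc : HasCompactSupport φ) (hψ : ContDiff ℝ ∞ ψ)
    (hψs : tsupport ψ ⊆ Ω ×ˢ univ) (a b : E3)
    (h0 : Integrable (fun q => ψ q.1 * (interiorKernel Ω (baseKernel ν k) q * φ (streamMap q)))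
      ((phaseMeasure Ω).prod streamMeasure))
    (h1 : Integrable (fun q => fderiv ℝ ψ q.1 (a, b) *
      (interiorKernel Ω (baseKernel ν k) q * φ (streamMap q)))
      ((phaseMeasure Ω).prod streamMeasure))
    (h2 : Integrable (fun q => ψ q.1 * (interiorKernel Ω (velKernel ν k b) q * φ (streamMap q)))
      ((phaseMeasure Ω).prod streamMeasure))
    (h3 : ∀ i, Integrable (fun q => ψ q.1 *
      (interiorKernel Ω (gradKernel ν k a b i) q * partialX φ i (streamMap q)))
      ((phaseMeasure Ω).prod streamMeasure))
    (h4 : Integrable (fun q => ψ q.1 * (exitKernel Ω ν k a b q * φ (exitMap Ω q)))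
      ((phaseMeasure Ω).prod volume)) :
    testPairing (phaseMeasure Ω) streamMeasure (interiorKernel Ω (baseKernel ν k)) streamMap
        (fun z => fderiv ℝ ψ z (a, b)) φ +
      testPairing (phaseMeasure Ω) streamMeasure (interiorKernel Ω (velKernel ν k b)) streamMap ψ φ +
      (∑ i, testPairing (phaseMeasure Ω) streamMeasure (interiorKernel Ω (gradKernel ν k a b i))
        streamMap ψ (partialX φ i)) +
      testPairing (phaseMeasure Ω) volume (exitKernel Ω ν k a b) (exitMap Ω) ψ φ = 0 := by
  obtain ⟨g0, -⟩ := integrable_slice h0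
  obtain ⟨g1, e1⟩ := integrable_slice h1
  obtain ⟨g2, e2⟩ := integrable_slice h2
  have g3 := fun i => (integrable_slice (h3 i)).1
  have e3 := fun i => (integrable_slice (h3 i)).2
  have gs := integrable_finsetSum Finset.univ fun i _ => g3 i
  have hDi : Integrable (sliceDeriv Ω ν k a b ψ φ) ((phaseMeasure Ω).prod volume) :=
    ((g1.add g2).add gs).add h4
  have i1 := integral_add' ((g1.add g2).add gs) h4
  rw [integral_add' (g1.add g2) gs, integral_add' g1 g2, integral_finsetSum _ fun i _ => g3 i,
    e1, e2, Finset.sum_congr rfl fun i _ => e3 i] at i1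
  refine i1.symm.trans ?_
  change ∫ q, sliceDeriv Ω ν k a b ψ φ q ∂_ = 0
  -- With w outermost, the integral over phase space vanishes for almost every w separately.
  rw [integral_prod_symm _ hDi]
  refine integral_eq_zero_of_ae ?_
  filter_upwards [g0.prod_left_ae, hDi.prod_left_ae] with w hw0 hwD
  exact integral_sliceDeriv_eq_zero hΩ hL hφ hφc hψ hψs a b w hw0 hwD

end

section

/-! ### Weak gradients and traces -/

variable {Ω : Set E3}

lemma isOpen_phaseSpace (hΩ : IsOpen Ω) : IsOpen (Ω ×ˢ (univ : Set E3)) := hΩ.prod isOpen_univ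

lemma inner_single_right (u : E3) (i : Fin 3) :
    inner ℝ u (EuclideanSpace.single i (1 : ℝ)) = u i := by
  simp [EuclideanSpace.inner_single_right]

lemma setIntegral_mul_fderiv_eq_neg {φ ψ : E3 × E3 → ℝ} (hφ : ContDiff ℝ ∞ φ)
    (hψ : ContDiff ℝ ∞ ψ) (hψc : HasCompactSupport ψ) (hψs : tsupport ψ ⊆ Ω ×ˢ univ)
    (e : E3 × E3) :
    ∫ z in Ω ×ˢ univ, φ z * fderiv ℝ ψ z e = -∫ z in Ω ×ˢ univ, fderiv ℝ φ z e * ψ z := by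
  have hH : ((volume : Measure E3).prod (volume : Measure E3)).IsAddHaarMeasure := inferInstance
  have : (volume : Measure (E3 × E3)).IsAddHaarMeasure := hH
  have h0 : ∀ z ∉ Ω ×ˢ (univ : Set E3), ψ z = 0 := fun z hz =>
    image_eq_zero_of_notMem_tsupport fun h => hz (hψs h)
  have h1 : ∀ z ∉ Ω ×ˢ (univ : Set E3), fderiv ℝ ψ z = 0 := fun z hz =>
    fderiv_of_notMem_tsupport ℝ fun h => hz (hψs h)
  rw [setIntegral_eq_integral_of_forall_compl_eq_zero fun z hz => by simp [h1 z hz],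
    setIntegral_eq_integral_of_forall_compl_eq_zero fun z hz => by simp [h0 z hz]]
  have hψ' : Continuous fun z => fderiv ℝ ψ z e :=
    (hψ.continuous_fderiv (by simp)).clm_apply continuous_const
  have hφ' : Continuous fun z => fderiv ℝ φ z e :=
    (hφ.continuous_fderiv (by simp)).clm_apply continuous_const
  have hψ'c : HasCompactSupport fun z => fderiv ℝ ψ z e := hψc.fderiv_apply ℝ e
  refine integral_mul_fderiv_eq_neg_fderiv_mul_of_integrable ?_ ?_ ?_
    (fun z _ => hφ.differentiable (by simp) z) (fun z _ => hψ.differentiable (by simp) z)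
  · exact (hφ'.mul hψ.continuous).integrable_of_hasCompactSupport hψc.mul_left
  · exact (hφ.continuous.mul hψ').integrable_of_hasCompactSupport hψ'c.mul_left
  · exact (hφ.continuous.mul hψ.continuous).integrable_of_hasCompactSupport hψc.mul_left

lemma integrableOn_mul_of_eq_zero {U K : Set (E3 × E3)} {G χ : E3 × E3 → ℝ}
    (hG : LocallyIntegrableOn G U) (hχ : Continuous χ) (hK : IsCompact K) (hKU : K ⊆ U)
    (hχK : ∀ z ∉ K, χ z = 0) : IntegrableOn (fun z => G z * χ z) U := by
  have h1 : IntegrableOn (fun z => χ z • G z) K :=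
    (hG.integrableOn_compact_subset hKU hK).continuousOn_smul hχ.continuousOn hK
  have h2 : IntegrableOn (fun z => G z * χ z) K := by
    simpa only [smul_eq_mul, mul_comm] using h1
  refine ((integrableOn_iff_integrable_of_support_subset fun z hz => ?_).1 h2).integrableOn
  by_contra hc
  exact hz (by simp [hχK z hc])

lemma locallyIntegrableOn_coord {U : Set (E3 × E3)} {G : E3 × E3 → E3}
    (hG : LocallyIntegrableOn G U) (i : Fin 3) : LocallyIntegrableOn (fun z => G z i) U := by
  intro z hz
  obtain ⟨s, hs, hi⟩ := hG z hz
  exact ⟨s, hs, (EuclideanSpace.proj (𝕜 := ℝ) i).integrable_comp hi⟩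

/-- Both sides are weak derivatives of f - φ, so the fundamental lemma of the calculus of variations
identifies them. This turns convergence in the infimum norm `sobolevNorm` into convergence of the
partial derivatives to those of one fixed weak gradient. -/
lemma HasWeakGradient.sub_smooth_coord_ae_eq {f φ : E3 × E3 → ℝ}
    {Gx Gv Gx' Gv' : E3 × E3 → E3} (hG : HasWeakGradient Ω f Gx Gv) (hΩ : IsOpen Ω) (hφ : ContDiff ℝ ∞ φ)
    (hG' : HasWeakGradient Ω (f - φ) Gx' Gv') (i : Fin 3) :
    (fun z => Gx z i - partialX φ i z) =ᵐ[phaseMeasure Ω] fun z => Gx' z i := by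
  have hU := isOpen_phaseSpace hΩ
  have hpc : Continuous (partialX φ i) :=
    (hφ.continuous_fderiv (by simp)).clm_apply continuous_const
  have hl1 := locallyIntegrableOn_coord hG.locallyIntegrable_x i
  have hl2 := locallyIntegrableOn_coord hG'.locallyIntegrable_x i
  have hl3 : LocallyIntegrableOn (partialX φ i) (Ω ×ˢ univ) :=
    hpc.locallyIntegrable.locallyIntegrableOn _
  have hmain := hU.ae_eq_zero_of_integral_contDiff_smul_eq_zero ((hl1.sub hl3).sub hl2) ?_
  · rw [phaseMeasure, EventuallyEq, ae_restrict_iff' hU.measurableSet]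
    filter_upwards [hmain] with z hz hzΩ
    simpa [sub_eq_zero] using hz hzΩ
  intro ψ hψ hψc hψs
  have h0 : ∀ z ∉ tsupport ψ, ψ z = 0 := fun z hz => image_eq_zero_of_notMem_tsupport hz
  have e1 := hG.deriv_x ψ hψ hψc hψs (EuclideanSpace.single i 1)
  have e2 := hG'.deriv_x ψ hψ hψc hψs (EuclideanSpace.single i 1)
  have e3 := setIntegral_mul_fderiv_eq_neg hφ hψ hψc hψs (EuclideanSpace.single i (1 : ℝ), 0)
  have hψ' : Continuous fun z => fderiv ℝ ψ z (EuclideanSpace.single i (1 : ℝ), 0) :=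
    (hψ.continuous_fderiv (by simp)).clm_apply continuous_const
  have h0' : ∀ z ∉ tsupport ψ, fderiv ℝ ψ z (EuclideanSpace.single i (1 : ℝ), 0) = 0 :=
    fun z hz => by rw [fderiv_of_notMem_tsupport ℝ hz]; rfl
  simp only [inner_single_right, Pi.sub_apply, sub_mul] at e1 e2
  rw [integral_sub (integrableOn_mul_of_eq_zero hG.locallyIntegrable hψ' hψc hψs h0')
    (integrableOn_mul_of_eq_zero (hφ.continuous.locallyIntegrable.locallyIntegrableOn _)
      hψ' hψc hψs h0'), e1, e3] at e2
  rw [← setIntegral_eq_integral_of_forall_compl_eq_zero (s := Ω ×ˢ univ)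
    fun z hz => by rw [h0 z fun h => hz (hψs h), zero_smul]]
  have i1 := integrableOn_mul_of_eq_zero hl1 hψ.continuous hψc hψs h0
  have i2 := integrableOn_mul_of_eq_zero hl2 hψ.continuous hψc hψs h0
  have i3 := integrableOn_mul_of_eq_zero hl3 hψ.continuous hψc hψs h0
  have e4 : ∀ z, ψ z • ((fun z => Gx z i) - partialX φ i - fun z => Gx' z i) z =
      Gx z i * ψ z - partialX φ i z * ψ z - Gx' z i * ψ z := fun z => by
    simp only [Pi.sub_apply, smul_eq_mul]; ring
  simp only [e4]
  refine (integral_sub (i1.sub i3) i2).trans ?_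
  rw [integral_sub' i1 i3]
  simp only [partialX]
  linarith

/-! ### Limits of the identity for smooth functions -/

lemma gaussWeight_zero_exponent (v : E3) : gaussWeight 0 v = 1 := by simp [gaussWeight]

lemma exists_enorm_le_of_hasCompactSupport {χ : E3 × E3 → ℝ} (hχ : Continuous χ)
    (hχc : HasCompactSupport χ) : ∃ B : ℝ≥0, ∀ z, ‖χ z‖ₑ ≤ B := by
  obtain ⟨C, hC⟩ := hχc.exists_bound_of_continuous hχ
  refine ⟨C.toNNReal, fun z => ?_⟩
  rw [← ofReal_norm]
  exact ENNReal.ofReal_le_ofReal (hC z)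

lemma weightedLpNorm_lt_top_of_hasCompactSupport {p : ℝ} (hp : 0 < p) {μ : Measure (E3 × E3)}
    [IsFiniteMeasureOnCompacts μ] {χ : E3 × E3 → ℝ} (hχ : Continuous χ)
    (hχc : HasCompactSupport χ) : weightedLpNorm p 0 μ χ < ⊤ := by
  obtain ⟨B, hB⟩ := exists_enorm_le_of_hasCompactSupport hχ hχc
  rw [weightedLpNorm_eq hp.le]
  refine ENNReal.rpow_lt_top_of_nonneg (by positivity) (ne_of_lt ?_)
  simp only [gaussWeight_zero_exponent, one_mul]
  calc ∫⁻ z, ‖χ z‖ₑ ^ p ∂μ ≤ ∫⁻ z, (tsupport χ).indicator (fun _ => (B : ℝ≥0∞) ^ p) z ∂μ := by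
        refine lintegral_mono fun z => ?_
        by_cases hz : z ∈ tsupport χ
        · rw [indicator_of_mem hz]
          exact ENNReal.rpow_le_rpow (hB z) hp.le
        · simp [image_eq_zero_of_notMem_tsupport hz, hp]
    _ = (B : ℝ≥0∞) ^ p * μ (tsupport χ) := lintegral_indicator_const
        (isClosed_tsupport χ).measurableSet _
    _ < ⊤ := ENNReal.mul_lt_top (ENNReal.rpow_lt_top_of_nonneg hp.le ENNReal.coe_ne_top)
        hχc.isCompact.measure_lt_top

lemma weightedLpNorm_congr_ae {F : Type*} [NormedAddCommGroup F] {p α : ℝ}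
    {μ : Measure (E3 × E3)} {f g : E3 × E3 → F} (h : f =ᵐ[μ] g) :
    weightedLpNorm p α μ f = weightedLpNorm p α μ g := by
  rw [weightedLpNorm, weightedLpNorm]
  congr 1
  refine lintegral_congr_ae ?_
  filter_upwards [h] with z hz
  rw [hz]

lemma weightedLpNorm_mono {F G : Type*} [NormedAddCommGroup F] [NormedAddCommGroup G] {p α : ℝ}
    (hp : 0 ≤ p) {μ : Measure (E3 × E3)} {f : E3 × E3 → F} {g : E3 × E3 → G}
    (h : ∀ z, ‖f z‖ ≤ ‖g z‖) : weightedLpNorm p α μ f ≤ weightedLpNorm p α μ g := by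
  refine ENNReal.rpow_le_rpow (lintegral_mono fun z => ?_) (by positivity)
  refine mul_le_mul_left (ENNReal.rpow_le_rpow ?_ hp) _
  rw [← ofReal_norm, ← ofReal_norm]
  exact ENNReal.ofReal_le_ofReal (h z)

lemma weightedLpNorm_zero_exponent_le {F : Type*} [NormedAddCommGroup F] {p α : ℝ} (hp : 0 ≤ p)
    (hα : 0 ≤ α) (μ : Measure (E3 × E3)) (f : E3 × E3 → F) :
    weightedLpNorm p 0 μ f ≤ weightedLpNorm p α μ f := by
  rw [weightedLpNorm_eq hp, weightedLpNorm_eq hp]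
  refine ENNReal.rpow_le_rpow (lintegral_mono fun z => ENNReal.rpow_le_rpow ?_ hp) (by positivity)
  rw [gaussWeight_zero_exponent]
  exact mul_le_mul_left (one_le_gaussWeight hα _) _

lemma weightedLpNorm_le_sobolevNorm (p α : ℝ) (Ω : Set E3) (f : E3 × E3 → ℝ) :
    weightedLpNorm p α (phaseMeasure Ω) f ≤ sobolevNorm p α Ω f :=
  le_iInf fun _ => le_iInf fun _ => le_iInf fun _ => le_self_add.trans le_self_add

lemma HasWeakGradient.weightedLpNorm_sub_partialX_le {p : ℝ} (hp : 0 ≤ p) {f φ : E3 × E3 → ℝ}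
    {Gx Gv : E3 × E3 → E3} (hΩ : IsOpen Ω) (hG : HasWeakGradient Ω f Gx Gv)
    (hφ : ContDiff ℝ ∞ φ) (i : Fin 3) :
    weightedLpNorm p 0 (phaseMeasure Ω) ((fun z => Gx z i) - partialX φ i) ≤
      sobolevNorm p 0 Ω (f - φ) := by
  refine le_iInf fun Gx' => le_iInf fun Gv' => le_iInf fun hG' => ?_
  have h1 := weightedLpNorm_congr_ae (p := p) (α := 0) (hG.sub_smooth_coord_ae_eq hΩ hφ hG' i)
  have h2 : weightedLpNorm p 0 (phaseMeasure Ω) (fun z => Gx' z i) ≤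
      weightedLpNorm p 0 (phaseMeasure Ω) Gx' :=
    weightedLpNorm_mono hp fun z => PiLp.norm_apply_le (Gx' z) i
  exact (h1.le.trans h2).trans (le_add_self.trans le_self_add)

end

/-! ### Passage to the limit along smooth approximations -/

section

variable {Ω : Set E3} {ρ γ : ℝ} {ν : E3 → ℝ} {k : E3 → E3 → ℝ}
  {W : Type*} [MeasurableSpace W]

lemma KernelBound.integrable_test_of_hasCompactSupport {p : ℝ} {μ η : Measure (E3 × E3)}
    [IsFiniteMeasureOnCompacts μ] {m : Measure W} [SFinite m] {R : (E3 × E3) × W → ℝ}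
    {T : (E3 × E3) × W → E3 × E3} {C : ℝ≥0∞} (hK : KernelBound p 0 μ η m R T C) (hC : C ≠ ⊤)
    (hp : 1 ≤ p) (hR : Measurable R) (hT : Measurable T) {u : E3 × E3 → ℝ}
    (hu : AEStronglyMeasurable u η) (huf : weightedLpNorm p 0 η u < ⊤) {χ : E3 × E3 → ℝ}
    (hχ : Continuous χ) (hχc : HasCompactSupport χ) :
    Integrable (fun q => χ q.1 * (R q * u (T q))) (μ.prod m) := by
  obtain ⟨B, hB⟩ := exists_enorm_le_of_hasCompactSupport hχ hχc
  exact hK.integrable_test hC hp hR hT hu huf (isClosed_tsupport χ).measurableSet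
    hχc.isCompact.measure_lt_top hχ.measurable
    (fun z hz => image_eq_zero_of_notMem_tsupport hz) hB

lemma KernelBound.tendsto_testPairing_of_hasCompactSupport {p : ℝ} {μ η : Measure (E3 × E3)}
    [IsFiniteMeasureOnCompacts μ] {m : Measure W} [SFinite m] {R : (E3 × E3) × W → ℝ}
    {T : (E3 × E3) × W → E3 × E3} {C : ℝ≥0∞} (hK : KernelBound p 0 μ η m R T C) (hC : C ≠ ⊤)
    (hp : 1 ≤ p) (hR : Measurable R) (hT : Measurable T) {u : E3 × E3 → ℝ}
    (hu : AEStronglyMeasurable u η) (huf : weightedLpNorm p 0 η u < ⊤) {w : ℕ → E3 × E3 → ℝ}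
    (hw : ∀ n, Continuous (w n))
    (hwu : Tendsto (fun n => weightedLpNorm p 0 η (u - w n)) atTop (𝓝 0)) {χ : E3 × E3 → ℝ}
    (hχ : Continuous χ) (hχc : HasCompactSupport χ) :
    Tendsto (fun n => testPairing μ m R T χ (w n)) atTop (𝓝 (testPairing μ m R T χ u)) := by
  obtain ⟨B, hB⟩ := exists_enorm_le_of_hasCompactSupport hχ hχc
  exact hK.tendsto_testPairing hC hp hR hT hu huf (fun n => (hw n).aestronglyMeasurable) hwu
    (isClosed_tsupport χ).measurableSet hχc.isCompact.measure_lt_top hχ.measurable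
    (fun z hz => image_eq_zero_of_notMem_tsupport hz) hB

instance : IsFiniteMeasureOnCompacts (phaseMeasure Ω) := by
  have hH : ((volume : Measure E3).prod (volume : Measure E3)).IsAddHaarMeasure := inferInstance
  have : (volume : Measure (E3 × E3)).IsAddHaarMeasure := hH
  unfold phaseMeasure; infer_instance

lemma IsConvexC2Domain.isFiniteMeasureOnCompacts_boundaryMeasure (hΩ : IsConvexC2Domain Ω) :
    IsFiniteMeasureOnCompacts (boundaryMeasure Ω) := by
  have := hΩ.isFiniteMeasure_surfaceMeasure
  rw [boundaryMeasure_eq]; infer_instance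

/-- The weak derivative of `S_Ω K h` in the direction `(a, b)`, for a Sobolev function `h` with
trace `g`. -/
lemma testPairing_weak (hΩ : IsConvexC2Domain Ω) (hL : CollisionAssumption ρ γ ν k) {p : ℝ}
    (hp : 1 ≤ p) (hp2 : p < 2) {h g : E3 × E3 → ℝ} {Gx Gv : E3 × E3 → E3}
    (hG : HasWeakGradient Ω h Gx Gv) (hhf : weightedLpNorm p 0 (phaseMeasure Ω) h < ⊤)
    (hGf : weightedLpNorm p 0 (phaseMeasure Ω) Gx < ⊤) (hg : IsTrace p Ω h g)
    (hgf : weightedLpNorm p 0 (boundaryMeasure Ω) g < ⊤)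
    {ψ : E3 × E3 → ℝ} (hψ : ContDiff ℝ ∞ ψ) (hψc : HasCompactSupport ψ)
    (hψs : tsupport ψ ⊆ Ω ×ˢ univ) {a b : E3} (ha : ‖a‖ ≤ 1) (hb : ‖b‖ ≤ 1) :
    testPairing (phaseMeasure Ω) streamMeasure (interiorKernel Ω (baseKernel ν k)) streamMap
        (fun z => fderiv ℝ ψ z (a, b)) h +
      testPairing (phaseMeasure Ω) streamMeasure (interiorKernel Ω (velKernel ν k b)) streamMap ψ h +
      (∑ i, testPairing (phaseMeasure Ω) streamMeasure (interiorKernel Ω (gradKernel ν k a b i))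
        streamMap ψ (fun z => Gx z i)) +
      testPairing (phaseMeasure Ω) volume (exitKernel Ω ν k a b) (exitMap Ω) ψ g = 0 := by
  have hp0 : 0 < p := by linarith
  -- The approximations defining the trace converge in the unweighted norms, so the bounds are used
  -- here with exponent zero.
  have hα : (0 : ℝ) < (1 - ρ) / 2 := by linarith [hL.rho_lt_one]
  obtain ⟨C0, hC0⟩ := exists_kernelBound_base hL hp le_rfl hα
  obtain ⟨C1, hC1⟩ := exists_kernelBound_vel hL hp le_rfl hα
  obtain ⟨C2, hC2⟩ := exists_kernelBound_grad hL hp le_rfl hα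
  obtain ⟨C3, hC3⟩ := exists_kernelBound_exit hL hp hp2 le_rfl hα
  replace hC0 := hC0 Ω hΩ
  replace hC1 := hC1 Ω hΩ b hb
  replace hC2 := hC2 Ω hΩ a b ha hb
  replace hC3 := hC3 Ω hΩ a b ha hb
  have hD : ∀ C : ℝ≥0, (C : ℝ≥0∞) * ENNReal.ofReal (Metric.diam Ω) ≠ ⊤ := fun C => by finiteness
  have hbm := hΩ.isFiniteMeasureOnCompacts_boundaryMeasure
  have hm0 := measurable_interiorKernel hΩ.isOpen (measurable_baseKernel hL)
  have hm1 := measurable_interiorKernel hΩ.isOpen (measurable_velKernel hL b)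
  have hm2 := fun i => measurable_interiorKernel hΩ.isOpen (measurable_gradKernel hL a b i)
  have hm3 := measurable_exitKernel hΩ hL a b
  obtain ⟨hgm, φ, hφ, hφh, hφg⟩ := hg
  have hhm : AEStronglyMeasurable h (phaseMeasure Ω) := hG.locallyIntegrable.aestronglyMeasurable
  have hGm : ∀ i, AEStronglyMeasurable (fun z => Gx z i) (phaseMeasure Ω) := fun i =>
    (locallyIntegrableOn_coord hG.locallyIntegrable_x i).aestronglyMeasurable
  have hGif : ∀ i, weightedLpNorm p 0 (phaseMeasure Ω) (fun z => Gx z i) < ⊤ := fun i =>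
    (weightedLpNorm_mono hp0.le fun z => PiLp.norm_apply_le (Gx z) i).trans_lt hGf
  have hψ' : Continuous fun z => fderiv ℝ ψ z (a, b) :=
    (hψ.continuous_fderiv (by simp)).clm_apply continuous_const
  have hψ'c : HasCompactSupport fun z => fderiv ℝ ψ z (a, b) := hψc.fderiv_apply ℝ (a, b)
  have hφc : ∀ n, Continuous (φ n) := fun n => (hφ n).1.continuous
  have hpc : ∀ n i, Continuous (partialX (φ n) i) := fun n i =>
    ((hφ n).1.continuous_fderiv (by simp)).clm_apply continuous_const
  have hpcs : ∀ n i, HasCompactSupport (partialX (φ n) i) := fun n i =>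
    (hφ n).2.fderiv_apply ℝ _
  have hlim0 : Tendsto (fun n => weightedLpNorm p 0 (phaseMeasure Ω) (h - φ n)) atTop (𝓝 0) :=
    tendsto_of_tendsto_of_tendsto_of_le_of_le tendsto_const_nhds hφh (fun _ => zero_le)
      fun n => weightedLpNorm_le_sobolevNorm _ _ _ _
  have hlim1 : ∀ i, Tendsto (fun n => weightedLpNorm p 0 (phaseMeasure Ω)
      ((fun z => Gx z i) - partialX (φ n) i)) atTop (𝓝 0) := fun i =>
    tendsto_of_tendsto_of_tendsto_of_le_of_le tendsto_const_nhds hφh (fun _ => zero_le)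
      fun n => hG.weightedLpNorm_sub_partialX_le hp0.le hΩ.isOpen (hφ n).1 i
  have t0 := hC0.tendsto_testPairing_of_hasCompactSupport ENNReal.coe_ne_top hp hm0
    measurable_streamMap hhm hhf hφc hlim0 hψ' hψ'c
  have t1 := hC1.tendsto_testPairing_of_hasCompactSupport ENNReal.coe_ne_top hp hm1
    measurable_streamMap hhm hhf hφc hlim0 hψ.continuous hψc
  have t2 := fun i => (hC2 i).tendsto_testPairing_of_hasCompactSupport (hD _) hp (hm2 i)
    measurable_streamMap (hGm i) (hGif i) (fun n => hpc n i) (hlim1 i) hψ.continuous hψc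
  have t3 := hC3.tendsto_testPairing_of_hasCompactSupport (hD _) hp hm3
    hΩ.measurable_exitMap hgm hgf hφc hφg hψ.continuous hψc
  -- The sum is zero for every smooth approximation. Its interior terms converge with the functions
  -- and their position derivatives, and its exit term with their boundary values.
  refine tendsto_nhds_unique (((t0.add t1).add (tendsto_finsetSum _ fun i _ => t2 i)).add t3) ?_
  refine tendsto_const_nhds.congr fun n => (testPairing_smooth hΩ hL (hφ n).1 (hφ n).2 hψ hψs a b
    ?_ ?_ ?_ ?_ ?_).symm
  · exact hC0.integrable_test_of_hasCompactSupport ENNReal.coe_ne_top hp hm0 measurable_streamMap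
      (hφc n).aestronglyMeasurable (weightedLpNorm_lt_top_of_hasCompactSupport hp0 (hφc n) (hφ n).2)
      hψ.continuous hψc
  · exact hC0.integrable_test_of_hasCompactSupport ENNReal.coe_ne_top hp hm0 measurable_streamMap
      (hφc n).aestronglyMeasurable (weightedLpNorm_lt_top_of_hasCompactSupport hp0 (hφc n) (hφ n).2)
      hψ' hψ'c
  · exact hC1.integrable_test_of_hasCompactSupport ENNReal.coe_ne_top hp hm1 measurable_streamMap
      (hφc n).aestronglyMeasurable (weightedLpNorm_lt_top_of_hasCompactSupport hp0 (hφc n) (hφ n).2)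
      hψ.continuous hψc
  · exact fun i => (hC2 i).integrable_test_of_hasCompactSupport (hD _) hp (hm2 i)
      measurable_streamMap (hpc n i).aestronglyMeasurable
      (weightedLpNorm_lt_top_of_hasCompactSupport hp0 (hpc n i) (hpcs n i)) hψ.continuous hψc
  · exact hC3.integrable_test_of_hasCompactSupport (hD _) hp hm3 hΩ.measurable_exitMap
      (hφc n).aestronglyMeasurable (weightedLpNorm_lt_top_of_hasCompactSupport hp0 (hφc n) (hφ n).2)
      hψ.continuous hψc

end

section

variable {Ω : Set E3} {ρ γ : ℝ} {ν : E3 → ℝ} {k : E3 → E3 → ℝ}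
  {W : Type*} [MeasurableSpace W]

/-! ### Identification of `S_Ω K h` -/

lemma weightedLpNorm_lt_top_iff {F : Type*} [NormedAddCommGroup F] {p : ℝ} (hp : 0 < p) (α : ℝ)
    (μ : Measure (E3 × E3)) (f : E3 × E3 → F) :
    weightedLpNorm p α μ f < ⊤ ↔ ∫⁻ z, (gaussWeight α z.2 * ‖f z‖ₑ) ^ p ∂μ < ⊤ := by
  rw [weightedLpNorm_eq hp.le, ENNReal.rpow_lt_top_iff_of_pos (by positivity)]

lemma KernelBound.ae_integrable {p α : ℝ} {μ η : Measure (E3 × E3)} [SFinite μ] {m : Measure W}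
    [SFinite m] {R : (E3 × E3) × W → ℝ} {T : (E3 × E3) × W → E3 × E3} {C : ℝ≥0∞}
    (hK : KernelBound p α μ η m R T C) (hC : C ≠ ⊤) (hp : 0 < p) (hR : Measurable R)
    (hT : Measurable T) {u : E3 × E3 → ℝ} (hu : AEStronglyMeasurable u η)
    (huf : weightedLpNorm p α η u < ⊤) :
    ∀ᵐ z ∂μ, Integrable (fun o => R (z, o) * u (T (z, o))) m := by
  have hm := hK.aestronglyMeasurable hp hR hT hu
  have h1 := (hK.lintegral_le hp hR hT hu).trans_lt
    (ENNReal.mul_lt_top hC.lt_top ((weightedLpNorm_lt_top_iff hp α η u).1 huf))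
  have hg := measurable_gaussWeight α
  have hmeas : AEMeasurable (fun z : E3 × E3 =>
      (gaussWeight α z.2 * ∫⁻ o, ‖R (z, o) * u (T (z, o))‖ₑ ∂m) ^ p) μ :=
    (AEMeasurable.mul (by fun_prop) hm.enorm.lintegral_prod_right').pow_const p
  filter_upwards [ae_lt_top' hmeas h1.ne, hm.prodMk_left] with z hz hzm
  refine ⟨hzm, ?_⟩
  rw [ENNReal.rpow_lt_top_iff_of_pos hp] at hz
  by_contra hcon
  have h2 : ∫⁻ o, ‖R (z, o) * u (T (z, o))‖ₑ ∂m = ⊤ := by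
    simpa [HasFiniteIntegral] using hcon
  rw [h2, ENNReal.mul_top (gaussWeight_pos _ _)] at hz
  exact absurd hz (lt_irrefl _)

lemma ae_mem_regularSet (hΩ : IsOpen Ω) : ∀ᵐ z ∂phaseMeasure Ω, z ∈ regularSet Ω := by
  have h1 : ∀ᵐ z : E3 × E3 ∂phaseMeasure Ω, z ∈ Ω ×ˢ (univ : Set E3) :=
    ae_restrict_mem (isOpen_phaseSpace hΩ).measurableSet
  have h2 : ∀ᵐ z : E3 × E3 ∂phaseMeasure Ω, ∀ t : ℝ, z.2 + t • (0 : E3) ≠ 0 :=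
    ae_restrict_of_ae (ae_line_ne 0 0)
  filter_upwards [h1, h2] with z hz hz'
  exact ⟨hz.1, by simpa using hz' 0⟩

/-- The operator is defined by iterated integrals, the kernel form by a joint one. The base bound
gives absolute convergence at almost every phase point, where Fubini applies. -/
lemma opS_opK_ae_eq (hΩ : IsConvexC2Domain Ω) (hL : CollisionAssumption ρ γ ν k) {p : ℝ}
    (hp : 1 ≤ p) {h : E3 × E3 → ℝ} (hh : AEStronglyMeasurable h (phaseMeasure Ω))
    (hhf : weightedLpNorm p 0 (phaseMeasure Ω) h < ⊤) :
    opS ν Ω (opK k h) =ᵐ[phaseMeasure Ω]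
      kernelOp streamMeasure (interiorKernel Ω (baseKernel ν k)) streamMap h := by
  have hα : (0 : ℝ) < (1 - ρ) / 2 := by linarith [hL.rho_lt_one]
  obtain ⟨C0, hC0⟩ := exists_kernelBound_base hL hp le_rfl hα
  filter_upwards [ae_mem_regularSet hΩ.isOpen, (hC0 Ω hΩ).ae_integrable ENNReal.coe_ne_top
    (by linarith) (measurable_interiorKernel hΩ.isOpen (measurable_baseKernel hL))
    measurable_streamMap hh hhf] with z hz hi
  rw [kernelOp, streamMeasure, integral_prod_symm _ hi, opS,
    intervalIntegral.integral_of_le (exitTime_nonneg _ _), integral_Ioc_eq_integral_Ioo,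
    ← Ioi_inter_Iio, ← setIntegral_indicator measurableSet_Iio]
  refine setIntegral_congr_fun measurableSet_Ioi fun s hs => ?_
  have hiff := hΩ.mem_iff_lt_exitTime hz.1 hz.2 (le_of_lt hs)
  simp only [interiorKernel, streamMap]
  by_cases hsτ : s < exitTime Ω z.1 z.2
  · rw [indicator_of_mem (show s ∈ Iio _ from hsτ)]
    simp only [indicator_of_mem (hiff.2 hsτ), baseKernel, opK, mul_assoc]
    rw [integral_const_mul]
  · rw [indicator_of_notMem (show s ∉ Iio _ from hsτ)]
    simp only [indicator_of_notMem (fun hc => hsτ (hiff.1 hc)), zero_mul, integral_zero]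

/-! ### Weighted norms -/

lemma weightedLpNorm_add_le {p α : ℝ} (hp : 1 ≤ p) {μ : Measure (E3 × E3)} {f g : E3 × E3 → ℝ}
    (hf : AEStronglyMeasurable f μ) (hg : AEStronglyMeasurable g μ) :
    weightedLpNorm p α μ (f + g) ≤ weightedLpNorm p α μ f + weightedLpNorm p α μ g := by
  have hp0 : 0 ≤ p := by linarith
  have hw := measurable_gaussWeight α
  have hw' : AEMeasurable (fun z : E3 × E3 => gaussWeight α z.2) μ := by fun_prop
  rw [weightedLpNorm_eq hp0, weightedLpNorm_eq hp0, weightedLpNorm_eq hp0]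
  refine le_trans (ENNReal.rpow_le_rpow (lintegral_mono fun z => ENNReal.rpow_le_rpow ?_ hp0)
    (by positivity)) (ENNReal.lintegral_Lp_add_le (hw'.mul hf.enorm) (hw'.mul hg.enorm) hp)
  simp only [Pi.add_apply]
  rw [← mul_add]
  exact mul_le_mul_right (enorm_add_le _ _) _

lemma weightedLpNorm_sum_le {p α : ℝ} (hp : 1 ≤ p) {μ : Measure (E3 × E3)} {ι : Type*}
    (s : Finset ι) {f : ι → E3 × E3 → ℝ} (hf : ∀ i, AEStronglyMeasurable (f i) μ) :
    weightedLpNorm p α μ (∑ i ∈ s, f i) ≤ ∑ i ∈ s, weightedLpNorm p α μ (f i) := by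
  classical
  induction s using Finset.induction_on with
  | empty =>
    have hp0 : 0 < p := by linarith
    simp [weightedLpNorm, hp0]
  | insert i s hi ih =>
    rw [Finset.sum_insert hi, Finset.sum_insert hi]
    exact (weightedLpNorm_add_le hp (hf i)
      (Finset.aestronglyMeasurable_sum _ fun j _ => hf j)).trans (add_le_add le_rfl ih)

lemma weightedLpNorm_toLp_le {p α : ℝ} (hp : 1 ≤ p) {μ : Measure (E3 × E3)}
    {f : Fin 3 → E3 × E3 → ℝ} (hf : ∀ i, AEStronglyMeasurable (f i) μ) :
    weightedLpNorm p α μ (fun z => (WithLp.toLp 2 fun i => f i z : E3)) ≤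
      ∑ i, weightedLpNorm p α μ (f i) := by
  have h1 : weightedLpNorm p α μ (fun z => (WithLp.toLp 2 fun i => f i z : E3)) ≤
      weightedLpNorm p α μ (∑ i, fun z => ‖f i z‖) := by
    refine weightedLpNorm_mono (by linarith) fun z => ?_
    rw [Finset.sum_apply, Real.norm_of_nonneg (Finset.sum_nonneg fun i _ => norm_nonneg _)]
    rw [EuclideanSpace.norm_eq]
    refine Real.sqrt_le_iff.2 ⟨Finset.sum_nonneg fun i _ => norm_nonneg _, ?_⟩
    exact Finset.sum_sq_le_sq_sum_of_nonneg fun i _ => norm_nonneg _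
  refine h1.trans ((weightedLpNorm_sum_le hp _ fun i => (hf i).norm).trans
    (Finset.sum_le_sum fun i _ => weightedLpNorm_mono (by linarith) fun z => ?_))
  rw [norm_norm]

lemma locallyIntegrableOn_of_weightedLpNorm {F : Type*} [NormedAddCommGroup F] {p : ℝ}
    (hp : 1 ≤ p) {U : Set (E3 × E3)} {f : E3 × E3 → F}
    (hf : AEStronglyMeasurable f (volume.restrict U))
    (hff : weightedLpNorm p 0 (volume.restrict U) f < ⊤) : LocallyIntegrableOn f U := by
  have hH : ((volume : Measure E3).prod (volume : Measure E3)).IsAddHaarMeasure := inferInstance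
  have : (volume : Measure (E3 × E3)).IsAddHaarMeasure := hH
  have hp0 : 0 < p := by linarith
  rw [weightedLpNorm_lt_top_iff hp0] at hff
  simp only [gaussWeight_zero_exponent, one_mul] at hff
  intro z hz
  refine ⟨U ∩ Metric.ball z 1, inter_mem_nhdsWithin _ (Metric.ball_mem_nhds z one_pos), ?_⟩
  rw [inter_comm, IntegrableOn, ← Measure.restrict_restrict Metric.isOpen_ball.measurableSet]
  refine ⟨hf.restrict, ?_⟩
  have h1 := lintegral_rpow_le_measure_mul ((volume.restrict U).restrict (Metric.ball z 1)) hp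
    hf.restrict.enorm
  rw [Measure.restrict_apply_univ] at h1
  have h2 : (volume.restrict U) (Metric.ball z 1) < ⊤ :=
    (Measure.restrict_apply_le _ _).trans_lt measure_ball_lt_top
  have h3 := h1.trans_lt (ENNReal.mul_lt_top
    (ENNReal.rpow_lt_top_of_nonneg (by linarith) h2.ne)
    ((setLIntegral_le_lintegral _ _).trans_lt hff))
  exact (ENNReal.rpow_lt_top_iff_of_pos hp0).1 h3

end

section

variable {Ω : Set E3} {ρ γ : ℝ} {ν : E3 → ℝ} {k : E3 → E3 → ℝ}
  {W : Type*} [MeasurableSpace W]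

/-! ### The weak gradient of `S_Ω K h` -/

lemma KernelBound.test_kernelOp {p : ℝ} {μ η : Measure (E3 × E3)}
    [IsFiniteMeasureOnCompacts μ] [SFinite μ] {m : Measure W} [SFinite m]
    {R : (E3 × E3) × W → ℝ} {T : (E3 × E3) × W → E3 × E3} {C : ℝ≥0∞}
    (hK : KernelBound p 0 μ η m R T C) (hC : C ≠ ⊤)
    (hp : 1 ≤ p) (hR : Measurable R) (hT : Measurable T) {u : E3 × E3 → ℝ}
    (hu : AEStronglyMeasurable u η) (huf : weightedLpNorm p 0 η u < ⊤) {χ : E3 × E3 → ℝ}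
    (hχ : Continuous χ) (hχc : HasCompactSupport χ) :
    Integrable (fun z => χ z * kernelOp m R T u z) μ ∧
      testPairing μ m R T χ u = ∫ z, χ z * kernelOp m R T u z ∂μ := by
  have hi := hK.integrable_test_of_hasCompactSupport hC hp hR hT hu huf hχ hχc
  refine ⟨?_, testPairing_eq hi⟩
  have h1 := hi.integral_prod_left
  simp only [integral_const_mul] at h1
  exact h1

/-- The weak derivative of `S_Ω K h` in the direction `(a, b)`, in terms of `h`, its gradient `G` in
the position variable, and its trace `g`. -/
def dirDeriv (Ω : Set E3) (ν : E3 → ℝ) (k : E3 → E3 → ℝ) (a b : E3) (h : E3 × E3 → ℝ)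
    (G : E3 × E3 → E3) (g : E3 × E3 → ℝ) : E3 × E3 → ℝ :=
  kernelOp streamMeasure (interiorKernel Ω (velKernel ν k b)) streamMap h +
    (∑ i, kernelOp streamMeasure (interiorKernel Ω (gradKernel ν k a b i)) streamMap
      (fun z => G z i)) +
    kernelOp volume (exitKernel Ω ν k a b) (exitMap Ω) g

lemma aestronglyMeasurable_coord {μ : Measure (E3 × E3)} {G : E3 × E3 → E3}
    (hG : AEStronglyMeasurable G μ) (i : Fin 3) : AEStronglyMeasurable (fun z => G z i) μ :=
  (EuclideanSpace.proj (𝕜 := ℝ) i).continuous.comp_aestronglyMeasurable hG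

/-- Taking p-th roots of the kernel bounds turns one power of the diameter into the power 1/p, and
the constants are uniform over directions in the unit ball. -/
lemma exists_dirDeriv_le (hL : CollisionAssumption ρ γ ν k) {p α : ℝ} (hp : 1 ≤ p) (hp2 : p < 2)
    (hα0 : 0 ≤ α) (hα : α < (1 - ρ) / 2) :
    ∃ C : ℝ≥0, ∀ Ω, IsConvexC2Domain Ω → ∀ a b : E3, ‖a‖ ≤ 1 → ‖b‖ ≤ 1 →
      ∀ (h g : E3 × E3 → ℝ) (G : E3 × E3 → E3), AEStronglyMeasurable h (phaseMeasure Ω) →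
      AEStronglyMeasurable G (phaseMeasure Ω) → AEStronglyMeasurable g (boundaryMeasure Ω) →
      AEStronglyMeasurable (dirDeriv Ω ν k a b h G g) (phaseMeasure Ω) ∧
      weightedLpNorm p α (phaseMeasure Ω) (dirDeriv Ω ν k a b h G g) ≤
        C * (weightedLpNorm p α (phaseMeasure Ω) h +
          ENNReal.ofReal (Metric.diam Ω) ^ (1 / p) * weightedLpNorm p α (phaseMeasure Ω) G +
          ENNReal.ofReal (Metric.diam Ω) ^ (1 / p) * weightedLpNorm p α (boundaryMeasure Ω) g) := by
  have hp0 : 0 < p := by linarith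
  obtain ⟨C1, hC1⟩ := exists_kernelBound_vel hL hp hα0 hα
  obtain ⟨C2, hC2⟩ := exists_kernelBound_grad hL hp hα0 hα
  obtain ⟨C3, hC3⟩ := exists_kernelBound_exit hL hp hp2 hα0 hα
  -- The factor 3 counts the position derivatives of h.
  refine ⟨C1 ^ (1 / p) + 3 * C2 ^ (1 / p) + C3 ^ (1 / p), fun Ω hΩ a b ha hb h g G hh hG hg => ?_⟩
  replace hC1 := hC1 Ω hΩ b hb
  replace hC2 := hC2 Ω hΩ a b ha hb
  replace hC3 := hC3 Ω hΩ a b ha hb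
  have hm1 := measurable_interiorKernel hΩ.isOpen (measurable_velKernel hL b)
  have hm2 := fun i => measurable_interiorKernel hΩ.isOpen (measurable_gradKernel hL a b i)
  have hm3 := measurable_exitKernel hΩ hL a b
  have hGi := aestronglyMeasurable_coord hG
  have s1 := hC1.aestronglyMeasurable_kernelOp hp0 hm1 measurable_streamMap hh
  have s2 := fun i => (hC2 i).aestronglyMeasurable_kernelOp hp0 (hm2 i) measurable_streamMap (hGi i)
  have s3 := hC3.aestronglyMeasurable_kernelOp hp0 hm3 hΩ.measurable_exitMap hg
  have s2' := Finset.aestronglyMeasurable_sum Finset.univ fun i _ => s2 i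
  refine ⟨(s1.add s2').add s3, ?_⟩
  set d := ENNReal.ofReal (Metric.diam Ω) ^ (1 / p)
  have hrp : ∀ C : ℝ≥0, ((C : ℝ≥0∞) * ENNReal.ofReal (Metric.diam Ω)) ^ (1 / p) =
      (C ^ (1 / p) : ℝ≥0) * d := fun C => by
    rw [ENNReal.mul_rpow_of_nonneg _ _ (by positivity),
      ENNReal.coe_rpow_of_nonneg _ (by positivity)]
  have b1 : weightedLpNorm p α (phaseMeasure Ω) _ ≤ _ :=
    hC1.weightedLpNorm_le hp0 hm1 measurable_streamMap hh
  have b2 : ∀ i, weightedLpNorm p α (phaseMeasure Ω) (kernelOp streamMeasure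
      (interiorKernel Ω (gradKernel ν k a b i)) streamMap (fun z => G z i)) ≤
      (C2 ^ (1 / p) : ℝ≥0) * d * weightedLpNorm p α (phaseMeasure Ω) G := fun i => by
    refine ((hC2 i).weightedLpNorm_le hp0 (hm2 i) measurable_streamMap (hGi i)).trans ?_
    rw [hrp]
    exact mul_le_mul_right (weightedLpNorm_mono hp0.le fun z => PiLp.norm_apply_le (G z) i) _
  have b3 := hC3.weightedLpNorm_le hp0 hm3 hΩ.measurable_exitMap hg
  rw [← ENNReal.coe_rpow_of_nonneg _ (by positivity)] at b1
  rw [hrp] at b3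
  set X := weightedLpNorm p α (phaseMeasure Ω) h
  set Y := weightedLpNorm p α (phaseMeasure Ω) G
  set Z := weightedLpNorm p α (boundaryMeasure Ω) g
  refine (weightedLpNorm_add_le hp (s1.add s2') s3).trans ?_
  refine (add_le_add ((weightedLpNorm_add_le hp s1 s2').trans
    (add_le_add b1 ((weightedLpNorm_sum_le hp _ s2).trans (Finset.sum_le_sum fun i _ => b2 i))))
    b3).trans ?_
  rw [Finset.sum_const, Finset.card_univ, Fintype.card_fin, nsmul_eq_mul]
  push_cast
  set c1 : ℝ≥0∞ := ((C1 ^ (1 / p) : ℝ≥0) : ℝ≥0∞)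
  set c2 : ℝ≥0∞ := ((C2 ^ (1 / p) : ℝ≥0) : ℝ≥0∞)
  set c3 : ℝ≥0∞ := ((C3 ^ (1 / p) : ℝ≥0) : ℝ≥0∞)
  calc c1 * X + 3 * (c2 * d * Y) + c3 * d * Z
      = c1 * X + (3 * c2) * (d * Y) + c3 * (d * Z) := by ring
    _ ≤ (c1 + 3 * c2 + c3) * X + (c1 + 3 * c2 + c3) * (d * Y) + (c1 + 3 * c2 + c3) * (d * Z) := by
        gcongr
        · exact le_self_add.trans le_self_add
        · exact le_add_self.trans le_self_add
        · exact le_add_self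
    _ = _ := by ring

/-- The vanishing sum of pairings read as integrals over phase space: the pairing with the
derivative of ψ is the left side, and the three families of derivative kernels make up the right. -/
lemma integral_opS_opK_mul_fderiv (hΩ : IsConvexC2Domain Ω) (hL : CollisionAssumption ρ γ ν k)
    {p : ℝ} (hp : 1 ≤ p) (hp2 : p < 2) {h g : E3 × E3 → ℝ} {Gx Gv : E3 × E3 → E3}
    (hG : HasWeakGradient Ω h Gx Gv) (hhf : weightedLpNorm p 0 (phaseMeasure Ω) h < ⊤)
    (hGf : weightedLpNorm p 0 (phaseMeasure Ω) Gx < ⊤) (hg : IsTrace p Ω h g)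
    (hgf : weightedLpNorm p 0 (boundaryMeasure Ω) g < ⊤)
    {ψ : E3 × E3 → ℝ} (hψ : ContDiff ℝ ∞ ψ) (hψc : HasCompactSupport ψ)
    (hψs : tsupport ψ ⊆ Ω ×ˢ univ) {a b : E3} (ha : ‖a‖ ≤ 1) (hb : ‖b‖ ≤ 1) :
    ∫ z in Ω ×ˢ univ, opS ν Ω (opK k h) z * fderiv ℝ ψ z (a, b) =
      -∫ z in Ω ×ˢ univ, dirDeriv Ω ν k a b h Gx g z * ψ z := by
  have hα : (0 : ℝ) < (1 - ρ) / 2 := by linarith [hL.rho_lt_one]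
  obtain ⟨C0, hC0⟩ := exists_kernelBound_base hL hp le_rfl hα
  obtain ⟨C1, hC1⟩ := exists_kernelBound_vel hL hp le_rfl hα
  obtain ⟨C2, hC2⟩ := exists_kernelBound_grad hL hp le_rfl hα
  obtain ⟨C3, hC3⟩ := exists_kernelBound_exit hL hp hp2 le_rfl hα
  replace hC0 := hC0 Ω hΩ
  replace hC1 := hC1 Ω hΩ b hb
  replace hC2 := hC2 Ω hΩ a b ha hb
  replace hC3 := hC3 Ω hΩ a b ha hb
  have hD : ∀ C : ℝ≥0, (C : ℝ≥0∞) * ENNReal.ofReal (Metric.diam Ω) ≠ ⊤ := fun C => by finiteness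
  have hm0 := measurable_interiorKernel hΩ.isOpen (measurable_baseKernel hL)
  have hm1 := measurable_interiorKernel hΩ.isOpen (measurable_velKernel hL b)
  have hm2 := fun i => measurable_interiorKernel hΩ.isOpen (measurable_gradKernel hL a b i)
  have hm3 := measurable_exitKernel hΩ hL a b
  have hhm : AEStronglyMeasurable h (phaseMeasure Ω) := hG.locallyIntegrable.aestronglyMeasurable
  have hGm : ∀ i, AEStronglyMeasurable (fun z => Gx z i) (phaseMeasure Ω) := fun i =>
    (locallyIntegrableOn_coord hG.locallyIntegrable_x i).aestronglyMeasurable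
  have hGif : ∀ i, weightedLpNorm p 0 (phaseMeasure Ω) (fun z => Gx z i) < ⊤ := fun i =>
    (weightedLpNorm_mono (by linarith) fun z => PiLp.norm_apply_le (Gx z) i).trans_lt hGf
  have hψ' : Continuous fun z => fderiv ℝ ψ z (a, b) :=
    (hψ.continuous_fderiv (by simp)).clm_apply continuous_const
  have hψ'c : HasCompactSupport fun z => fderiv ℝ ψ z (a, b) := hψc.fderiv_apply ℝ (a, b)
  have key := testPairing_weak hΩ hL hp hp2 hG hhf hGf hg hgf hψ hψc hψs ha hb
  obtain ⟨-, e0⟩ := hC0.test_kernelOp ENNReal.coe_ne_top hp hm0 measurable_streamMap hhm hhf hψ' hψ'c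
  obtain ⟨i1, e1⟩ := hC1.test_kernelOp ENNReal.coe_ne_top hp hm1 measurable_streamMap hhm hhf
    hψ.continuous hψc
  have i2 := fun i => ((hC2 i).test_kernelOp (hD _) hp (hm2 i) measurable_streamMap (hGm i) (hGif i)
    hψ.continuous hψc).1
  have e2 := fun i => ((hC2 i).test_kernelOp (hD _) hp (hm2 i) measurable_streamMap (hGm i) (hGif i)
    hψ.continuous hψc).2
  obtain ⟨i3, e3⟩ := hC3.test_kernelOp (hD _) hp hm3 hΩ.measurable_exitMap hg.1 hgf
    hψ.continuous hψc
  have i2s := integrable_finsetSum Finset.univ fun i _ => i2 i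
  rw [e0, e1, Finset.sum_congr rfl fun i _ => e2 i, e3, ← integral_finsetSum _ fun i _ => i2 i,
    add_assoc, add_assoc, ← integral_add' i2s i3,
    ← integral_add' i1 (i2s.add i3)] at key
  have l1 : ∫ z in Ω ×ˢ univ, opS ν Ω (opK k h) z * fderiv ℝ ψ z (a, b) =
      ∫ z, fderiv ℝ ψ z (a, b) *
        kernelOp streamMeasure (interiorKernel Ω (baseKernel ν k)) streamMap h z
        ∂phaseMeasure Ω := by
    refine integral_congr_ae ?_
    filter_upwards [opS_opK_ae_eq hΩ hL hp hhm hhf] with z hz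
    rw [hz, mul_comm]
  rw [l1, eq_neg_iff_add_eq_zero, ← key]
  congr 1
  refine integral_congr_ae (Eventually.of_forall fun z => ?_)
  simp only [dirDeriv, Pi.add_apply, Finset.sum_apply]
  rw [← Finset.mul_sum]
  ring

/-- The vector field whose coordinates are the derivatives in the coordinate directions. -/
def gradVec (D : E3 → E3 × E3 → ℝ) (z : E3 × E3) : E3 :=
  WithLp.toLp 2 fun i => D (EuclideanSpace.single i 1) z

lemma norm_single_le_one (i : Fin 3) : ‖(EuclideanSpace.single i (1 : ℝ) : E3)‖ ≤ 1 := by simp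

lemma weightedLpNorm_gradVec_le {p α : ℝ} (hp : 1 ≤ p) {μ : Measure (E3 × E3)}
    {D : E3 → E3 × E3 → ℝ} {B : ℝ≥0∞}
    (hD : ∀ a : E3, ‖a‖ ≤ 1 → AEStronglyMeasurable (D a) μ ∧ weightedLpNorm p α μ (D a) ≤ B) :
    AEStronglyMeasurable (gradVec D) μ ∧ weightedLpNorm p α μ (gradVec D) ≤ 3 * B := by
  refine ⟨?_, (weightedLpNorm_toLp_le hp fun i => (hD _ (norm_single_le_one i)).1).trans
    ((Finset.sum_le_sum fun i _ => (hD _ (norm_single_le_one i)).2).trans (le_of_eq ?_))⟩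
  · refine (PiLp.continuous_toLp 2 _).comp_aestronglyMeasurable
      (aemeasurable_pi_lambda _ fun i => (hD _ (norm_single_le_one i)).1.aemeasurable).aestronglyMeasurable
  · rw [Finset.sum_const, Finset.card_univ, Fintype.card_fin, nsmul_eq_mul, Nat.cast_ofNat]

/-- A weak derivative in every direction is a linear function of the direction. -/
lemma integral_gradVec {U : Set (E3 × E3)} {f ψ : E3 × E3 → ℝ} {D : E3 → E3 × E3 → ℝ}
    (hψ : ContDiff ℝ ∞ ψ) (hψc : HasCompactSupport ψ) (hψs : tsupport ψ ⊆ U)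
    (hf : LocallyIntegrableOn f U) (hD : LocallyIntegrableOn (gradVec D) U)
    (L : E3 →L[ℝ] E3 × E3)
    (h : ∀ a : E3, ‖a‖ ≤ 1 →
      ∫ z in U, f z * fderiv ℝ ψ z (L a) = -∫ z in U, D a z * ψ z) (w : E3) :
    ∫ z in U, f z * fderiv ℝ ψ z (L w) = -∫ z in U, inner ℝ (gradVec D z) w * ψ z := by
  -- Only basis directions enter, so linearity of the family D in its direction need not be known;
  -- the derivative of the test function is linear.
  have hw : w = ∑ i, w i • EuclideanSpace.single i (1 : ℝ) := by
    ext j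
    simp [Finset.sum_apply, Pi.single_apply]
  have e1 : ∀ z, f z * fderiv ℝ ψ z (L w) =
      ∑ i, w i * (f z * fderiv ℝ ψ z (L (EuclideanSpace.single i 1))) := fun z => by
    nth_rewrite 1 [hw]
    simp only [map_sum, map_smul, smul_eq_mul, Finset.mul_sum]
    exact Finset.sum_congr rfl fun i _ => by ring
  have e2 : ∀ z, inner ℝ (gradVec D z) w * ψ z = ∑ i, w i * (gradVec D z i * ψ z) := fun z => by
    rw [PiLp.inner_apply, Finset.sum_mul]
    exact Finset.sum_congr rfl fun i _ => by simp; ring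
  have h0 : ∀ z ∉ tsupport ψ, ψ z = 0 := fun z hz => image_eq_zero_of_notMem_tsupport hz
  have h1 : ∀ (e : E3 × E3), ∀ z ∉ tsupport ψ, fderiv ℝ ψ z e = 0 :=
    fun e z hz => by rw [fderiv_of_notMem_tsupport ℝ hz]; rfl
  have hψ' : ∀ e, Continuous fun z => fderiv ℝ ψ z e := fun e =>
    (hψ.continuous_fderiv (by simp)).clm_apply continuous_const
  simp only [e1, e2]
  rw [integral_finsetSum _ fun i _ => (integrableOn_mul_of_eq_zero hf (hψ' _) hψc hψs
      (h1 _)).const_mul _, integral_finsetSum _ fun i _ => (integrableOn_mul_of_eq_zero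
      (locallyIntegrableOn_coord hD i) hψ.continuous hψc hψs h0).const_mul _,
    ← Finset.sum_neg_distrib]
  refine Finset.sum_congr rfl fun i _ => ?_
  rw [integral_const_mul, integral_const_mul, h _ (norm_single_le_one i), mul_neg]
  rfl

end

/-! ### The weak gradient of the transported function and its norm -/

section

variable {Ω : Set E3} {ρ γ : ℝ} {ν : E3 → ℝ} {k : E3 → E3 → ℝ}

/-- Directions (a,0) give the position gradient and (0,b) the velocity gradient. Local integrability
follows from the unweighted bounds in L^p. -/
lemma hasWeakGradient_opS_opK (hΩ : IsConvexC2Domain Ω) (hL : CollisionAssumption ρ γ ν k)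
    {p : ℝ} (hp : 1 ≤ p) (hp2 : p < 2) {h g : E3 × E3 → ℝ} {Gx Gv : E3 × E3 → E3}
    (hG : HasWeakGradient Ω h Gx Gv) (hhf : weightedLpNorm p 0 (phaseMeasure Ω) h < ⊤)
    (hGf : weightedLpNorm p 0 (phaseMeasure Ω) Gx < ⊤) (hg : IsTrace p Ω h g)
    (hgf : weightedLpNorm p 0 (boundaryMeasure Ω) g < ⊤) :
    HasWeakGradient Ω (opS ν Ω (opK k h)) (gradVec fun a => dirDeriv Ω ν k a 0 h Gx g)
      (gradVec fun b => dirDeriv Ω ν k 0 b h Gx g) := by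
  have hp0 : 0 < p := by linarith
  have hα : (0 : ℝ) < (1 - ρ) / 2 := by linarith [hL.rho_lt_one]
  have hhm : AEStronglyMeasurable h (phaseMeasure Ω) := hG.locallyIntegrable.aestronglyMeasurable
  have hGm : AEStronglyMeasurable Gx (phaseMeasure Ω) :=
    hG.locallyIntegrable_x.aestronglyMeasurable
  obtain ⟨C0, hC0⟩ := exists_kernelBound_base hL hp le_rfl hα
  obtain ⟨C, hC⟩ := exists_dirDeriv_le hL hp hp2 le_rfl hα
  have hm0 := measurable_interiorKernel hΩ.isOpen (measurable_baseKernel hL)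
  have hae := opS_opK_ae_eq hΩ hL hp hhm hhf
  have hz1 : ‖(0 : E3)‖ ≤ 1 := by simp
  set B : ℝ≥0∞ := C * (weightedLpNorm p 0 (phaseMeasure Ω) h +
    ENNReal.ofReal (Metric.diam Ω) ^ (1 / p) * weightedLpNorm p 0 (phaseMeasure Ω) Gx +
    ENNReal.ofReal (Metric.diam Ω) ^ (1 / p) * weightedLpNorm p 0 (boundaryMeasure Ω) g) with hB
  have hBf : 3 * B < ⊤ := by
    have hd : ENNReal.ofReal (Metric.diam Ω) ^ (1 / p) ≠ ⊤ :=
      ENNReal.rpow_ne_top_of_nonneg (by positivity) ENNReal.ofReal_ne_top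
    have h1 := hhf.ne
    have h2 := hGf.ne
    have h3 := hgf.ne
    rw [lt_top_iff_ne_top, hB]
    finiteness
  obtain ⟨mx, bx⟩ := weightedLpNorm_gradVec_le hp
    (D := fun a => dirDeriv Ω ν k a 0 h Gx g) (B := B)
    fun a ha => hC Ω hΩ a 0 ha hz1 h g Gx hhm hGm hg.1
  obtain ⟨mv, bv⟩ := weightedLpNorm_gradVec_le hp
    (D := fun b => dirDeriv Ω ν k 0 b h Gx g) (B := B)
    fun b hb => hC Ω hΩ 0 b hz1 hb h g Gx hhm hGm hg.1
  have lS : LocallyIntegrableOn (opS ν Ω (opK k h)) (Ω ×ˢ univ) := by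
    refine locallyIntegrableOn_of_weightedLpNorm hp ?_ ?_
    · exact ((hC0 Ω hΩ).aestronglyMeasurable_kernelOp hp0 hm0 measurable_streamMap hhm).congr
        hae.symm
    · refine (weightedLpNorm_congr_ae hae).trans_lt
        (((hC0 Ω hΩ).weightedLpNorm_le hp0 hm0 measurable_streamMap hhm).trans_lt ?_)
      exact ENNReal.mul_lt_top (ENNReal.rpow_lt_top_of_nonneg (by positivity) ENNReal.coe_ne_top) hhf
  have lx := locallyIntegrableOn_of_weightedLpNorm hp mx (bx.trans_lt hBf)
  have lv := locallyIntegrableOn_of_weightedLpNorm hp mv (bv.trans_lt hBf)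
  refine ⟨lS, lx, lv, fun φ hφ hφc hφs w => ?_, fun φ hφ hφc hφs w => ?_⟩
  · exact integral_gradVec hφ hφc hφs lS lx (ContinuousLinearMap.inl ℝ E3 E3) (fun a ha =>
      integral_opS_opK_mul_fderiv hΩ hL hp hp2 hG hhf hGf hg hgf hφ hφc hφs ha hz1) w
  · exact integral_gradVec hφ hφc hφs lS lv (ContinuousLinearMap.inr ℝ E3 E3) (fun b hb =>
      integral_opS_opK_mul_fderiv hΩ hL hp hp2 hG hhf hGf hg hgf hφ hφc hφs hz1 hb) w

lemma exists_sobolevNorm_opS_opK_le (hL : CollisionAssumption ρ γ ν k) {p α : ℝ} (hp : 1 ≤ p)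
    (hp2 : p < 2) (hα0 : 0 ≤ α) (hα : α < (1 - ρ) / 2) :
    ∃ C : ℝ≥0, 0 < C ∧ ∀ Ω, IsConvexC2Domain Ω → ∀ (h g : E3 × E3 → ℝ) (Gx Gv : E3 × E3 → E3),
      HasWeakGradient Ω h Gx Gv → weightedLpNorm p α (phaseMeasure Ω) h < ⊤ →
      weightedLpNorm p α (phaseMeasure Ω) Gx < ⊤ → IsTrace p Ω h g →
      weightedLpNorm p α (boundaryMeasure Ω) g < ⊤ →
      sobolevNorm p α Ω (opS ν Ω (opK k h)) ≤
        C * (ENNReal.ofReal (Metric.diam Ω) ^ (1 / p) * weightedLpNorm p α (phaseMeasure Ω) Gx +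
          weightedLpNorm p α (phaseMeasure Ω) h +
          ENNReal.ofReal (Metric.diam Ω) ^ (1 / p) * weightedLpNorm p α (boundaryMeasure Ω) g) := by
  have hp0 : 0 < p := by linarith
  obtain ⟨C0, hC0⟩ := exists_kernelBound_base hL hp hα0 hα
  obtain ⟨C, hC⟩ := exists_dirDeriv_le hL hp hp2 hα0 hα
  -- Two gradients of three coordinates each account for 6C. The added 1 makes the constant
  -- positive, so that an infinite trace norm makes the final bound infinite.
  refine ⟨C0 ^ (1 / p) + 6 * C + 1, by positivity, fun Ω hΩ h g Gx Gv hG hhf hGf hg hgf => ?_⟩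
  have hhm : AEStronglyMeasurable h (phaseMeasure Ω) := hG.locallyIntegrable.aestronglyMeasurable
  have hGm : AEStronglyMeasurable Gx (phaseMeasure Ω) :=
    hG.locallyIntegrable_x.aestronglyMeasurable
  have hm0 := measurable_interiorKernel hΩ.isOpen (measurable_baseKernel hL)
  have hz1 : ‖(0 : E3)‖ ≤ 1 := by simp
  -- The weak gradient is identified in the unweighted spaces; since α ≥ 0 the weight is at least 1,
  -- so finite weighted norms suffice.
  have h0 : ∀ {F : Type} [NormedAddCommGroup F] {μ : Measure (E3 × E3)} {f : E3 × E3 → F},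
      weightedLpNorm p α μ f < ⊤ → weightedLpNorm p 0 μ f < ⊤ := fun hf =>
    (weightedLpNorm_zero_exponent_le hp0.le hα0 _ _).trans_lt hf
  have hW := hasWeakGradient_opS_opK hΩ hL hp hp2 hG (h0 hhf) (h0 hGf) hg (h0 hgf)
  have hS := (hC0 Ω hΩ).weightedLpNorm_le hp0 hm0 measurable_streamMap hhm
  rw [← weightedLpNorm_congr_ae (opS_opK_ae_eq hΩ hL hp hhm (h0 hhf)),
    ← ENNReal.coe_rpow_of_nonneg _ (by positivity)] at hS
  obtain ⟨-, bx⟩ := weightedLpNorm_gradVec_le hp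
    (D := fun a => dirDeriv Ω ν k a 0 h Gx g)
    fun a ha => hC Ω hΩ a 0 ha hz1 h g Gx hhm hGm hg.1
  obtain ⟨-, bv⟩ := weightedLpNorm_gradVec_le hp
    (D := fun b => dirDeriv Ω ν k 0 b h Gx g)
    fun b hb => hC Ω hΩ 0 b hz1 hb h g Gx hhm hGm hg.1
  have hle : sobolevNorm p α Ω (opS ν Ω (opK k h)) ≤ _ :=
    iInf_le_of_le _ (iInf_le_of_le _ (iInf_le _ hW))
  refine hle.trans ((add_le_add (add_le_add hS bx) bv).trans ?_)
  set d := ENNReal.ofReal (Metric.diam Ω) ^ (1 / p)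
  set X := weightedLpNorm p α (phaseMeasure Ω) h
  set Y := weightedLpNorm p α (phaseMeasure Ω) Gx
  set Z := weightedLpNorm p α (boundaryMeasure Ω) g
  push_cast
  set c0 : ℝ≥0∞ := ((C0 ^ (1 / p) : ℝ≥0) : ℝ≥0∞)
  calc c0 * X + 3 * (C * (X + d * Y + d * Z)) + 3 * (C * (X + d * Y + d * Z))
      = c0 * X + 6 * C * (d * Y + X + d * Z) := by ring
    _ ≤ c0 * (d * Y + X + d * Z) + 6 * C * (d * Y + X + d * Z) + 1 * (d * Y + X + d * Z) := by
        refine le_add_right (add_le_add (mul_le_mul_right ?_ _) le_rfl)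
        exact le_add_self.trans le_self_add
    _ = _ := by ring

lemma IsConvexC2Domain.diam_pos (hΩ : IsConvexC2Domain Ω) : 0 < Metric.diam Ω := by
  obtain ⟨x, hx⟩ := hΩ.nonempty
  refine Metric.diam_pos ?_ hΩ.isBounded
  exact (infinite_of_mem_nhds x (hΩ.isOpen.mem_nhds hx)).nontrivial

/-- Passes an estimate from all competitors to the infimum, with no need for the infimum to be
attained. -/
lemma le_mul_of_forall_lt {A c s e : ℝ≥0∞} (hs : s < ⊤) (hc : c ≠ ⊤)
    (h : ∀ x, s < x → A ≤ c * x + e) : A ≤ c * s + e := by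
  have : (𝓝[>] s).NeBot := nhdsGT_neBot_of_exists_gt ⟨⊤, hs⟩
  have ht : Tendsto (fun x => c * x + e) (𝓝[>] s) (𝓝 (c * s + e)) :=
    (ENNReal.Tendsto.const_mul (tendsto_nhdsWithin_of_tendsto_nhds tendsto_id)
      (Or.inr hc)).add tendsto_const_nhds
  exact ge_of_tendsto ht (by filter_upwards [self_mem_nhdsWithin] with x hx using h x hx)

end

end StationaryBoltzmann

end

theorem lemma1p4 (ρ γ : ℝ) (ν : E3 → ℝ) (k : E3 → E3 → ℝ) (hL : CollisionAssumption ρ γ ν k)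
    (p α : ℝ) (hp1 : 1 ≤ p) (hp2 : p < 2) (hα0 : 0 ≤ α) (hα : α < (1 - ρ) / 2) :
    ∃ C : ℝ≥0, ∀ Ω : Set E3, IsConvexC2Domain Ω →
      ∀ h : E3 × E3 → ℝ, MemSobolev p α Ω h →
        sobolevNorm p α Ω (opS ν Ω (opK k h)) ≤
          C * (ENNReal.ofReal (Metric.diam Ω) ^ (1 / p) * sobolevNorm p α Ω h
            + weightedLpNorm p α (phaseMeasure Ω) h
            + ENNReal.ofReal (Metric.diam Ω) ^ (1 / p) * traceNorm p α Ω h) := by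
  obtain ⟨C, hC0, hC⟩ := exists_sobolevNorm_opS_opK_le hL hp1 hp2 hα0 hα
  refine ⟨C, fun Ω hΩ h hh => ?_⟩
  have hp0 : 0 < p := by linarith
  set d := ENNReal.ofReal (Metric.diam Ω) ^ (1 / p) with hd
  set X := weightedLpNorm p α (phaseMeasure Ω) h
  have hdt : d ≠ ⊤ := ENNReal.rpow_ne_top_of_nonneg (by positivity) ENNReal.ofReal_ne_top
  have hd0 : d ≠ 0 := by
    rw [hd, Ne, ENNReal.rpow_eq_zero_iff_of_pos (by positivity)]
    simpa using hΩ.diam_pos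
  -- An infinite trace norm makes the right side infinite, since neither the constant nor the
  -- diameter vanishes.
  rcases eq_or_ne (traceNorm p α Ω h) ⊤ with ht | ht
  · rw [ht, ENNReal.mul_top hd0, add_top, ENNReal.mul_top (by simpa using hC0.ne')]
    exact le_top
  have hCd : (C : ℝ≥0∞) * d ≠ ⊤ := ENNReal.mul_ne_top ENNReal.coe_ne_top hdt
  have hX : X < ⊤ := (weightedLpNorm_le_sobolevNorm p α Ω h).trans_lt hh
  -- A number above an infimum is beaten by an actual weak gradient, respectively trace, to which
  -- the concrete estimate applies.
  have key : ∀ x, sobolevNorm p α Ω h < x → ∀ y, traceNorm p α Ω h < y →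
      sobolevNorm p α Ω (opS ν Ω (opK k h)) ≤ C * (d * x + X + d * y) := by
    intro x hx y hy
    simp only [sobolevNorm, iInf_lt_iff] at hx
    simp only [traceNorm, iInf_lt_iff] at hy
    obtain ⟨Gx, Gv, hG, hGx⟩ := hx
    obtain ⟨g, hg, hgy⟩ := hy
    have hGle : weightedLpNorm p α (phaseMeasure Ω) Gx < x :=
      (le_add_self.trans le_self_add).trans_lt hGx
    refine (hC Ω hΩ h g Gx Gv hG hX (hGle.trans_le le_top) hg (hgy.trans_le le_top)).trans ?_
    gcongr
  have key2 : ∀ x, sobolevNorm p α Ω h < x →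
      sobolevNorm p α Ω (opS ν Ω (opK k h)) ≤ C * d * x + (C * X + C * d * traceNorm p α Ω h) := by
    intro x hx
    have := le_mul_of_forall_lt (A := sobolevNorm p α Ω (opS ν Ω (opK k h)))
      (e := C * d * x + C * X) (lt_top_iff_ne_top.2 ht) hCd fun y hy =>
      (key x hx y hy).trans (le_of_eq (by ring))
    exact this.trans (le_of_eq (by ring))
  exact (le_mul_of_forall_lt hh hCd key2).trans (le_of_eq (by ring))
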